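/- Let $\mathbb K$ be an algebraically closed field of characteristic zero and $r\ge 1$ an integer. For $n\ge 0$ let $R(n)$ be the Khovanov–Lauda–Rouquier algebra of the Jordan quiver: the $\mathbb Z$-graded $\mathbb K$-algebra with generators $x_1,\dots,x_n$ of degree $2r$ and $\tau_1,\dots,\tau_{n-1}$ of degree $0$, subject to $$x_jx_k=x_kx_j,\quad \tau_k^2=1,\quad \tau_kx_k=x_{k+1}\tau_k,\quad x_k\tau_k=\tau_kx_{k+1},\quad \tau_kx_j=x_j\tau_k\ (j\ne k,k+1),$$ $$\tau_j\tau_k=\tau_k\tau_j\ (|j-k|>1),\qquad \tau_k\tau_{k+1}\tau_k=\tau_{k+1}\tau_k\tau_{k+1}.$$ Put $e_\ell=\frac1{\ell!}\sum_{w\in S_\ell}\tau_w\in R(\ell)$, where $\tau_w$ is the product of the $\tau_k$ along a reduced expression of $w$. For $n=m+\ell$ let $R(m)\to R(n)$ be the inclusion on the first $m$ strands, and let $1_m\otimes e_\ell\in R(n)$ be the element $e_\ell$ placed on the last $\ell$ strands; it commutes with the image of $R(m)$. Define functors between categories of $\mathbb Z$-graded left modules with degree-preserving homomorphisms by $$\mathcal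 F_\ell\colon R(m)\text{-grmod}\to R(n)\text{-grmod},\quad M\mapsto R(n)(1_m\otimes e_\ell)\otimes_{R(m)}M,$$ $$\mathcal E_\ell\colon R(n)\text{-grmod}\to R(m)\text{-grmod},\quad M\mapsto (1_m\otimes e_\ell)M,$$ with $\mathcal E_\ell=0$ on $R(n)$-modules if $n<\ell$. Let $Z_p$ be the algebra of symmetric polynomials over $\mathbb K$ in $p$ variables, each of degree $2r$. Then for all $\ell,t\ge 1$ and every $n\ge 0$ with $n+t\ge\ell$ there is an isomorphism of functors from graded $R(n)$-modules to graded $R(n+t-\ell)$-modules $$\mathcal E_\ell\mathcal F_t\;\simeq\;\bigoplus_{p=0}^{\min\{\ell,t\}}\mathcal F_{t-p}\,\mathcal E_{\ell-p}\otimes_{\mathbb K} Z_p ,$$ where the summands with $\ell-p>n$ are zero. Moreover, for every integer $a\ge 0$ let $R^\Lambda(n)$ be the quotient of $R(n)$ by the two-sided ideal generated by $x_1^a$ (so $R^\Lambda(0)=\mathbb K$), let $\mathcal F^\Lambda_\ell,\mathcal E^\Lambda_\ell$ be defined as above with $R^\Lambda$ in place of $R$, and let $Z_p^\Lambda=\big(\mathbb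 K[x_1,\dots,x_p]/(x_1^a,\dots,x_p^a)\big)^{S_p}$ with each $x_k$ of degree $2r$. Then, for the same $\ell,t,n$, there is an isomorphism of functors from graded $R^\Lambda(n)$-modules to graded $R^\Lambda(n+t-\ell)$-modules $$\mathcal E^\Lambda_\ell\mathcal F^\Lambda_t\;\simeq\;\bigoplus_{p=0}^{\min\{\ell,t\}}\mathcal F^\Lambda_{t-p}\,\mathcal E^\Lambda_{\ell-p}\otimes_{\mathbb K} Z^\Lambda_p ,$$ where again the summands with $\ell-p>n$ are zero. -/

import Mathlib

open CategoryTheory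
open scoped TensorProduct

universe u

namespace JordanKLR

noncomputable section

/-! ## Gradings of vector spaces: auxiliary facts

A `ℤ`-grading of a `K`-vector space `M` is a family `ℳ : ℤ → Submodule K M` with
`DirectSum.IsInternal ℳ`. -/

section Gradings

variable {K : Type*} [Field K] {M N V : Type*} [AddCommGroup M] [Module K M]
  [AddCommGroup N] [Module K N] [AddCommGroup V] [Module K V]

/-- The projection of a graded vector space onto its piece of degree `d`. -/
def gproj {ℳ : ℤ → Submodule K M} (h : DirectSum.IsInternal ℳ) (d : ℤ) : M →ₗ[K] M :=
  (ℳ d).subtype ∘ₗ DirectSum.component K ℤ (fun i => ℳ i) d ∘ₗ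
    (LinearEquiv.ofBijective (DirectSum.coeLinearMap ℳ) h).symm.toLinearMap

theorem gproj_mem {ℳ : ℤ → Submodule K M} (h : DirectSum.IsInternal ℳ) (d : ℤ) (m : M) :
    gproj h d m ∈ ℳ d :=
  Subtype.property _

theorem gproj_same {ℳ : ℤ → Submodule K M} (h : DirectSum.IsInternal ℳ) {d : ℤ} {m : M}
    (hm : m ∈ ℳ d) : gproj h d m = m :=
  congrArg Subtype.val (h.ofBijective_coeLinearMap_of_mem hm)

theorem gproj_ne {ℳ : ℤ → Submodule K M} (h : DirectSum.IsInternal ℳ) {c d : ℤ} (hcd : c ≠ d)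
    {m : M} (hm : m ∈ ℳ c) : gproj h d m = 0 :=
  congrArg Subtype.val (h.ofBijective_coeLinearMap_of_mem_ne hcd hm)

theorem hom_induction {ℳ : ℤ → Submodule K M} (h : ⨆ i, ℳ i = ⊤) {P : M → Prop}
    (mem : ∀ i, ∀ x ∈ ℳ i, P x) (zero : P 0) (add : ∀ x y, P x → P y → P (x + y)) (m : M) :
    P m :=
  Submodule.iSup_induction ℳ (motive := P) (h ▸ Submodule.mem_top : m ∈ ⨆ i, ℳ i) mem zero add

theorem isInternal_of_proj (ℳ : ℤ → Submodule K M) (p : ℤ → M →ₗ[K] M) (hsup : ⨆ i, ℳ i = ⊤)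
    (h1 : ∀ d, ∀ m ∈ ℳ d, p d m = m) (h2 : ∀ c d, c ≠ d → ∀ m ∈ ℳ c, p d m = 0) :
    DirectSum.IsInternal ℳ := by
  refine DirectSum.isInternal_submodule_of_iSupIndep_of_iSup_eq_top ?_ hsup
  intro d
  rw [Submodule.disjoint_def]
  intro x hx hx'
  have hle : (⨆ (j) (_ : j ≠ d), ℳ j) ≤ LinearMap.ker (p d) :=
    iSup₂_le fun j hj m hm => h2 j d hj m hm
  rw [← h1 d x hx]
  exact hle hx'

theorem gproj_comm {ℳ : ℤ → Submodule K M} {𝒩 : ℤ → Submodule K N}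
    (hM : DirectSum.IsInternal ℳ) (hN : DirectSum.IsInternal 𝒩) (f : M →ₗ[K] N)
    (hf : ∀ d, ∀ m ∈ ℳ d, f m ∈ 𝒩 d) (d : ℤ) (m : M) : f (gproj hM d m) = gproj hN d (f m) := by
  induction m using hom_induction hM.submodule_iSup_eq_top with
  | mem i x hx =>
    by_cases hi : i = d
    · subst hi
      rw [gproj_same hM hx, gproj_same hN (hf _ _ hx)]
    · rw [gproj_ne hM hi hx, gproj_ne hN hi (hf _ _ hx), map_zero]
  | zero => simp
  | add x y hx hy => simp [hx, hy]

/-- A subspace of a graded space that is stable under the projections is graded. -/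
theorem isInternal_comap {ℳ : ℤ → Submodule K M} (hM : DirectSum.IsInternal ℳ) (f : N →ₗ[K] M)
    (hf : Function.Injective f) (h : ∀ d x, ∃ y, f y = gproj hM d (f x)) :
    DirectSum.IsInternal (fun d => (ℳ d).comap f) := by
  let e := LinearEquiv.ofInjective f hf
  let p : ℤ → N →ₗ[K] N := fun d =>
    e.symm.toLinearMap ∘ₗ ((gproj hM d ∘ₗ f).codRestrict (LinearMap.range f) fun x => h d x)
  have hp : ∀ d x, f (p d x) = gproj hM d (f x) := fun d x =>
    congrArg Subtype.val (e.apply_symm_apply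
      (((gproj hM d ∘ₗ f).codRestrict (LinearMap.range f) fun x => h d x) x))
  refine isInternal_of_proj _ p ?_ ?_ ?_
  · rw [eq_top_iff]
    intro x _
    classical
    let s := (LinearEquiv.ofBijective (DirectSum.coeLinearMap ℳ) hM).symm (f x)
    have hs : f x = ∑ d ∈ s.support, gproj hM d (f x) := by
      conv_lhs => rw [← (LinearEquiv.ofBijective (DirectSum.coeLinearMap ℳ) hM).apply_symm_apply
        (f x)]
      exact DirectSum.coeLinearMap_eq_dfinsuppSum ℳ s
    have hx : x = ∑ d ∈ s.support, p d x := by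
      apply hf
      rw [map_sum]
      simp_rw [hp]
      exact hs
    rw [hx]
    refine Submodule.sum_mem _ fun d _ => Submodule.mem_iSup_of_mem d ?_
    rw [Submodule.mem_comap, hp]
    exact gproj_mem hM d _
  · intro d m hm
    apply hf
    rw [hp, gproj_same hM hm]
  · intro c d hcd m hm
    apply hf
    rw [hp, gproj_ne hM hcd hm, map_zero]

/-- A quotient of a graded space by a subspace stable under the projections is graded. -/
theorem isInternal_map {ℳ : ℤ → Submodule K M} (hM : DirectSum.IsInternal ℳ) (f : M →ₗ[K] N)
    (hf : Function.Surjective f) (h : ∀ d x, f x = 0 → f (gproj hM d x) = 0) :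
    DirectSum.IsInternal (fun d => (ℳ d).map f) := by
  let e := f.quotKerEquivOfSurjective hf
  let p : ℤ → N →ₗ[K] N := fun d =>
    ((LinearMap.ker f).liftQ (f ∘ₗ gproj hM d) fun x hx => h d x hx) ∘ₗ e.symm.toLinearMap
  have hp : ∀ d x, p d (f x) = f (gproj hM d x) := by
    intro d x
    have : e.symm (f x) = (LinearMap.ker f).mkQ x := by
      rw [LinearEquiv.symm_apply_eq]
      rfl
    show ((LinearMap.ker f).liftQ (f ∘ₗ gproj hM d) fun x hx => h d x hx) (e.symm (f x)) = _
    rw [this]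
    rfl
  refine isInternal_of_proj _ p ?_ ?_ ?_
  · rw [← Submodule.map_iSup, hM.submodule_iSup_eq_top, Submodule.map_top,
      LinearMap.range_eq_top.2 hf]
  · rintro d _ ⟨x, hx, rfl⟩
    rw [hp, gproj_same hM hx]
  · rintro c d hcd _ ⟨x, hx, rfl⟩
    rw [hp, gproj_ne hM hcd hx, map_zero]

/-- The total grading on `M ⊗ V`: degree `d` is spanned by the `m ⊗ v` with
`deg m + deg v = d`. -/
def tensorGrade (ℳ : ℤ → Submodule K M) (𝒱 : ℤ → Submodule K V) (d : ℤ) :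
    Submodule K (M ⊗[K] V) :=
  Submodule.span K {x | ∃ i j m v, i + j = d ∧ m ∈ ℳ i ∧ v ∈ 𝒱 j ∧ m ⊗ₜ[K] v = x}

theorem tmul_mem {ℳ : ℤ → Submodule K M} {𝒱 : ℤ → Submodule K V} {i j d : ℤ} {m : M} {v : V}
    (hd : i + j = d) (hm : m ∈ ℳ i) (hv : v ∈ 𝒱 j) : m ⊗ₜ[K] v ∈ tensorGrade ℳ 𝒱 d :=
  Submodule.subset_span ⟨i, j, m, v, hd, hm, hv, rfl⟩

theorem isInternal_tensor {ℳ : ℤ → Submodule K M} {𝒱 : ℤ → Submodule K V}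
    (hM : DirectSum.IsInternal ℳ) (hV : DirectSum.IsInternal 𝒱) :
    DirectSum.IsInternal (tensorGrade ℳ 𝒱) := by
  let Φ : ℤ → M →ₗ[K] V →ₗ[K] M ⊗[K] V := fun d =>
    DirectSum.toModule K ℤ (V →ₗ[K] M ⊗[K] V) (fun i =>
      (LinearMap.lcomp K (M ⊗[K] V) (gproj hV (d - i))) ∘ₗ (TensorProduct.mk K M V) ∘ₗ
        (ℳ i).subtype) ∘ₗ
      (LinearEquiv.ofBijective (DirectSum.coeLinearMap ℳ) hM).symm.toLinearMap
  have hΦ : ∀ d i m v, m ∈ ℳ i → Φ d m v = m ⊗ₜ gproj hV (d - i) v := by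
    intro d i m v hm
    have : (LinearEquiv.ofBijective (DirectSum.coeLinearMap ℳ) hM).symm m
        = DirectSum.lof K ℤ (fun i => ℳ i) i ⟨m, hm⟩ := by
      rw [LinearEquiv.symm_apply_eq]
      exact (DirectSum.coeLinearMap_lof (A := ℳ) i ⟨m, hm⟩).symm
    simp only [Φ, LinearMap.comp_apply, LinearEquiv.coe_coe, this, DirectSum.toModule_lof]
    rfl
  refine isInternal_of_proj _ (fun d => TensorProduct.lift (Φ d)) ?_ ?_ ?_
  · rw [eq_top_iff]
    intro x hx
    clear hx
    induction x using TensorProduct.induction_on with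
    | zero => exact zero_mem _
    | add x y hx hy => exact add_mem hx hy
    | tmul m v =>
      induction m using hom_induction hM.submodule_iSup_eq_top with
      | zero => simp
      | add x y hx hy => rw [TensorProduct.add_tmul]; exact add_mem hx hy
      | mem i m hm =>
        induction v using hom_induction hV.submodule_iSup_eq_top with
        | zero => simp
        | add x y hx hy => rw [TensorProduct.tmul_add]; exact add_mem hx hy
        | mem j v hv => exact Submodule.mem_iSup_of_mem (i + j) (tmul_mem rfl hm hv)
  · intro d x hx
    have : tensorGrade ℳ 𝒱 d ≤ LinearMap.eqLocus (TensorProduct.lift (Φ d)) LinearMap.id := by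
      refine Submodule.span_le.2 ?_
      rintro _ ⟨i, j, m, v, rfl, hm, hv, rfl⟩
      show TensorProduct.lift (Φ (i + j)) (m ⊗ₜ v) = m ⊗ₜ v
      rw [TensorProduct.lift.tmul, hΦ _ i _ _ hm, add_sub_cancel_left, gproj_same hV hv]
    exact this hx
  · intro c d hcd x hx
    have : tensorGrade ℳ 𝒱 c ≤ LinearMap.ker (TensorProduct.lift (Φ d)) := by
      refine Submodule.span_le.2 ?_
      rintro _ ⟨i, j, m, v, rfl, hm, hv, rfl⟩
      show TensorProduct.lift (Φ d) (m ⊗ₜ v) = 0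
      rw [TensorProduct.lift.tmul, hΦ _ i _ _ hm, gproj_ne hV (by omega) hv,
        TensorProduct.tmul_zero]
    exact this hx

theorem map_tensorGrade {M' V' : Type*} [AddCommGroup M'] [Module K M'] [AddCommGroup V']
    [Module K V'] {ℳ : ℤ → Submodule K M} {𝒱 : ℤ → Submodule K V} {ℳ' : ℤ → Submodule K M'}
    {𝒱' : ℤ → Submodule K V'} (f : M ⊗[K] V →ₗ[K] M' ⊗[K] V') (s : ℤ)
    (hf : ∀ k l x v, x ∈ ℳ k → v ∈ 𝒱 l → f (x ⊗ₜ v) ∈ tensorGrade ℳ' 𝒱' (s + (k + l)))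
    {d : ℤ} {m : M ⊗[K] V} (hm : m ∈ tensorGrade ℳ 𝒱 d) : f m ∈ tensorGrade ℳ' 𝒱' (s + d) := by
  have : tensorGrade ℳ 𝒱 d ≤ (tensorGrade ℳ' 𝒱' (s + d)).comap f := by
    refine Submodule.span_le.2 ?_
    rintro _ ⟨k, l, x, v, rfl, hx, hv, rfl⟩
    exact hf k l x v hx hv
  exact this hm

/-- The grading of a finite direct sum. -/
theorem isInternal_pi {J : Type*} [Fintype J] {M : J → Type*} [∀ j, AddCommGroup (M j)]
    [∀ j, Module K (M j)] {ℳ : ∀ j, ℤ → Submodule K (M j)}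
    (h : ∀ j, DirectSum.IsInternal (ℳ j)) :
    DirectSum.IsInternal (fun d => Submodule.pi Set.univ fun j => ℳ j d) := by
  classical
  refine isInternal_of_proj _
    (fun d => LinearMap.pi fun j => gproj (h j) d ∘ₗ LinearMap.proj j) ?_ ?_ ?_
  · rw [eq_top_iff]
    intro x _
    rw [← Finset.univ_sum_single x]
    refine Submodule.sum_mem _ fun j _ => ?_
    generalize x j = y
    induction y using hom_induction (h j).submodule_iSup_eq_top with
    | zero => simp
    | add x y hx hy => rw [Pi.single_add]; exact add_mem hx hy
    | mem i m hm =>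
      refine Submodule.mem_iSup_of_mem i ?_
      rw [Submodule.mem_pi]
      intro k _
      by_cases hk : k = j
      · subst hk; simpa using hm
      · simp [hk]
  · intro d m hm
    funext j
    exact gproj_same (h j) (hm j trivial)
  · intro c d hcd m hm
    funext j
    exact gproj_ne (h j) hcd (hm j trivial)

end Gradings

/-! ## Graded modules -/

/-- A `ℤ`-graded `K`-vector space. -/
structure GrSpace (K : Type u) [Field K] where
  carrier : Type u
  [addCommGroup : AddCommGroup carrier]
  [module : Module K carrier]
  grade : ℤ → Submodule K carrier
  isInternal : DirectSum.IsInternal grade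

attribute [instance] GrSpace.addCommGroup GrSpace.module

/-- A `ℤ`-graded left module over the graded `K`-algebra `A = ⨁ 𝒜 d`. -/
structure GrMod {K : Type u} [Field K] {A : Type u} [Ring A] [Algebra K A]
    (𝒜 : ℤ → Submodule K A) where
  carrier : Type u
  [addCommGroup : AddCommGroup carrier]
  [moduleBase : Module K carrier]
  [module : Module A carrier]
  [tower : IsScalarTower K A carrier]
  grade : ℤ → Submodule K carrier
  isInternal : DirectSum.IsInternal grade
  smul_mem : ∀ {i j : ℤ} {a : A} {m : carrier}, a ∈ 𝒜 i → m ∈ grade j → a • m ∈ grade (i + j)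

attribute [instance] GrMod.addCommGroup GrMod.moduleBase GrMod.module GrMod.tower

section Modules

variable {K : Type u} [Field K] {A : Type u} [Ring A] [Algebra K A] {𝒜 : ℤ → Submodule K A}
  {B : Type u} [Ring B] [Algebra K B] {ℬ : ℤ → Submodule K B}

/-- Morphisms of graded modules: module homomorphisms that preserve degrees. -/
@[ext]
structure GrMod.Hom (M N : GrMod 𝒜) where
  toLin : M.carrier →ₗ[A] N.carrier
  map_grade : ∀ (d : ℤ) (m : M.carrier), m ∈ M.grade d → toLin m ∈ N.grade d

/-- The category of graded modules, with degree-preserving homomorphisms. -/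
instance : Category (GrMod 𝒜) where
  Hom M N := GrMod.Hom M N
  id M := ⟨LinearMap.id, fun _ _ h => h⟩
  comp f g := ⟨g.toLin ∘ₗ f.toLin, fun d m h => g.map_grade d _ (f.map_grade d m h)⟩

@[ext]
theorem GrMod.hom_ext {M N : GrMod 𝒜} {f g : M ⟶ N} (h : ∀ x, f.toLin x = g.toLin x) : f = g :=
  GrMod.Hom.ext (LinearMap.ext h)

@[simp] theorem GrMod.id_toLin (M : GrMod 𝒜) : GrMod.Hom.toLin (𝟙 M) = LinearMap.id := rfl

@[simp] theorem GrMod.comp_toLin {M N P : GrMod 𝒜} (f : M ⟶ N) (g : N ⟶ P) :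
    GrMod.Hom.toLin (f ≫ g) = g.toLin ∘ₗ f.toLin := rfl

/-- The (external) direct sum of a finite family of graded modules. -/
def GrMod.dsum {J : Type} [Fintype J] (M : J → GrMod 𝒜) : GrMod 𝒜 where
  carrier := ∀ j, (M j).carrier
  grade d := Submodule.pi Set.univ fun j => (M j).grade d
  isInternal := isInternal_pi fun j => (M j).isInternal
  smul_mem ha hm := fun j _ => (M j).smul_mem ha (hm j trivial)

/-- The direct sum of a finite family of functors into graded modules, formed objectwise. -/
def dsumFunctor {C : Type*} [Category C] {J : Type} [Fintype J] (F : J → (C ⥤ GrMod 𝒜)) :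
    C ⥤ GrMod 𝒜 where
  obj X := GrMod.dsum fun j => (F j).obj X
  map f := ⟨LinearMap.pi fun j => ((F j).map f).toLin ∘ₗ LinearMap.proj j,
    fun d m hm j _ => ((F j).map f).map_grade d _ (hm j trivial)⟩
  map_id X := by
    apply GrMod.hom_ext
    intro x
    funext j
    show ((F j).map (𝟙 X)).toLin (x j) = x j
    rw [(F j).map_id]
    rfl
  map_comp f g := by
    apply GrMod.hom_ext
    intro x
    funext j
    show ((F j).map (f ≫ g)).toLin (x j) = ((F j).map g).toLin (((F j).map f).toLin (x j))
    rw [(F j).map_comp]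
    rfl

/-- The graded module `M ⊗_K V` for a graded vector space `V`: the algebra acts on the left
factor, and the grading is the total one. -/
def tensorObj (V : GrSpace K) (M : GrMod 𝒜) : GrMod 𝒜 where
  carrier := M.carrier ⊗[K] V.carrier
  grade := tensorGrade M.grade V.grade
  isInternal := isInternal_tensor M.isInternal V.isInternal
  smul_mem := fun {i _ a _} ha hm =>
    map_tensorGrade (Module.toModuleEnd K (M.carrier ⊗[K] V.carrier) a) i
      (fun k l _ _ hx hv => tmul_mem (add_assoc i k l) (M.smul_mem ha hx) hv) hm

/-- The morphism `f ⊗ id`. -/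
def tensorMap (V : GrSpace K) {M N : GrMod 𝒜} (f : M ⟶ N) : tensorObj V M ⟶ tensorObj V N :=
  GrMod.Hom.mk (M := tensorObj V M) (N := tensorObj V N)
    (TensorProduct.AlgebraTensorModule.map f.toLin LinearMap.id) (fun d m hm => by
      have h := map_tensorGrade (ℳ' := N.grade) (𝒱' := V.grade)
        ((TensorProduct.AlgebraTensorModule.map f.toLin
          (LinearMap.id (R := K) (M := V.carrier))).restrictScalars K) 0
        (fun k l x v hx hv => tmul_mem (zero_add (k + l)).symm (f.map_grade _ _ hx) hv) hm
      rw [zero_add] at h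
      exact h)

/-- The functor `M ↦ M ⊗_K V`. -/
def tensorFunctor (𝒜 : ℤ → Submodule K A) (V : GrSpace K) : GrMod 𝒜 ⥤ GrMod 𝒜 where
  obj := tensorObj V
  map := tensorMap V
  map_id M := by
    apply GrMod.hom_ext
    intro (x : M.carrier ⊗[K] V.carrier)
    exact congrArg (fun f => f x) (TensorProduct.AlgebraTensorModule.map_id
      (R := K) (A := A) (M := M.carrier) (N := V.carrier))
  map_comp {M N P} f g := by
    apply GrMod.hom_ext
    intro (x : M.carrier ⊗[K] V.carrier)
    induction x using TensorProduct.induction_on with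
    | zero => exact (map_zero _).trans (map_zero _).symm
    | tmul m v => rfl
    | add x y hx hy => exact (map_add _ x y).trans ((congrArg₂ _ hx hy).trans (map_add _ x y).symm)

/-! ## Induction and restriction along an algebra map and a commuting element of degree zero -/

/-- A degree-preserving algebra homomorphism `ι : A → B` together with an element `e ∈ B` of
degree zero that commutes with the image of `ι`.  In the applications `ι` is the inclusion of
the algebra on the first strands, and `e` is an idempotent supported on the last strands. -/
structure Corner (𝒜 : ℤ → Submodule K A) (ℬ : ℤ → Submodule K B) where
  ι : A →ₐ[K] B
  e : B
  ι_mem : ∀ (d : ℤ) (a : A), a ∈ 𝒜 d → ι a ∈ ℬ d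
  e_mem : e ∈ ℬ 0
  comm : ∀ a, Commute e (ι a)

namespace Corner

variable (c : Corner 𝒜 ℬ)

section Res

/-- The subspace `e M` of `M`. -/
def eSub (M : GrMod ℬ) : Submodule K M.carrier := LinearMap.range (Module.toModuleEnd K M.carrier c.e)

theorem mem_eSub {M : GrMod ℬ} {m : M.carrier} : m ∈ c.eSub M ↔ ∃ x, c.e • x = m := Iff.rfl

theorem ι_smul_mem {M : GrMod ℬ} (a : A) {m : M.carrier} (hm : m ∈ c.eSub M) :
    c.ι a • m ∈ c.eSub M := by
  obtain ⟨x, rfl⟩ := c.mem_eSub.1 hm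
  exact ⟨c.ι a • x, by
    show c.e • c.ι a • x = c.ι a • c.e • x
    rw [smul_smul, (c.comm a).eq, smul_smul]⟩

/-- `e M` as an `A`-module, `A` acting through `ι`. -/
instance eSubModule (M : GrMod ℬ) : Module A (c.eSub M) where
  smul a m := ⟨c.ι a • (m : M.carrier), c.ι_smul_mem a m.2⟩
  one_smul m := Subtype.ext (by show c.ι 1 • (m : M.carrier) = m; simp)
  mul_smul a b m := Subtype.ext (by
    show c.ι (a * b) • (m : M.carrier) = c.ι a • c.ι b • (m : M.carrier)
    rw [map_mul, mul_smul])
  smul_zero a := Subtype.ext (smul_zero (c.ι a))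
  smul_add a m n := Subtype.ext (smul_add (c.ι a) (m : M.carrier) n)
  add_smul a b m := Subtype.ext (by
    show c.ι (a + b) • (m : M.carrier) = c.ι a • (m : M.carrier) + c.ι b • (m : M.carrier)
    rw [map_add, add_smul])
  zero_smul m := Subtype.ext (by show c.ι 0 • (m : M.carrier) = 0; simp)

theorem coe_smul (M : GrMod ℬ) (a : A) (m : c.eSub M) :
    ((a • m : c.eSub M) : M.carrier) = c.ι a • (m : M.carrier) := rfl

instance (M : GrMod ℬ) : IsScalarTower K A (c.eSub M) where
  smul_assoc k a m := Subtype.ext (by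
    rw [coe_smul, map_smul, smul_assoc]; rfl)

theorem e_smul_gproj (M : GrMod ℬ) (d : ℤ) (x : M.carrier) :
    c.e • gproj M.isInternal d x = gproj M.isInternal d (c.e • x) :=
  gproj_comm M.isInternal M.isInternal (Module.toModuleEnd K M.carrier c.e)
    (fun d m hm => by
      have := M.smul_mem c.e_mem hm
      rwa [zero_add] at this) d x

/-- The functor `M ↦ e M` from graded `B`-modules to graded `A`-modules.
The piece of degree `d` of `e M` is the intersection of `e M` with that of `M`. -/
def res : GrMod ℬ ⥤ GrMod 𝒜 where
  obj M :=
    { carrier := c.eSub M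
      grade := fun d => (M.grade d).comap (c.eSub M).subtype
      isInternal := isInternal_comap M.isInternal (c.eSub M).subtype Subtype.val_injective (by
        rintro d ⟨_, x, rfl⟩
        exact ⟨⟨_, gproj M.isInternal d x, rfl⟩, c.e_smul_gproj M d x⟩)
      smul_mem := fun {i j a m} ha hm => M.smul_mem (c.ι_mem i a ha) hm }
  map {M N} f :=
    { toLin :=
        { toFun := fun m => ⟨f.toLin m, by
            obtain ⟨_, x, rfl⟩ := m
            exact ⟨f.toLin x, (map_smul f.toLin c.e x).symm⟩⟩
          map_add' := fun x y => Subtype.ext (map_add f.toLin _ _)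
          map_smul' := fun a x => Subtype.ext (map_smul f.toLin (c.ι a) (x : M.carrier)) }
      map_grade := fun d m hm => f.map_grade d _ hm }
  map_id M := rfl
  map_comp f g := rfl

end Res

section Ind

/-- The left ideal `B e` of `B`. -/
def ideal : Submodule B B := Submodule.span B {c.e}

theorem mul_ι_mem {b : B} (hb : b ∈ c.ideal) (a : A) : b * c.ι a ∈ c.ideal := by
  obtain ⟨x, rfl⟩ := Submodule.mem_span_singleton.1 hb
  refine Submodule.mem_span_singleton.2 ⟨x * c.ι a, ?_⟩
  simp only [smul_eq_mul, mul_assoc, (c.comm a).eq]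

/-- The right action of `a : A` on `B e`. -/
def rmul (b : c.ideal) (a : A) : c.ideal := ⟨b * c.ι a, c.mul_ι_mem b.2 a⟩

/-- The relations `b a ⊗ m = b ⊗ a m` that define `B e ⊗_A M` as a quotient of
`B e ⊗_K M`. -/
def indRel (M : GrMod 𝒜) : Submodule B (c.ideal ⊗[K] M.carrier) :=
  Submodule.span B {x | ∃ b a m, x = c.rmul b a ⊗ₜ[K] m - b ⊗ₜ[K] (a • m)}

/-- The `B`-module `B e ⊗_A M`. -/
abbrev IndCarrier (M : GrMod 𝒜) : Type u := (c.ideal ⊗[K] M.carrier) ⧸ c.indRel M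

/-- The grading of `B e` inherited from `B`. -/
def idealGrade (d : ℤ) : Submodule K c.ideal := (ℬ d).comap (c.ideal.subtype.restrictScalars K)

/-- The projection of `B e ⊗_K M` onto `B e ⊗_A M`. -/
def indMk (M : GrMod 𝒜) : c.ideal ⊗[K] M.carrier →ₗ[K] c.IndCarrier M :=
  (c.indRel M).mkQ.restrictScalars K

/-- The grading of `B e ⊗_A M`: the piece of degree `d` is spanned by the `b ⊗ m` with
`deg b + deg m = d`. -/
def indGrade (M : GrMod 𝒜) (d : ℤ) : Submodule K (c.IndCarrier M) :=
  (tensorGrade c.idealGrade M.grade d).map (c.indMk M)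

/-- The homomorphism `id ⊗ f` from `B e ⊗_K M` to `B e ⊗_K N`. -/
def indPre {M N : GrMod 𝒜} (f : M ⟶ N) :
    c.ideal ⊗[K] M.carrier →ₗ[B] c.ideal ⊗[K] N.carrier :=
  TensorProduct.AlgebraTensorModule.map LinearMap.id (f.toLin.restrictScalars K)

theorem indPre_rel {M N : GrMod 𝒜} (f : M ⟶ N) :
    c.indRel M ≤ (c.indRel N).comap (c.indPre f) := by
  refine Submodule.span_le.2 ?_
  rintro _ ⟨b, a, m, rfl⟩
  refine Submodule.subset_span ⟨b, a, f.toLin m, ?_⟩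
  rw [map_sub]
  show c.rmul b a ⊗ₜ[K] f.toLin m - b ⊗ₜ[K] f.toLin (a • m) = _
  rw [map_smul]

variable [GradedAlgebra ℬ]

theorem isInternal_ideal : DirectSum.IsInternal c.idealGrade := by
  refine isInternal_comap (DirectSum.Decomposition.isInternal ℬ)
    (c.ideal.subtype.restrictScalars K) Subtype.val_injective ?_
  rintro d ⟨x, hx⟩
  obtain ⟨y, rfl⟩ := Submodule.mem_span_singleton.1 hx
  refine ⟨⟨gproj (DirectSum.Decomposition.isInternal ℬ) d y * c.e,
    Submodule.mem_span_singleton.2 ⟨_, rfl⟩⟩, ?_⟩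
  exact gproj_comm (DirectSum.Decomposition.isInternal ℬ) (DirectSum.Decomposition.isInternal ℬ)
    (LinearMap.mulRight K c.e) (fun d m hm => by
      have := SetLike.GradedMul.mul_mem hm c.e_mem
      rwa [add_zero] at this) d y

theorem gproj_tmul_of_mem {M : GrMod 𝒜} {i j : ℤ} {b : c.ideal} {m : M.carrier}
    (hb : b ∈ c.idealGrade i) (hm : m ∈ M.grade j) (d : ℤ) :
    gproj (isInternal_tensor c.isInternal_ideal M.isInternal) d (b ⊗ₜ[K] m)
      = if i + j = d then b ⊗ₜ[K] m else 0 := by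
  split_ifs with h
  · exact gproj_same _ (tmul_mem h hb hm)
  · exact gproj_ne _ h (tmul_mem rfl hb hm)

theorem smul_mem_indGrade (M : GrMod 𝒜) {i j : ℤ} {b : B} {m : c.IndCarrier M} (hb : b ∈ ℬ i)
    (hm : m ∈ c.indGrade M j) : b • m ∈ c.indGrade M (i + j) := by
  obtain ⟨x, hx, rfl⟩ := hm
  refine ⟨b • x, ?_, rfl⟩
  exact map_tensorGrade (ℳ' := c.idealGrade) (𝒱' := M.grade)
    (Module.toModuleEnd K (c.ideal ⊗[K] M.carrier) b) i
    (fun k l x v hx hv => tmul_mem (m := b • x) (v := v) (add_assoc i k l)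
      (show b • x ∈ c.idealGrade (i + k) from SetLike.GradedMul.mul_mem (A := ℬ) hb hx) hv) hx

variable [GradedAlgebra 𝒜]

theorem gproj_rel_mem (M : GrMod 𝒜) (d : ℤ) (b : c.ideal) (a : A) (m : M.carrier) :
    gproj (isInternal_tensor c.isInternal_ideal M.isInternal) d
      (c.rmul b a ⊗ₜ[K] m - b ⊗ₜ[K] (a • m)) ∈ c.indRel M := by
  have hr0 : ∀ a, c.rmul 0 a = 0 := fun a => Subtype.ext (zero_mul _)
  have hr0' : ∀ b, c.rmul b 0 = 0 := fun b => Subtype.ext (by simp [rmul])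
  have hra : ∀ b b' a, c.rmul (b + b') a = c.rmul b a + c.rmul b' a :=
    fun b b' a => Subtype.ext (add_mul _ _ _)
  have hra' : ∀ b a a', c.rmul b (a + a') = c.rmul b a + c.rmul b a' :=
    fun b a a' => Subtype.ext (by simp [rmul, mul_add])
  induction b using hom_induction c.isInternal_ideal.submodule_iSup_eq_top with
  | zero => simp [hr0]
  | add b b' hb hb' =>
    rw [hra, TensorProduct.add_tmul, TensorProduct.add_tmul, add_sub_add_comm, map_add]
    exact add_mem hb hb'
  | mem i b hb =>
    induction a using hom_induction (DirectSum.Decomposition.isInternal 𝒜).submodule_iSup_eq_top with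
    | zero => simp [hr0']
    | add a a' ha ha' =>
      rw [hra', TensorProduct.add_tmul, add_smul, TensorProduct.tmul_add, add_sub_add_comm, map_add]
      exact add_mem ha ha'
    | mem j a ha =>
      induction m using hom_induction M.isInternal.submodule_iSup_eq_top with
      | zero => simp
      | add m m' hm hm' =>
        rw [TensorProduct.tmul_add, smul_add, TensorProduct.tmul_add, add_sub_add_comm, map_add]
        exact add_mem hm hm'
      | mem k m hm =>
        have h1 : c.rmul b a ∈ c.idealGrade (i + j) :=
          SetLike.GradedMul.mul_mem (A := ℬ) hb (c.ι_mem j a ha)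
        rw [map_sub, c.gproj_tmul_of_mem h1 hm,
          c.gproj_tmul_of_mem hb (M.smul_mem ha hm), add_assoc]
        split_ifs
        · exact Submodule.subset_span ⟨b, a, m, rfl⟩
        · simp

theorem gproj_mem_indRel (M : GrMod 𝒜) (d : ℤ) {x : c.ideal ⊗[K] M.carrier}
    (hx : x ∈ c.indRel M) :
    gproj (isInternal_tensor c.isInternal_ideal M.isInternal) d x ∈ c.indRel M := by
  suffices H : ∀ b' : B,
      gproj (isInternal_tensor c.isInternal_ideal M.isInternal) d (b' • x) ∈ c.indRel M by
    simpa using H 1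
  refine Submodule.span_induction (p := fun x _ => ∀ b' : B,
    gproj (isInternal_tensor c.isInternal_ideal M.isInternal) d (b' • x) ∈ c.indRel M)
    ?_ ?_ ?_ ?_ hx
  · rintro _ ⟨b, a, m, rfl⟩ b'
    have h : b' • (c.rmul b a ⊗ₜ[K] m - b ⊗ₜ[K] (a • m))
        = c.rmul (b' • b) a ⊗ₜ[K] m - (b' • b) ⊗ₜ[K] (a • m) := by
      rw [smul_sub, TensorProduct.smul_tmul', TensorProduct.smul_tmul']
      congr 2
      exact Subtype.ext (mul_assoc _ _ _).symm
    rw [h]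
    exact c.gproj_rel_mem M d _ _ _
  · intro b'
    simp
  · intro x y _ _ hx hy b'
    rw [smul_add, map_add]
    exact add_mem (hx b') (hy b')
  · intro b x _ hx b'
    rw [smul_smul]
    exact hx _

theorem isInternal_indGrade (M : GrMod 𝒜) : DirectSum.IsInternal (c.indGrade M) :=
  isInternal_map (isInternal_tensor c.isInternal_ideal M.isInternal) (c.indMk M)
    (c.indRel M).mkQ_surjective (fun d x hx => by
      have h : x ∈ c.indRel M := (Submodule.Quotient.mk_eq_zero _).1 hx
      exact (Submodule.Quotient.mk_eq_zero _).2 (c.gproj_mem_indRel M d h))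

/-- The graded `B`-module `B e ⊗_A M`. -/
def indObj (M : GrMod 𝒜) : GrMod ℬ where
  carrier := c.IndCarrier M
  grade := c.indGrade M
  isInternal := c.isInternal_indGrade M
  smul_mem := c.smul_mem_indGrade M

/-- The homomorphism `id ⊗ f` from `B e ⊗_A M` to `B e ⊗_A N`. -/
def indMap {M N : GrMod 𝒜} (f : M ⟶ N) : c.indObj M ⟶ c.indObj N :=
  GrMod.Hom.mk (M := c.indObj M) (N := c.indObj N)
    (Submodule.mapQ (c.indRel M) (c.indRel N) (c.indPre f) (c.indPre_rel f)) (by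
      rintro d _ ⟨x, hx, rfl⟩
      refine ⟨c.indPre f x, ?_, rfl⟩
      have h := map_tensorGrade (ℳ' := c.idealGrade) (𝒱' := N.grade)
        ((c.indPre f).restrictScalars K) 0
        (fun k l x v hx hv => tmul_mem (zero_add (k + l)).symm hx (f.map_grade _ _ hv)) hx
      rw [zero_add] at h
      exact h)

/-- The functor `M ↦ B e ⊗_A M` from graded `A`-modules to graded `B`-modules. -/
def ind : GrMod 𝒜 ⥤ GrMod ℬ where
  obj := c.indObj
  map := c.indMap
  map_id M := by
    apply GrMod.hom_ext
    intro (x : c.IndCarrier M)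
    obtain ⟨x, rfl⟩ := Submodule.mkQ_surjective _ x
    show (c.indRel M).mkQ (c.indPre (𝟙 M) x) = (c.indRel M).mkQ x
    congr 1
    induction x using TensorProduct.induction_on with
    | zero => exact map_zero _
    | tmul m v => rfl
    | add x y hx hy => rw [map_add, hx, hy]
  map_comp {M N P} f g := by
    apply GrMod.hom_ext
    intro (x : c.IndCarrier M)
    obtain ⟨x, rfl⟩ := Submodule.mkQ_surjective _ x
    show (c.indRel P).mkQ (c.indPre (f ≫ g) x) = (c.indRel P).mkQ (c.indPre g (c.indPre f x))
    congr 1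
    induction x using TensorProduct.induction_on with
    | zero => simp only [map_zero]
    | tmul m v => rfl
    | add x y hx hy => rw [map_add, map_add, map_add, hx, hy]

end Ind

end Corner

end Modules

/-! ## Gradings by word length -/

section Words

variable {K : Type u} [Field K] {A : Type u} [Ring A] [Algebra K A] {B : Type u} [Ring B]
  [Algebra K B] {X Y : Type}

/-- For an algebra with generators `g x` of weight `wt x`, the span of the monomials in the
generators that have total weight `d`. -/
def wordGrade (K : Type u) [Field K] {A : Type u} [Ring A] [Algebra K A] {X : Type} (g : X → A)
    (wt : X → ℤ) (d : ℤ) : Submodule K A :=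
  Submodule.span K {y | ∃ l : List X, (l.map wt).sum = d ∧ (l.map g).prod = y}

theorem word_mem (g : X → A) (wt : X → ℤ) (l : List X) {d : ℤ} (h : (l.map wt).sum = d) :
    (l.map g).prod ∈ wordGrade K g wt d :=
  Submodule.subset_span ⟨l, h, rfl⟩

theorem wordGrade_map (f : A →ₐ[K] B) {g : X → A} {wt : X → ℤ} {g' : Y → B} {wt' : Y → ℤ}
    (σ : X → Y) (hg : ∀ x, f (g x) = g' (σ x)) (hw : ∀ x, wt' (σ x) = wt x) (d : ℤ) (a : A)
    (ha : a ∈ wordGrade K g wt d) : f a ∈ wordGrade K g' wt' d := by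
  have : wordGrade K g wt d ≤ (wordGrade K g' wt' d).comap f.toLinearMap := by
    refine Submodule.span_le.2 ?_
    rintro _ ⟨l, rfl, rfl⟩
    refine Submodule.subset_span ⟨l.map σ, ?_, ?_⟩
    · rw [List.map_map]
      congr 2
      funext x
      exact hw x
    · show _ = f _
      rw [List.map_map, map_list_prod, List.map_map]
      congr 2
      funext x
      exact (hg x).symm
  exact this ha

instance wordGrade_gradedMonoid (g : X → A) (wt : X → ℤ) :
    SetLike.GradedMonoid (wordGrade K g wt) where
  one_mem := word_mem g wt [] rfl
  mul_mem := by
    intro i j a b ha hb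
    have : wordGrade K g wt i * wordGrade K g wt j ≤ wordGrade K g wt (i + j) := by
      rw [wordGrade, wordGrade, Submodule.span_mul_span]
      refine Submodule.span_le.2 ?_
      rintro _ ⟨_, ⟨l, rfl, rfl⟩, _, ⟨l', rfl, rfl⟩, rfl⟩
      refine Submodule.subset_span ⟨l ++ l', ?_, ?_⟩ <;> simp
    exact this (Submodule.mul_mem_mul ha hb)

theorem isInternal_wordGrade (g : X → A) (wt : X → ℤ)
    (hgen : Algebra.adjoin K (Set.range g) = ⊤) (φ : A →ₐ[K] AddMonoidAlgebra A ℤ)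
    (hφ : ∀ x, φ (g x) = AddMonoidAlgebra.single (wt x) (g x)) :
    DirectSum.IsInternal (wordGrade K g wt) := by
  let p : ℤ → A →ₗ[K] A := fun d =>
    { toFun := fun a => (φ a).coeff d
      map_add' := fun a b => by simp
      map_smul' := fun c a => by simp }
  have hw : ∀ l : List X, φ (l.map g).prod
      = AddMonoidAlgebra.single (l.map wt).sum (l.map g).prod := by
    intro l
    induction l with
    | nil => simp [-LaurentPolynomial.single_eq_C_mul_T, AddMonoidAlgebra.one_def]
    | cons x l ih => simp [-LaurentPolynomial.single_eq_C_mul_T, hφ, ih, AddMonoidAlgebra.single_mul_single]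
  refine isInternal_of_proj _ p ?_ ?_ ?_
  · rw [eq_top_iff]
    intro a _
    have ha : a ∈ Algebra.adjoin K (Set.range g) := hgen ▸ Algebra.mem_top
    rw [← Subalgebra.mem_toSubmodule, Algebra.adjoin_eq_span] at ha
    refine Submodule.span_le.2 ?_ ha
    intro y hy
    obtain ⟨L, hL, rfl⟩ := Submonoid.exists_list_of_mem_closure hy
    have hL' : L ∈ Set.range (List.map g) := by
      rw [Set.range_list_map]
      exact hL
    obtain ⟨l, rfl⟩ := hL'
    exact Submodule.mem_iSup_of_mem _ (word_mem g wt _ rfl)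
  · intro d m hm
    have : wordGrade K g wt d ≤ LinearMap.eqLocus (p d) LinearMap.id := by
      refine Submodule.span_le.2 ?_
      rintro _ ⟨l, rfl, rfl⟩
      show (φ (l.map g).prod).coeff _ = _
      rw [hw]
      exact Finsupp.single_eq_same
    exact this hm
  · intro c d hcd m hm
    have : wordGrade K g wt c ≤ LinearMap.ker (p d) := by
      refine Submodule.span_le.2 ?_
      rintro _ ⟨l, rfl, rfl⟩
      show (φ (l.map g).prod).coeff _ = _
      rw [hw]
      exact Finsupp.single_eq_of_ne' hcd
    exact this hm

end Words

/-! ## The algebras `R(n)` of the Jordan quiver -/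

/-- The generators of `R(n)`: dots `x_k` for each of the `n` strands, and crossings `τ_k` of the
strands `k` and `k + 1`.  Strands are numbered from `0`. -/
inductive Gen (n : ℕ) : Type
  | x (k : Fin n) : Gen n
  | tau (k : ℕ) (hk : k + 1 < n) : Gen n

/-- The degrees of the generators: `x_k` has degree `2 r`, and `τ_k` has degree `0`. -/
def Gen.deg (r : ℕ) {n : ℕ} : Gen n → ℤ
  | .x _ => 2 * r
  | .tau _ _ => 0

section Algebras

variable (K : Type u) [Field K]

/-- The dot `x_k` in the free algebra. -/
abbrev fx {n : ℕ} (k : Fin n) : FreeAlgebra K (Gen n) := FreeAlgebra.ι K (Gen.x k)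

/-- The crossing `τ_k` in the free algebra. -/
abbrev ft {n : ℕ} (k : ℕ) (hk : k + 1 < n) : FreeAlgebra K (Gen n) :=
  FreeAlgebra.ι K (Gen.tau k hk)

/-- The defining relations of `R(n)`. -/
inductive KLRRel (n : ℕ) : FreeAlgebra K (Gen n) → FreeAlgebra K (Gen n) → Prop
  | x_comm (j k : Fin n) : KLRRel n (fx K j * fx K k) (fx K k * fx K j)
  | tau_sq (k : ℕ) (hk : k + 1 < n) : KLRRel n (ft K k hk * ft K k hk) 1
  | tau_x (k : ℕ) (hk : k + 1 < n) :
      KLRRel n (ft K k hk * fx K ⟨k, by omega⟩) (fx K ⟨k + 1, hk⟩ * ft K k hk)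
  | x_tau (k : ℕ) (hk : k + 1 < n) :
      KLRRel n (fx K ⟨k, by omega⟩ * ft K k hk) (ft K k hk * fx K ⟨k + 1, hk⟩)
  | tau_x_far (k : ℕ) (hk : k + 1 < n) (j : Fin n) (h1 : (j : ℕ) ≠ k) (h2 : (j : ℕ) ≠ k + 1) :
      KLRRel n (ft K k hk * fx K j) (fx K j * ft K k hk)
  | tau_far (j k : ℕ) (hj : j + 1 < n) (hk : k + 1 < n) (h : j + 1 < k) :
      KLRRel n (ft K j hj * ft K k hk) (ft K k hk * ft K j hj)
  | braid (k : ℕ) (hk : k + 1 + 1 < n) :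
      KLRRel n (ft K k (by omega) * ft K (k + 1) hk * ft K k (by omega))
        (ft K (k + 1) hk * ft K k (by omega) * ft K (k + 1) hk)

/-- The Khovanov-Lauda-Rouquier algebra `R(n)` of the Jordan quiver. -/
def KLR (n : ℕ) : Type u := RingQuot (KLRRel K n)

instance (n : ℕ) : Ring (KLR K n) := inferInstanceAs (Ring (RingQuot (KLRRel K n)))

instance (n : ℕ) : Algebra K (KLR K n) := inferInstanceAs (Algebra K (RingQuot (KLRRel K n)))

/-- The quotient map from the free algebra. -/
def klrMk (n : ℕ) : FreeAlgebra K (Gen n) →ₐ[K] KLR K n := RingQuot.mkAlgHom K (KLRRel K n)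

/-- The images of the generators in `R(n)`. -/
def gen (n : ℕ) (g : Gen n) : KLR K n := klrMk K n (FreeAlgebra.ι K g)

/-- The cyclotomic relation `x_1 ^ a = 0` (void for `n = 0`). -/
inductive CycRel (n a : ℕ) : KLR K n → KLR K n → Prop
  | mk (h : 0 < n) : CycRel n a (gen K n (Gen.x ⟨0, h⟩) ^ a) 0

/-- The cyclotomic quotient `R^Λ(n)`, where `a = Λ(h_i)`: the quotient of `R(n)` by the two-sided
ideal generated by `x_1 ^ a`. -/
def CycKLR (n a : ℕ) : Type u := RingQuot (CycRel K n a)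

instance (n a : ℕ) : Ring (CycKLR K n a) := inferInstanceAs (Ring (RingQuot (CycRel K n a)))

instance (n a : ℕ) : Algebra K (CycKLR K n a) :=
  inferInstanceAs (Algebra K (RingQuot (CycRel K n a)))

/-- The quotient map `R(n) → R^Λ(n)`. -/
def cycMk (n a : ℕ) : KLR K n →ₐ[K] CycKLR K n a := RingQuot.mkAlgHom K (CycRel K n a)

/-- The images of the generators in `R^Λ(n)`. -/
def cycGen (n a : ℕ) (g : Gen n) : CycKLR K n a := cycMk K n a (gen K n g)

/-- The grading of `R(n)`. -/
def klrGrade (r n : ℕ) : ℤ → Submodule K (KLR K n) := wordGrade K (gen K n) (Gen.deg r)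

/-- The grading of `R^Λ(n)`. -/
def cycGrade (r n a : ℕ) : ℤ → Submodule K (CycKLR K n a) :=
  wordGrade K (cycGen K n a) (Gen.deg r)

variable {K}

theorem klrMk_surjective (n : ℕ) : Function.Surjective (klrMk K n) :=
  RingQuot.mkAlgHom_surjective K _

theorem klrMk_rel {n : ℕ} {u v : FreeAlgebra K (Gen n)} (h : KLRRel K n u v) :
    klrMk K n u = klrMk K n v :=
  RingQuot.mkAlgHom_rel K h

/-- The universal property of `R(n)`. -/
def klrLift {n : ℕ} {B : Type u} [Ring B] [Algebra K B] (f : Gen n → B)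
    (hf : ∀ ⦃u v⦄, KLRRel K n u v → FreeAlgebra.lift K f u = FreeAlgebra.lift K f v) :
    KLR K n →ₐ[K] B :=
  RingQuot.liftAlgHom K ⟨FreeAlgebra.lift K f, hf⟩

theorem klrLift_gen {n : ℕ} {B : Type u} [Ring B] [Algebra K B] (f : Gen n → B)
    (hf : ∀ ⦃u v⦄, KLRRel K n u v → FreeAlgebra.lift K f u = FreeAlgebra.lift K f v)
    (g : Gen n) : klrLift f hf (gen K n g) = f g :=
  (RingQuot.liftAlgHom_mkAlgHom_apply (S := K) (FreeAlgebra.lift K f) hf _).trans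
    (FreeAlgebra.lift_ι_apply f g)

theorem cycMk_surjective (n a : ℕ) : Function.Surjective (cycMk K n a) :=
  RingQuot.mkAlgHom_surjective K _

/-- The universal property of `R^Λ(n)`. -/
def cycLift {n a : ℕ} {B : Type u} [Ring B] [Algebra K B] (f : KLR K n →ₐ[K] B)
    (hf : ∀ h : 0 < n, f (gen K n (Gen.x ⟨0, h⟩)) ^ a = 0) : CycKLR K n a →ₐ[K] B :=
  RingQuot.liftAlgHom K ⟨f, by
    rintro _ _ ⟨h⟩
    rw [map_pow, map_zero, hf]⟩

theorem cycLift_mk {n a : ℕ} {B : Type u} [Ring B] [Algebra K B] (f : KLR K n →ₐ[K] B)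
    (hf : ∀ h : 0 < n, f (gen K n (Gen.x ⟨0, h⟩)) ^ a = 0) (y : KLR K n) :
    cycLift f hf (cycMk K n a y) = f y :=
  RingQuot.liftAlgHom_mkAlgHom_apply (S := K) f _ y

theorem adjoin_gen (n : ℕ) : Algebra.adjoin K (Set.range (gen K n)) = ⊤ := by
  have h : Set.range (gen K n) = klrMk K n '' Set.range (FreeAlgebra.ι K) := by
    rw [← Set.range_comp]; rfl
  rw [h, ← AlgHom.map_adjoin, FreeAlgebra.adjoin_range_ι, Algebra.map_top,
    AlgHom.range_eq_top]
  exact klrMk_surjective n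

theorem adjoin_cycGen (n a : ℕ) : Algebra.adjoin K (Set.range (cycGen K n a)) = ⊤ := by
  have h : Set.range (cycGen K n a) = cycMk K n a '' Set.range (gen K n) := by
    rw [← Set.range_comp]; rfl
  rw [h, ← AlgHom.map_adjoin, adjoin_gen, Algebra.map_top, AlgHom.range_eq_top]
  exact cycMk_surjective n a

section Rels

variable {n : ℕ}

theorem x_comm (j k : Fin n) :
    gen K n (.x j) * gen K n (.x k) = gen K n (.x k) * gen K n (.x j) := by
  simpa [gen] using klrMk_rel (KLRRel.x_comm (K := K) j k)

theorem tau_sq (k : ℕ) (hk : k + 1 < n) : gen K n (.tau k hk) * gen K n (.tau k hk) = 1 := by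
  simpa [gen] using klrMk_rel (KLRRel.tau_sq (K := K) k hk)

theorem tau_x (k : ℕ) (hk : k + 1 < n) :
    gen K n (.tau k hk) * gen K n (.x ⟨k, by omega⟩)
      = gen K n (.x ⟨k + 1, hk⟩) * gen K n (.tau k hk) := by
  simpa [gen] using klrMk_rel (KLRRel.tau_x (K := K) k hk)

theorem x_tau (k : ℕ) (hk : k + 1 < n) :
    gen K n (.x ⟨k, by omega⟩) * gen K n (.tau k hk)
      = gen K n (.tau k hk) * gen K n (.x ⟨k + 1, hk⟩) := by
  simpa [gen] using klrMk_rel (KLRRel.x_tau (K := K) k hk)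

theorem tau_x_far (k : ℕ) (hk : k + 1 < n) (j : Fin n) (h1 : (j : ℕ) ≠ k)
    (h2 : (j : ℕ) ≠ k + 1) :
    gen K n (.tau k hk) * gen K n (.x j) = gen K n (.x j) * gen K n (.tau k hk) := by
  simpa [gen] using klrMk_rel (KLRRel.tau_x_far (K := K) k hk j h1 h2)

theorem tau_far (j k : ℕ) (hj : j + 1 < n) (hk : k + 1 < n) (h : j + 1 < k) :
    gen K n (.tau j hj) * gen K n (.tau k hk) = gen K n (.tau k hk) * gen K n (.tau j hj) := by
  simpa [gen] using klrMk_rel (KLRRel.tau_far (K := K) j k hj hk h)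

theorem braid (k : ℕ) (hk : k + 1 + 1 < n) :
    gen K n (.tau k (by omega)) * gen K n (.tau (k + 1) hk) * gen K n (.tau k (by omega))
      = gen K n (.tau (k + 1) hk) * gen K n (.tau k (by omega)) * gen K n (.tau (k + 1) hk) := by
  simpa [gen] using klrMk_rel (KLRRel.braid (K := K) k hk)

end Rels

/-- The algebra map `R(n) → R(n)[T, T⁻¹]` that multiplies a homogeneous element of degree `d`
by `T ^ d`. -/
def klrCoaction (r n : ℕ) : KLR K n →ₐ[K] AddMonoidAlgebra (KLR K n) ℤ :=
  klrLift (fun g => AddMonoidAlgebra.single (Gen.deg r g) (gen K n g)) (by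
      intro u v h
      cases h with
      | x_comm j k => simp [-LaurentPolynomial.single_eq_C_mul_T, AddMonoidAlgebra.single_mul_single, Gen.deg, x_comm j k]
      | tau_sq k hk => simp [-LaurentPolynomial.single_eq_C_mul_T, AddMonoidAlgebra.single_mul_single, Gen.deg, tau_sq k hk,
          AddMonoidAlgebra.one_def]
      | tau_x k hk => simp [-LaurentPolynomial.single_eq_C_mul_T, AddMonoidAlgebra.single_mul_single, Gen.deg, tau_x k hk]
      | x_tau k hk => simp [-LaurentPolynomial.single_eq_C_mul_T, AddMonoidAlgebra.single_mul_single, Gen.deg, x_tau k hk]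
      | tau_x_far k hk j h1 h2 =>
        simp [-LaurentPolynomial.single_eq_C_mul_T, AddMonoidAlgebra.single_mul_single, Gen.deg, tau_x_far k hk j h1 h2]
      | tau_far j k hj hk h =>
        simp [-LaurentPolynomial.single_eq_C_mul_T, AddMonoidAlgebra.single_mul_single, Gen.deg, tau_far j k hj hk h]
      | braid k hk => simp [-LaurentPolynomial.single_eq_C_mul_T, AddMonoidAlgebra.single_mul_single, Gen.deg, braid k hk])

theorem klrCoaction_gen (r n : ℕ) (g : Gen n) :
    klrCoaction r n (gen K n g) = AddMonoidAlgebra.single (Gen.deg r g) (gen K n g) :=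
  klrLift_gen _ _ g

theorem isInternal_klrGrade (r n : ℕ) : DirectSum.IsInternal (klrGrade K r n) :=
  isInternal_wordGrade _ _ (adjoin_gen n) (klrCoaction r n) (klrCoaction_gen r n)

theorem x_pow_eq_zero {n : ℕ} (a : ℕ) (h : 0 < n) :
    cycGen K n a (Gen.x ⟨0, h⟩) ^ a = 0 := by
  have : cycMk K n a (gen K n (Gen.x ⟨0, h⟩) ^ a) = cycMk K n a 0 :=
    RingQuot.mkAlgHom_rel K (CycRel.mk h)
  rwa [map_pow, map_zero] at this

/-- The analogous map for `R^Λ(n)`. -/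
def cycCoaction (r n a : ℕ) : CycKLR K n a →ₐ[K] AddMonoidAlgebra (CycKLR K n a) ℤ :=
  cycLift ((AddMonoidAlgebra.mapAlgHom ℤ (cycMk K n a)).comp (klrCoaction r n)) (by
    intro h
    have := x_pow_eq_zero (K := K) a h
    rw [cycGen] at this
    simp [-LaurentPolynomial.single_eq_C_mul_T, klrCoaction_gen, AddMonoidAlgebra.single_pow, this])

theorem cycCoaction_gen (r n a : ℕ) (g : Gen n) :
    cycCoaction r n a (cycGen K n a g)
      = AddMonoidAlgebra.single (Gen.deg r g) (cycGen K n a g) := by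
  rw [cycGen, cycCoaction, cycLift_mk]
  simp [-LaurentPolynomial.single_eq_C_mul_T, klrCoaction_gen]

theorem isInternal_cycGrade (r n a : ℕ) : DirectSum.IsInternal (cycGrade K r n a) :=
  isInternal_wordGrade _ _ (adjoin_cycGen n a) (cycCoaction r n a) (cycCoaction_gen r n a)

instance klrGradedAlgebra (r n : ℕ) : GradedAlgebra (klrGrade K r n) where
  toGradedMonoid := wordGrade_gradedMonoid _ _
  toDecomposition := (isInternal_klrGrade r n).chooseDecomposition

instance cycGradedAlgebra (r n a : ℕ) : GradedAlgebra (cycGrade K r n a) where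
  toGradedMonoid := wordGrade_gradedMonoid _ _
  toDecomposition := (isInternal_cycGrade r n a).chooseDecomposition

/-! ### Inclusion on the first strands -/

/-- The inclusion of generators for `m ≤ n`. -/
def Gen.castLE {m n : ℕ} (h : m ≤ n) : Gen m → Gen n
  | .x k => .x (k.castLE h)
  | .tau k hk => .tau k (by omega)

/-- The map `R(m) → R(n)`, `y ↦ y ⊗ 1`, that adds `n - m` vertical strands on the right. -/
def incl {m n : ℕ} (h : m ≤ n) : KLR K m →ₐ[K] KLR K n :=
  klrLift (fun g => gen K n (g.castLE h)) (by
      intro u v hr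
      cases hr with
      | x_comm j k => simpa [Gen.castLE] using x_comm (K := K) (n := n) _ _
      | tau_sq k hk => simpa [Gen.castLE] using tau_sq (K := K) (n := n) k (by omega)
      | tau_x k hk => simpa [Gen.castLE] using tau_x (K := K) (n := n) k (by omega)
      | x_tau k hk => simpa [Gen.castLE] using x_tau (K := K) (n := n) k (by omega)
      | tau_x_far k hk j h1 h2 => simpa [Gen.castLE] using tau_x_far (K := K) (n := n) k (by omega) (j.castLE h) h1 h2
      | tau_far j k hj hk h_ => simpa [Gen.castLE] using tau_far (K := K) (n := n) j k (by omega) (by omega) h_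
      | braid k hk => simpa [Gen.castLE] using braid (K := K) (n := n) k (by omega))

theorem incl_gen {m n : ℕ} (h : m ≤ n) (g : Gen m) :
    incl h (gen K m g) = gen K n (g.castLE h) :=
  klrLift_gen _ _ g

/-- The induced map `R^Λ(m) → R^Λ(n)`. -/
def cycIncl (a : ℕ) {m n : ℕ} (h : m ≤ n) : CycKLR K m a →ₐ[K] CycKLR K n a :=
  cycLift ((cycMk K n a).comp (incl h)) (by
    intro hm
    rw [AlgHom.comp_apply, incl_gen]
    exact x_pow_eq_zero a (hm.trans_le h))

theorem cycIncl_gen (a : ℕ) {m n : ℕ} (h : m ≤ n) (g : Gen m) :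
    cycIncl a h (cycGen K m a g) = cycGen K n a (g.castLE h) := by
  rw [cycGen, cycIncl, cycLift_mk, AlgHom.comp_apply, incl_gen, cycGen]

/-! ### The idempotents `1_m ⊗ e_ℓ` -/

/-- The transposition of `k` and `k + 1`. -/
def adjSwap {ℓ : ℕ} (k : {k : ℕ // k + 1 < ℓ}) : Equiv.Perm (Fin ℓ) :=
  Equiv.swap ⟨k, by have := k.2; omega⟩ ⟨k + 1, k.2⟩

theorem exists_word {ℓ : ℕ} (w : Equiv.Perm (Fin ℓ)) :
    ∃ l : List {k : ℕ // k + 1 < ℓ}, (l.map adjSwap).prod = w := by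
  cases ℓ with
  | zero => exact ⟨[], Subsingleton.elim _ _⟩
  | succ n =>
    have hw : w ∈ Submonoid.closure (Set.range fun i : Fin n => Equiv.swap i.castSucc i.succ) := by
      rw [Equiv.Perm.mclosure_swap_castSucc_succ]; trivial
    induction hw using Submonoid.closure_induction with
    | mem y hy =>
      obtain ⟨i, rfl⟩ := hy
      exact ⟨[⟨i, by omega⟩], by simp [adjSwap]; rfl⟩
    | one => exact ⟨[], rfl⟩
    | mul u v _ _ hu hv =>
      obtain ⟨l, rfl⟩ := hu
      obtain ⟨l', rfl⟩ := hv
      exact ⟨l ++ l', by simp⟩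

theorem exists_redWord {ℓ : ℕ} (w : Equiv.Perm (Fin ℓ)) :
    ∃ l : List {k : ℕ // k + 1 < ℓ}, (l.map adjSwap).prod = w ∧
      ∀ l' : List {k : ℕ // k + 1 < ℓ}, (l'.map adjSwap).prod = w → l.length ≤ l'.length := by
  classical
  obtain ⟨l₀, h₀⟩ := exists_word w
  have H : ∃ N, ∃ l : List {k : ℕ // k + 1 < ℓ}, (l.map adjSwap).prod = w ∧ l.length = N :=
    ⟨_, l₀, h₀, rfl⟩
  obtain ⟨l, hl, hN⟩ := Nat.find_spec H
  exact ⟨l, hl, fun l' hl' => hN ▸ Nat.find_min' H ⟨l', hl', rfl⟩⟩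

/-- A reduced expression of `w` in adjacent transpositions. -/
def redWord {ℓ : ℕ} (w : Equiv.Perm (Fin ℓ)) : List {k : ℕ // k + 1 < ℓ} :=
  (exists_redWord w).choose

/-- The generator of `R(n)` given by the crossing `τ_k` of `R(ℓ)` placed to the right of `m`
vertical strands. -/
def shiftTau {m ℓ n : ℕ} (h : m + ℓ = n) (k : {k : ℕ // k + 1 < ℓ}) : Gen n :=
  .tau (m + k) (by have := k.2; omega)

variable (K) in
/-- The element `1_m ⊗ τ_w` of `R(n)`, for `n = m + ℓ` and `w ∈ S_ℓ`. -/
def tauPerm {m ℓ n : ℕ} (h : m + ℓ = n) (w : Equiv.Perm (Fin ℓ)) : KLR K n :=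
  (((redWord w).map (shiftTau h)).map (gen K n)).prod

variable (K) in
/-- The element `1_m ⊗ e_ℓ` of `R(n)`, for `n = m + ℓ`, where `e_ℓ = (1 / ℓ!) ∑ τ_w` with `w`
running through `S_ℓ`. -/
def symIdem {m ℓ n : ℕ} (h : m + ℓ = n) : KLR K n :=
  (ℓ.factorial : K)⁻¹ • ∑ w : Equiv.Perm (Fin ℓ), tauPerm K h w

theorem symIdem_mem (r : ℕ) {m ℓ n : ℕ} (h : m + ℓ = n) : symIdem K h ∈ klrGrade K r n 0 := by
  refine Submodule.smul_mem _ _ (Submodule.sum_mem _ fun w _ => ?_)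
  refine word_mem _ _ _ ?_
  rw [List.map_map]
  refine List.sum_eq_zero fun y hy => ?_
  obtain ⟨k, _, rfl⟩ := List.mem_map.1 hy
  rfl

theorem symIdem_comm {m ℓ n : ℕ} (h : m + ℓ = n) (y : KLR K m) :
    Commute (symIdem K h) (incl (by omega) y) := by
  have hgen : ∀ g : Gen m, Commute (symIdem K h) (incl (by omega) (gen K m g)) := by
    intro g
    rw [incl_gen]
    refine Commute.smul_left (Commute.sum_left _ _ _ fun w _ => ?_) _
    refine Commute.list_prod_left _ _ fun z hz => ?_
    obtain ⟨_, hz', rfl⟩ := List.mem_map.1 hz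
    obtain ⟨k, _, rfl⟩ := List.mem_map.1 hz'
    cases g with
    | x j =>
      have := j.2
      exact tau_x_far _ _ _ (by simp; omega) (by simp; omega)
    | tau j hj => exact (tau_far _ _ _ _ (by omega)).symm
  have hy : y ∈ Algebra.adjoin K (Set.range (gen K m)) := adjoin_gen (K := K) m ▸ Algebra.mem_top
  induction hy using Algebra.adjoin_induction with
  | mem y hy =>
    obtain ⟨g, rfl⟩ := hy
    exact hgen g
  | algebraMap c =>
    rw [AlgHom.commutes]
    exact (Algebra.commutes c _).symm
  | add u v _ _ hu hv =>
    rw [map_add]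
    exact hu.add_right hv
  | mul u v _ _ hu hv =>
    rw [map_mul]
    exact hu.mul_right hv

theorem Gen.deg_castLE (r : ℕ) {m n : ℕ} (h : m ≤ n) (g : Gen m) :
    Gen.deg r (g.castLE h) = Gen.deg r g := by
  cases g <;> rfl

variable (K) in
/-- The inclusion `R(m) → R(n)` on the first `m` strands and the idempotent `1_m ⊗ e_ℓ`, where
`n = m + ℓ`. -/
def corner (r : ℕ) {m ℓ n : ℕ} (h : m + ℓ = n) : Corner (klrGrade K r m) (klrGrade K r n) where
  ι := incl (by omega)
  e := symIdem K h
  ι_mem := wordGrade_map _ (Gen.castLE (by omega)) (incl_gen _) (Gen.deg_castLE r _)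
  e_mem := symIdem_mem r h
  comm := symIdem_comm h

variable (K) in
/-- The same data for the cyclotomic quotients. -/
def cycCorner (r a : ℕ) {m ℓ n : ℕ} (h : m + ℓ = n) :
    Corner (cycGrade K r m a) (cycGrade K r n a) where
  ι := cycIncl a (by omega)
  e := cycMk K n a (symIdem K h)
  ι_mem := wordGrade_map _ (Gen.castLE (by omega)) (cycIncl_gen a _) (Gen.deg_castLE r _)
  e_mem := wordGrade_map (cycMk K n a) id (fun _ => rfl) (fun _ => rfl) 0 _ (symIdem_mem r h)
  comm := by
    intro y
    obtain ⟨y, rfl⟩ := cycMk_surjective m a y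
    rw [cycIncl, cycLift_mk]
    exact (symIdem_comm h y).map (cycMk K n a)

end Algebras

/-! ## The functors `E_ℓ` and `F_ℓ` -/

section Functors

variable (K : Type u) [Field K]

/-- `F_ℓ : M ↦ R(n) (1_m ⊗ e_ℓ) ⊗_{R(m)} M`, from graded `R(m)`-modules to graded
`R(n)`-modules, where `n = m + ℓ`. -/
def functorF (r : ℕ) {m ℓ n : ℕ} (h : m + ℓ = n) :
    GrMod (klrGrade K r m) ⥤ GrMod (klrGrade K r n) :=
  (corner K r h).ind

/-- `E_ℓ : M ↦ (1_m ⊗ e_ℓ) M`, from graded `R(n)`-modules to graded `R(m)`-modules, where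
`n = m + ℓ`. -/
def functorE (r : ℕ) {m ℓ n : ℕ} (h : m + ℓ = n) :
    GrMod (klrGrade K r n) ⥤ GrMod (klrGrade K r m) :=
  (corner K r h).res

/-- `F^Λ_ℓ : M ↦ R^Λ(n) (1_m ⊗ e_ℓ) ⊗_{R^Λ(m)} M`, where `n = m + ℓ` and `a = Λ(h_i)`. -/
def cycFunctorF (r a : ℕ) {m ℓ n : ℕ} (h : m + ℓ = n) :
    GrMod (cycGrade K r m a) ⥤ GrMod (cycGrade K r n a) :=
  (cycCorner K r a h).ind

/-- `E^Λ_ℓ : M ↦ (1_m ⊗ e_ℓ) M`, where `n = m + ℓ` and `a = Λ(h_i)`. -/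
def cycFunctorE (r a : ℕ) {m ℓ n : ℕ} (h : m + ℓ = n) :
    GrMod (cycGrade K r n a) ⥤ GrMod (cycGrade K r m a) :=
  (cycCorner K r a h).res

end Functors

/-! ## The graded spaces `Z_p` and `Z_p^Λ` -/

section SymmetricPolynomials

variable (K : Type u) [Field K]

/-- The grading of `K[x_1, …, x_p]` in which every variable has degree `2 r`. -/
def polyGrade (r p : ℕ) : ℤ → Submodule K (MvPolynomial (Fin p) K) :=
  MvPolynomial.weightedHomogeneousSubmodule K fun _ => (2 * r : ℤ)

theorem isInternal_polyGrade (r p : ℕ) : DirectSum.IsInternal (polyGrade K r p) :=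
  @DirectSum.Decomposition.isInternal _ _ _ _ _ _ _ _
    (MvPolynomial.weightedDecomposition K (fun _ : Fin p => (2 * r : ℤ)))

theorem rename_mem (r p : ℕ) (σ : Equiv.Perm (Fin p)) (d : ℤ) (f : MvPolynomial (Fin p) K)
    (hf : f ∈ polyGrade K r p d) : MvPolynomial.rename σ f ∈ polyGrade K r p d := by
  intro c hc
  obtain ⟨c', rfl, hc'⟩ := MvPolynomial.coeff_rename_ne_zero _ _ _ hc
  rw [← hf hc', Finsupp.weight_apply, Finsupp.weight_apply]
  exact Finsupp.sum_mapDomain_index (by simp) (by simp [add_mul])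

/-- `Z_p`: the graded space of symmetric polynomials in `p` variables of degree `2 r`. -/
def symSpace (r p : ℕ) : GrSpace K where
  carrier := MvPolynomial.symmetricSubalgebra (Fin p) K
  grade := fun d => (polyGrade K r p d).comap
    (MvPolynomial.symmetricSubalgebra (Fin p) K).val.toLinearMap
  isInternal := isInternal_comap (isInternal_polyGrade K r p) _ Subtype.val_injective (by
    rintro d ⟨f, hf⟩
    refine ⟨⟨gproj (isInternal_polyGrade K r p) d f, fun σ => ?_⟩, rfl⟩
    have h := gproj_comm (isInternal_polyGrade K r p) (isInternal_polyGrade K r p)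
      (MvPolynomial.rename σ).toLinearMap (rename_mem K r p σ) d f
    refine h.trans (congrArg _ ?_)
    exact hf σ)

/-- The ideal `(x_1 ^ a, …, x_p ^ a)` of `K[x_1, …, x_p]`. -/
def powIdeal (p a : ℕ) : Ideal (MvPolynomial (Fin p) K) :=
  Ideal.span (Set.range fun i => MvPolynomial.X i ^ a)

/-- The truncated polynomial algebra `K[x_1, …, x_p] / (x_1 ^ a, …, x_p ^ a)`. -/
abbrev TruncPoly (p a : ℕ) : Type u := MvPolynomial (Fin p) K ⧸ powIdeal K p a

theorem powIdeal_le (p a : ℕ) (σ : Equiv.Perm (Fin p)) :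
    powIdeal K p a ≤ (powIdeal K p a).comap (MvPolynomial.rename σ) := by
  refine Ideal.span_le.2 ?_
  rintro _ ⟨i, rfl⟩
  refine Ideal.subset_span ⟨σ i, ?_⟩
  simp

/-- The action of `S_p` on the truncated polynomial algebra by permutation of the variables. -/
def permTrunc (p a : ℕ) (σ : Equiv.Perm (Fin p)) : TruncPoly K p a →ₐ[K] TruncPoly K p a :=
  Ideal.quotientMapₐ _ (MvPolynomial.rename σ) (powIdeal_le K p a σ)

/-- The algebra `(K[x_1, …, x_p] / (x_1 ^ a, …, x_p ^ a)) ^ S_p` of invariants. -/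
def truncInv (p a : ℕ) : Subalgebra K (TruncPoly K p a) :=
  ⨅ σ : Equiv.Perm (Fin p), AlgHom.equalizer (permTrunc K p a σ) (AlgHom.id K _)

theorem mem_truncInv {p a : ℕ} {z : TruncPoly K p a} :
    z ∈ truncInv K p a ↔ ∀ σ, permTrunc K p a σ z = z := by
  simp [truncInv, Algebra.mem_iInf, AlgHom.mem_equalizer]

/-- The grading of the truncated polynomial algebra. -/
def truncGrade (r p a : ℕ) (d : ℤ) : Submodule K (TruncPoly K p a) :=
  (polyGrade K r p d).map (Ideal.Quotient.mkₐ K (powIdeal K p a)).toLinearMap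

theorem gproj_mem_powIdeal (r p a : ℕ) (d : ℤ) {f : MvPolynomial (Fin p) K}
    (hf : f ∈ powIdeal K p a) : gproj (isInternal_polyGrade K r p) d f ∈ powIdeal K p a := by
  suffices H : ∀ g, gproj (isInternal_polyGrade K r p) d (g * f) ∈ powIdeal K p a by
    simpa using H 1
  refine Submodule.span_induction (p := fun f _ => ∀ g,
    gproj (isInternal_polyGrade K r p) d (g * f) ∈ powIdeal K p a) ?_ ?_ ?_ ?_ hf
  · rintro _ ⟨i, rfl⟩ g
    have hX : (MvPolynomial.X i ^ a : MvPolynomial (Fin p) K) ∈ powIdeal K p a :=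
      Ideal.subset_span ⟨i, rfl⟩
    have hXd : (MvPolynomial.X i ^ a : MvPolynomial (Fin p) K)
        ∈ polyGrade K r p (a • (2 * r : ℤ)) :=
      (MvPolynomial.isWeightedHomogeneous_X K (fun _ : Fin p => (2 * r : ℤ)) i).pow a
    induction g using hom_induction (isInternal_polyGrade K r p).submodule_iSup_eq_top with
    | zero => simp
    | add x y hx hy =>
      rw [add_mul, map_add]
      exact add_mem hx hy
    | mem j g hg =>
      have hm : g * MvPolynomial.X i ^ a ∈ polyGrade K r p (j + a • (2 * r : ℤ)) :=
        MvPolynomial.IsWeightedHomogeneous.mul hg hXd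
      by_cases hd : j + a • (2 * r : ℤ) = d
      · subst hd
        rw [gproj_same _ hm]
        exact Ideal.mul_mem_left _ _ hX
      · rw [gproj_ne _ hd hm]
        exact zero_mem _
  · intro g
    simp
  · intro x y _ _ hx hy g
    rw [mul_add, map_add]
    exact add_mem (hx g) (hy g)
  · intro c x _ hx g
    rw [smul_eq_mul, ← mul_assoc]
    exact hx _

theorem isInternal_truncGrade (r p a : ℕ) : DirectSum.IsInternal (truncGrade K r p a) :=
  isInternal_map (isInternal_polyGrade K r p) _ Ideal.Quotient.mk_surjective (fun d _ hx =>
    Ideal.Quotient.eq_zero_iff_mem.2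
      (gproj_mem_powIdeal K r p a d (Ideal.Quotient.eq_zero_iff_mem.1 hx)))

/-- `Z_p^Λ`: the graded space of `S_p`-invariants in `K[x_1, …, x_p] / (x_1 ^ a, …, x_p ^ a)`,
with variables of degree `2 r`. -/
def truncSpace (r p a : ℕ) : GrSpace K where
  carrier := truncInv K p a
  grade := fun d => (truncGrade K r p a d).comap (truncInv K p a).val.toLinearMap
  isInternal := isInternal_comap (isInternal_truncGrade K r p a) _ Subtype.val_injective (by
    rintro d ⟨z, hz⟩
    refine ⟨⟨gproj (isInternal_truncGrade K r p a) d z, (mem_truncInv K).2 fun σ => ?_⟩, rfl⟩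
    have h := gproj_comm (isInternal_truncGrade K r p a) (isInternal_truncGrade K r p a)
      (permTrunc K p a σ).toLinearMap (by
        rintro d _ ⟨f, hf, rfl⟩
        exact ⟨MvPolynomial.rename σ f, rename_mem K r p σ d f hf, rfl⟩) d z
    refine h.trans (congrArg _ ?_)
    exact (mem_truncInv K).1 hz σ)

end SymmetricPolynomials

/-- The indices `p ∈ {0, …, min ℓ t}` for which `E_{ℓ - p}` is defined on `R(n)`-modules, that
is `ℓ - p ≤ n`.  (For the other `p` the functor `E_{ℓ - p}` vanishes on `R(n)`-modules.) -/
abbrev SummandIndex (ℓ t n : ℕ) : Type := {p : Fin (min ℓ t + 1) // ℓ - (p : ℕ) ≤ n}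

theorem SummandIndex.left {ℓ t n : ℕ} (p : SummandIndex ℓ t n) :
    (n - (ℓ - p.1)) + (ℓ - p.1) = n :=
  Nat.sub_add_cancel p.2

theorem SummandIndex.right {ℓ t n m : ℕ} (h : m + ℓ = n + t) (p : SummandIndex ℓ t n) :
    (n - (ℓ - p.1)) + (t - p.1) = m := by
  have h1 := p.2
  have h2 := p.1.2
  omega

end

end JordanKLR

open JordanKLR

/-!
The proof treats `R(n)` and its cyclotomic quotients `R^Λ(n)` at the same time, as instances of a
`KLRSystem`: a family of quotients of the `R(n)` by the relations `x_1 ^ a = 0` for `a` in a set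
`s`, which is empty for `R(n)` and `{a}` for `R^Λ(n)`.  By conjugation every dot satisfies these
relations, so the algebra of dots on `p` strands is a quotient `DotAlg K s p` of the polynomial
algebra, whose invariants are `Z_p` and `Z_p^Λ` respectively (`SymDots`).

Put `N = n + t = m + ℓ`.  The space `E_ℓ F_t M` is `e_ℓ R(N) e_t ⊗_{R(n)} M`.  Since `R(N)` is
spanned by the products of a permutation and dots (`mem_span_rho_mul_x`), this space is governed by
the double cosets of `S_m × S_ℓ` and `S_n × S_t` in `S_N`.  These are represented by the exchanges
`w_p` of two neighbouring blocks of `ℓ - p` and `t - p` strands (`blockSwap`,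
`exists_double_coset`), where `p` strands run from the last `t` to the last `ℓ` positions.  The
intertwiners `τ_{w_p} z` with `z ∈ Z_p` commute with the actions of the first `n + p - ℓ` strands,
and they yield natural maps `F_{t-p} E_{ℓ-p} M ⊗ Z_p → E_ℓ F_t M` (`Square.natTrans`,
`KLRSystem.square`).  It remains to show that the sum of these maps over `p` is bijective: a
bijective degree-preserving homomorphism is an isomorphism of graded modules, whence the theorem
(`nonempty_iso_dsumFunctor`).

*Surjectivity.*  By the double coset decomposition, `E_ℓ F_t M` is spanned over `R(m)` by elements
`e_ℓ τ_{w_p} x_{i_1} ⋯ x_{i_q} e_t ⊗ l`.  Dots on the first `n` strands are absorbed into `l`, those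
on the next `t - p` strands move through `w_p` to `R(m)`, and those on the last `p` strands can be
symmetrized because `e_ℓ` and `e_t` absorb the permutations of these strands
(`e_smul_twine_mem_range`).

*Injectivity.*  No basis of `R(N)` is needed.  For commuting operators `X_i` on a space `V`, the
algebra `R(N)` acts on the functions `S_N → V` (`funRep`).  With `V = M ⊗ Q_{t-p} ⊗ Q_p`, where `Q_b`
denotes the algebra of dots on `b` strands, the induced module `F_t M` maps to such functions by
`indFun`, and summing the values on the coset `S_m w_p` gives an `R(m)`-linear map
`F_t M → F_{t-p} E_{ℓ-p} M ⊗ Q_p` (`summandProj`).  The stabilizer of a double coset is described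
by `double_coset_stabilizer`; it shows that this map vanishes on the summands for the other values
of `p` (`summandProj_of_ne`), and that on the summand for `p` it is a nonzero multiple of the
inclusion `Z_p ⊆ Q_p` (`exists_summandProj_pre`).
-/

namespace JordanKLR

noncomputable section

/-! ### Permutations of strands -/

/-- The permutations of `ℕ` that fix every point outside `[x, y)`.  Permutations of the strands
of every algebra `R(n)` are regarded as permutations of `ℕ`, so that the inclusions of the
symmetric groups acting on blocks of strands become inclusions of subgroups. -/
def blk (x y : ℕ) : Subgroup (Equiv.Perm ℕ) where
  carrier := {w | ∀ i, i < x ∨ y ≤ i → w i = i}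
  one_mem' := fun _ _ => rfl
  mul_mem' := fun {u v} hu hv i hi => by
    rw [Equiv.Perm.mul_apply, hv i hi, hu i hi]
  inv_mem' := fun {u} hu i hi => by
    rw [Equiv.Perm.inv_eq_iff_eq, hu i hi]

theorem perm_apply_inv (w : Equiv.Perm ℕ) (i : ℕ) : w (w⁻¹ i) = i := w.apply_symm_apply i

theorem perm_inv_apply (w : Equiv.Perm ℕ) (i : ℕ) : w⁻¹ (w i) = i := w.symm_apply_apply i

theorem mem_blk {x y : ℕ} {w : Equiv.Perm ℕ} : w ∈ blk x y ↔ ∀ i, i < x ∨ y ≤ i → w i = i :=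
  Iff.rfl

theorem blk_mono {x y x' y' : ℕ} (hx : x' ≤ x) (hy : y ≤ y') {w : Equiv.Perm ℕ}
    (hw : w ∈ blk x y) : w ∈ blk x' y' := fun i hi => hw i (by omega)

theorem blk_lt_iff {x y s : ℕ} (hs : s ≤ x ∨ y ≤ s) {w : Equiv.Perm ℕ} (hw : w ∈ blk x y) (i : ℕ) :
    w i < s ↔ i < s := by
  rw [mem_blk] at hw
  by_cases h1 : w i = i
  · rw [h1]
  · have h2 : ¬ (i < x ∨ y ≤ i) := fun h => h1 (hw i h)
    have h3 : ¬ (w i < x ∨ y ≤ w i) := fun h => h1 (w.injective (hw _ h))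
    omega

theorem blk_commute {x y x' y' : ℕ} (h : y ≤ x') {v w : Equiv.Perm ℕ} (hv : v ∈ blk x y)
    (hw : w ∈ blk x' y') : v * w = w * v := by
  ext i
  have h1 := blk_lt_iff (s := x') (.inr h) hv i
  have h2 := blk_lt_iff (s := x') (.inl le_rfl) hw i
  simp only [Equiv.Perm.mul_apply]
  by_cases hi : i < x'
  · rw [hw i (.inl hi), hw (v i) (.inl (h1.2 hi))]
  · rw [hv i (.inr (by omega)), hv (w i) (.inr (by omega))]

/-- A permutation that preserves an initial segment is a product of permutations of the two
parts. -/
theorem blk_split {x y s : ℕ} {w : Equiv.Perm ℕ} (hw : w ∈ blk x y)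
    (h : ∀ i, w i < s ↔ i < s) : ∃ w₁ ∈ blk x s, ∃ w₂ ∈ blk s y, w = w₁ * w₂ := by
  let v : Equiv.Perm ℕ := Equiv.Perm.ofSubtype (w.subtypePerm (p := fun i => i < s) h)
  have hv1 : ∀ i, i < s → v i = w i := fun i hi =>
    Equiv.Perm.ofSubtype_apply_of_mem (p := fun i => i < s) _ hi
  have hv2 : ∀ i, ¬ i < s → v i = i := fun i hi =>
    Equiv.Perm.ofSubtype_apply_of_not_mem (p := fun i => i < s) _ hi
  refine ⟨v, fun i hi => ?_, v⁻¹ * w, fun i hi => ?_, by group⟩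
  · by_cases h1 : i < s
    · rw [hv1 i h1, hw i (by omega)]
    · exact hv2 i h1
  · rw [Equiv.Perm.mul_apply, Equiv.Perm.inv_eq_iff_eq]
    by_cases h1 : i < s
    · exact (hv1 i h1).symm
    · rw [hv2 i h1, hw i (by omega)]

/-- The action of `S_ℓ` on the `ℓ` strands that follow the first `m`. -/
def emb (m : ℕ) {ℓ : ℕ} : Equiv.Perm (Fin ℓ) →* Equiv.Perm ℕ :=
  Equiv.Perm.viaEmbeddingHom ⟨fun i : Fin ℓ => m + i, fun i j h => Fin.ext (by simpa using h)⟩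

theorem emb_apply (m : ℕ) {ℓ : ℕ} (u : Equiv.Perm (Fin ℓ)) (i : Fin ℓ) :
    emb m u (m + i) = m + u i :=
  Equiv.Perm.viaEmbedding_apply u
    ⟨fun i : Fin ℓ => m + i, fun i j h => Fin.ext (by simpa using h)⟩ i

theorem emb_mem (m : ℕ) {ℓ : ℕ} (u : Equiv.Perm (Fin ℓ)) : emb m u ∈ blk m (m + ℓ) := by
  intro i hi
  refine Equiv.Perm.viaEmbedding_apply_of_notMem u
    ⟨fun i : Fin ℓ => m + i, fun i j h => Fin.ext (by simpa using h)⟩ i ?_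
  rintro ⟨j, hj⟩
  have := j.2
  have hj : m + (j : ℕ) = i := hj
  omega

theorem exists_emb {m ℓ : ℕ} {w : Equiv.Perm ℕ} (hw : w ∈ blk m (m + ℓ)) :
    ∃ u : Equiv.Perm (Fin ℓ), emb m u = w := by
  have key : ∀ v ∈ blk m (m + ℓ), ∀ i : Fin ℓ, m ≤ v (m + i) ∧ v (m + i) < m + ℓ := by
    intro v hv i
    have h1 := blk_lt_iff (s := m) (.inl le_rfl) hv (m + i)
    have h2 := blk_lt_iff (s := m + ℓ) (.inr le_rfl) hv (m + i)
    have := i.2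
    omega
  let f : ∀ v ∈ blk m (m + ℓ), Fin ℓ → Fin ℓ := fun v hv i =>
    ⟨v (m + i) - m, by have := key v hv i; omega⟩
  have hf : ∀ v (hv : v ∈ blk m (m + ℓ)) i, m + (f v hv i : ℕ) = v (m + i) := by
    intro v hv i
    have := key v hv i
    show m + (v (m + i) - m) = _
    omega
  let u : Equiv.Perm (Fin ℓ) :=
    { toFun := f w hw
      invFun := f w⁻¹ (inv_mem hw)
      left_inv := fun i => Fin.ext (by
        have := hf w⁻¹ (inv_mem hw) (f w hw i)
        rw [hf w hw i, perm_inv_apply] at this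
        omega)
      right_inv := fun i => Fin.ext (by
        have := hf w hw (f w⁻¹ (inv_mem hw) i)
        rw [hf w⁻¹ (inv_mem hw) i, perm_apply_inv] at this
        omega) }
  refine ⟨u, Equiv.ext fun i => ?_⟩
  by_cases hi : m ≤ i ∧ i < m + ℓ
  · obtain ⟨j, rfl⟩ : ∃ j : Fin ℓ, i = m + j := ⟨⟨i - m, by omega⟩, by simp; omega⟩
    rw [emb_apply]
    exact hf w hw j
  · rw [emb_mem m u i (by omega), hw i (by omega)]

/-- The transposition of `k` and `k + 1`. -/
def sw (k : ℕ) : Equiv.Perm ℕ := Equiv.swap k (k + 1)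

theorem sw_mul_self (k : ℕ) : sw k * sw k = 1 := Equiv.swap_mul_self _ _

theorem sw_mem {x y k : ℕ} (h1 : x ≤ k) (h2 : k + 1 < y) : sw k ∈ blk x y := fun i hi =>
  Equiv.swap_apply_of_ne_of_ne (by omega) (by omega)

theorem sw_apply (k i : ℕ) : sw k i = if i = k then k + 1 else if i = k + 1 then k else i :=
  Equiv.swap_apply_def _ _ _

theorem emb_adjSwap (m : ℕ) {ℓ : ℕ} (k : {k : ℕ // k + 1 < ℓ}) : emb m (adjSwap k) = sw (m + k) := by
  have := k.2
  ext i
  by_cases hi : m ≤ i ∧ i < m + ℓ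
  · obtain ⟨j, rfl⟩ : ∃ j : Fin ℓ, i = m + j := ⟨⟨i - m, by omega⟩, by simp; omega⟩
    rw [emb_apply, sw_apply, adjSwap, Equiv.swap_apply_def]
    simp only [Fin.ext_iff]
    split_ifs <;> simp_all <;> omega
  · rw [emb_mem m _ i (by omega), sw_apply]
    split_ifs <;> omega

theorem blk_induction {x y : ℕ} (hxy : x ≤ y) {P : Equiv.Perm ℕ → Prop} (one : P 1)
    (mul : ∀ k, x ≤ k → k + 1 < y → ∀ w ∈ blk x y, P w → P (sw k * w)) {w : Equiv.Perm ℕ}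
    (hw : w ∈ blk x y) : P w := by
  obtain ⟨ℓ, rfl⟩ := Nat.exists_eq_add_of_le hxy
  obtain ⟨u, rfl⟩ := exists_emb hw
  clear hw
  obtain ⟨l, rfl⟩ := exists_word u
  induction l with
  | nil => simpa using one
  | cons k l ih =>
    have := k.2
    rw [List.map_cons, List.prod_cons, map_mul, emb_adjSwap]
    exact mul _ (by omega) (by omega) _ (emb_mem _ _) ih

/-! ### The symmetric group by generators and relations -/

section Coxeter

variable {B : Type*} [Monoid B]

/-- The Coxeter relations of `S_n` for elements `τ 0, …, τ (n - 2)` of a monoid. -/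
structure BraidRel (τ : ℕ → B) (n : ℕ) : Prop where
  sq : ∀ k, k + 1 < n → τ k * τ k = 1
  far : ∀ j k, j + 1 < k → k + 1 < n → τ j * τ k = τ k * τ j
  braid : ∀ k, k + 2 < n → τ k * τ (k + 1) * τ k = τ (k + 1) * τ k * τ (k + 1)

theorem BraidRel.mono {τ : ℕ → B} {n m : ℕ} (h : BraidRel τ n) (hm : m ≤ n) : BraidRel τ m :=
  ⟨fun k hk => h.sq k (by omega), fun j k hj hk => h.far j k hj (by omega),
    fun k hk => h.braid k (by omega)⟩

theorem braidRel_sw (n : ℕ) : BraidRel sw n where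
  sq k _ := sw_mul_self k
  far j k hj _ := blk_commute (y := j + 2) (x' := k) (by omega) (sw_mem (x := j) le_rfl (by omega))
    (sw_mem (y := k + 2) le_rfl (by omega))
  braid k _ := by
    ext i
    simp only [Equiv.Perm.mul_apply, sw_apply]
    split_ifs <;> omega

/-- The product `τ i * τ (i + 1) * ⋯ * τ (i + d - 1)`. -/
def run (τ : ℕ → B) : ℕ → ℕ → B
  | _, 0 => 1
  | i, d + 1 => τ i * run τ (i + 1) d

theorem run_far {τ : ℕ → B} {n : ℕ} (h : BraidRel τ n) (j d i : ℕ) (hj : j + 1 < i)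
    (hd : i + d < n) : τ j * run τ i d = run τ i d * τ j := by
  induction d generalizing i with
  | zero => simp [run]
  | succ d ih =>
    rw [run, ← mul_assoc, h.far j i hj (by omega), mul_assoc, ih (i + 1) (by omega) (by omega),
      mul_assoc]

theorem run_braid {τ : ℕ → B} {n : ℕ} (h : BraidRel τ n) (d i k : ℕ) (hk : i ≤ k)
    (hkd : k + 1 < i + d) (hd : i + d < n) : τ (k + 1) * run τ i d = run τ i d * τ k := by
  induction d generalizing i with
  | zero => omega
  | succ d ih =>
    rcases hk.eq_or_lt with rfl | hk
    · obtain ⟨d, rfl⟩ : ∃ d', d = d' + 1 := ⟨d - 1, by omega⟩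
      rw [run, run, ← mul_assoc, ← mul_assoc, ← mul_assoc, ← h.braid i (by omega), mul_assoc,
        run_far h i d (i + 1 + 1) (by omega) (by omega), ← mul_assoc]
    · rw [run, ← mul_assoc, ← h.far i (k + 1) (by omega) (by omega), mul_assoc,
        ih (i + 1) (by omega) (by omega) (by omega), mul_assoc]

theorem run_sw_mem (i d : ℕ) : run sw i d ∈ blk i (i + d + 1) := by
  induction d generalizing i with
  | zero => exact one_mem _
  | succ d ih => exact mul_mem (sw_mem (by omega) (by omega)) (blk_mono (by omega) (by omega) (ih _))

theorem run_sw_apply (i d : ℕ) : run sw i d (i + d) = i := by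
  induction d generalizing i with
  | zero => rfl
  | succ d ih =>
    have := ih (i + 1)
    rw [run, Equiv.Perm.mul_apply, show i + (d + 1) = i + 1 + d by omega, this, sw_apply]
    simp

/-- The product of the `τ k` along a normal form of `w`: for `i = w n`, the permutation `w` of
`[0, n]` is `s_i s_{i + 1} ⋯ s_{n - 1}` times a permutation of `[0, n)`. -/
def word (τ : ℕ → B) : ℕ → Equiv.Perm ℕ → B
  | 0, _ => 1
  | n + 1, w => run τ (w n) (n - w n) * word τ n ((run sw (w n) (n - w n))⁻¹ * w)

theorem word_one (τ : ℕ → B) (n : ℕ) : word τ n 1 = 1 := by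
  induction n with
  | zero => rfl
  | succ n ih => simp [word, run, ih]

/-- The normal form is compatible with left multiplication by adjacent transpositions, which
amounts to the Coxeter presentation of the symmetric group. -/
theorem word_sw_mul {τ : ℕ → B} {n : ℕ} (h : BraidRel τ n) {w : Equiv.Perm ℕ} (hw : w ∈ blk 0 n)
    {k : ℕ} (hk : k + 1 < n) : word τ n (sw k * w) = τ k * word τ n w := by
  induction n generalizing w k with
  | zero => omega
  | succ n ih =>
    have hin : w n ≤ n := by
      have := blk_lt_iff (s := n + 1) (.inr le_rfl) hw n
      omega
    have hres : (run sw (w n) (n - w n))⁻¹ * w ∈ blk 0 n := by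
      intro i hi
      have hi : n ≤ i := by omega
      rcases hi.eq_or_lt with rfl | hi
      · rw [Equiv.Perm.mul_apply, Equiv.Perm.inv_eq_iff_eq]
        have := run_sw_apply (w n) (n - w n)
        rw [show w n + (n - w n) = n by omega] at this
        exact this.symm
      · rw [Equiv.Perm.mul_apply, hw i (.inr hi), Equiv.Perm.inv_eq_iff_eq]
        exact (run_sw_mem (w n) (n - w n) i (.inr (by omega))).symm
    set i := w n with hi
    have hS := braidRel_sw (n + 1)
    have hn : (sw k * w) n = sw k i := rfl
    rw [word, hn, word, ← hi]
    rcases lt_trichotomy (k + 1) i with h1 | h1 | h1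
    -- `s_k` commutes with the run `s_i ⋯ s_{n - 1}`
    · have e : sw k i = i := by rw [sw_apply]; split_ifs <;> omega
      have hc := run_far hS k (n - i) i h1 (by omega)
      rw [e, ← mul_assoc _ (sw k), show (run sw i (n - i))⁻¹ * sw k = sw k * (run sw i (n - i))⁻¹ by
        rw [inv_mul_eq_iff_eq_mul, ← mul_assoc, ← hc]; group]
      rw [mul_assoc (sw k), ih (h.mono (by omega)) hres (by omega), ← mul_assoc, ← mul_assoc,
        run_far h k (n - i) i h1 (by omega)]
    -- `s_k` extends the run by one letter
    · have e : sw k i = k := by rw [sw_apply]; split_ifs <;> omega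
      rw [e, show n - k = (n - i) + 1 by omega, run, run, h1, mul_inv_rev, mul_assoc _ (sw k)⁻¹,
        inv_mul_cancel_left, mul_assoc]
    · rcases (show k = i ∨ i < k by omega) with rfl | h2
      -- `s_k` cancels the first letter of the run
      · have e : sw i i = i + 1 := by rw [sw_apply]; simp
        rw [e, show n - i = (n - (i + 1)) + 1 by omega, run, run, mul_inv_rev,
          show (sw i)⁻¹ = sw i from inv_eq_of_mul_eq_one_left (sw_mul_self i), mul_assoc _ (sw i),
          mul_assoc (τ i), ← mul_assoc (τ i), h.sq i (by omega), one_mul]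
      -- `s_k` moves through the run by a braid relation and becomes `s_{k - 1}`
      · obtain ⟨k, rfl⟩ : ∃ k', k = k' + 1 := ⟨k - 1, by omega⟩
        have e : sw (k + 1) i = i := by rw [sw_apply]; split_ifs <;> omega
        have hc := run_braid hS (n - i) i k (by omega) (by omega) (by omega)
        rw [e, ← mul_assoc _ (sw (k + 1)),
          show (run sw i (n - i))⁻¹ * sw (k + 1) = sw k * (run sw i (n - i))⁻¹ by
            rw [inv_mul_eq_iff_eq_mul, ← mul_assoc, ← hc]; group]
        rw [mul_assoc (sw k), ih (h.mono (by omega)) hres (by omega), ← mul_assoc, ← mul_assoc,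
          run_braid h (n - i) i k (by omega) (by omega) (by omega)]

theorem word_mul {τ : ℕ → B} {n : ℕ} (h : BraidRel τ n) {v w : Equiv.Perm ℕ} (hv : v ∈ blk 0 n)
    (hw : w ∈ blk 0 n) : word τ n (v * w) = word τ n v * word τ n w := by
  refine blk_induction (P := fun v => word τ n (v * w) = word τ n v * word τ n w) (Nat.zero_le n)
    (by rw [word_one, one_mul, one_mul]) (fun k _ hk v hv ih => ?_) hv
  rw [mul_assoc, word_sw_mul h (mul_mem hv hw) hk, ih, word_sw_mul h hv hk, mul_assoc]

theorem word_sw {τ : ℕ → B} {n : ℕ} (h : BraidRel τ n) {k : ℕ} (hk : k + 1 < n) :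
    word τ n (sw k) = τ k := by
  simpa [word_one] using word_sw_mul h (one_mem (blk 0 n)) hk

end Coxeter

/-! ### Double cosets -/

/-- The permutation that exchanges the blocks `[k, k + c)` and `[k + c, k + c + b)`. -/
def blockSwap (k c b : ℕ) : Equiv.Perm ℕ where
  toFun i := if i < k then i else if i < k + c then i + b else if i < k + c + b then i - c else i
  invFun i := if i < k then i else if i < k + b then i + c else if i < k + c + b then i - b else i
  left_inv i := by dsimp only; split_ifs <;> omega
  right_inv i := by dsimp only; split_ifs <;> omega

theorem blockSwap_apply (k c b i : ℕ) : blockSwap k c b i = if i < k then i else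
    if i < k + c then i + b else if i < k + c + b then i - c else i := rfl

theorem blockSwap_inv (k c b : ℕ) : (blockSwap k c b)⁻¹ = blockSwap k b c := by
  refine Equiv.ext fun i => ?_
  show (if i < k then i else if i < k + b then i + c else if i < k + c + b then i - b else i) = _
  rw [blockSwap_apply]
  split_ifs <;> omega

theorem blockSwap_mem (k c b : ℕ) : blockSwap k c b ∈ blk k (k + c + b) := by
  intro i hi
  rw [blockSwap_apply]
  split_ifs <;> omega

/-- The number of points of `[n, N)` that `w` maps to points `≥ m`. It is constant on the double
cosets of `S_m × S_{N - m}` and `S_n × S_{N - n}` in `S_N`, and classifies them. -/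
def cross (m n N : ℕ) (w : Equiv.Perm ℕ) : ℕ := ((Finset.Ico n N).filter fun i => m ≤ w i).card

theorem cross_mul_left {m n N : ℕ} {g : Equiv.Perm ℕ} (hg : ∀ i, g i < m ↔ i < m)
    (w : Equiv.Perm ℕ) : cross m n N (g * w) = cross m n N w := by
  unfold cross
  congr 1
  refine Finset.filter_congr fun i _ => ?_
  have := hg (w i)
  rw [Equiv.Perm.mul_apply]
  omega

theorem cross_mul_right {m n N : ℕ} {h : Equiv.Perm ℕ} (h1 : ∀ i, h i < n ↔ i < n)
    (h2 : ∀ i, h i < N ↔ i < N) (w : Equiv.Perm ℕ) : cross m n N (w * h) = cross m n N w := by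
  unfold cross
  refine Finset.card_equiv h fun i => ?_
  have e1 := h1 i
  have e2 := h2 i
  rw [Finset.mem_filter, Finset.mem_filter, Finset.mem_Ico, Finset.mem_Ico,
    Equiv.Perm.mul_apply]
  omega

theorem cross_blockSwap {k c b p m n N : ℕ} (hn : n = k + c) (hm : m = k + b)
    (hN : N = k + c + b + p) : cross m n N (blockSwap k c b) = p := by
  have : ((Finset.Ico n N).filter fun i => m ≤ blockSwap k c b i) = Finset.Ico (k + c + b) N := by
    ext i
    rw [Finset.mem_filter, Finset.mem_Ico, Finset.mem_Ico, blockSwap_apply]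
    split_ifs <;> omega
  rw [cross, this, Nat.card_Ico]
  omega

/-- The points of `[x, y)` can be permuted so that those with a given property come first. -/
theorem exists_sort (x y : ℕ) (hxy : x ≤ y) (P : ℕ → Prop) [DecidablePred P] : ∃ σ ∈ blk x y,
    ∀ i, x ≤ i → i < y → (P (σ i) ↔ i < x + ((Finset.Ico x y).filter P).card) := by
  obtain ⟨ℓ, rfl⟩ := Nat.exists_eq_add_of_le hxy
  set d := ((Finset.Ico x (x + ℓ)).filter P).card with hd
  have hdℓ : d ≤ ℓ := by
    have := Finset.card_filter_le (Finset.Ico x (x + ℓ)) P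
    rw [Nat.card_Ico] at this
    omega
  have hc : Fintype.card {i : Fin ℓ // (i : ℕ) < d} = Fintype.card {i : Fin ℓ // P (x + i)} := by
    have h1 : Fintype.card {i : Fin ℓ // P (x + i)} = d := by
      rw [Fintype.card_subtype, hd]
      refine Finset.card_bij (fun i _ => x + i) ?_ ?_ ?_
      · intro i hi
        simpa using hi
      · intro i _ j _ h
        exact Fin.ext (by simpa using h)
      · intro i hi
        simp only [Finset.mem_filter, Finset.mem_Ico] at hi
        refine ⟨⟨i - x, by omega⟩, ?_, by simp; omega⟩
        simpa [show x + (i - x) = i by omega] using hi.2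
    rw [h1]
    have h2 := Fintype.card_congr (Fin.castLEquiv hdℓ)
    rw [Fintype.card_fin] at h2
    exact h2.symm
  let e := Fintype.equivOfCardEq hc
  refine ⟨emb x e.extendSubtype, emb_mem _ _, fun i h1 h2 => ?_⟩
  obtain ⟨j, rfl⟩ : ∃ j : Fin ℓ, i = x + j := ⟨⟨i - x, by omega⟩, by simp; omega⟩
  rw [emb_apply, Nat.add_lt_add_iff_left]
  exact ⟨fun h => by_contra fun hj => e.extendSubtype_not_mem j hj h,
    fun h => e.extendSubtype_mem j h⟩

/-- Double coset decomposition of a permutation with respect to `S_m × S_ℓ` and `S_n × S_t`. -/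
theorem exists_double_coset {m ℓ n t N : ℕ} (hm : m + ℓ = N) (hn : n + t = N)
    {w : Equiv.Perm ℕ} (hw : w ∈ blk 0 N) : ∃ k c b p, n = k + c ∧ m = k + b ∧ t = b + p ∧
      ℓ = c + p ∧ ∃ u ∈ blk m N, ∃ v ∈ blk 0 m, ∃ α ∈ blk 0 n, ∃ β ∈ blk n N,
        w = u * v * blockSwap k c b * (α * β) := by
  -- In each of `[0, n)` and `[n, N)`, the points that `w` maps below `m` are moved to the front.
  obtain ⟨σ, hσ, hσP⟩ := exists_sort 0 n (Nat.zero_le n) fun i => w i < m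
  obtain ⟨σ', hσ', hσP'⟩ := exists_sort n N (by omega) fun i => w i < m
  set k := ((Finset.Ico 0 n).filter fun i => w i < m).card with hk
  set b := ((Finset.Ico n N).filter fun i => w i < m).card with hb
  have hkb : k + b = m := by
    have h1 : ((Finset.Ico 0 N).filter fun i => w i < m).card = m := by
      refine Eq.trans ?_ ((Nat.card_Ico 0 m).trans (Nat.sub_zero m))
      refine Finset.card_equiv w fun i => ?_
      have := blk_lt_iff (.inr le_rfl) hw i
      rw [Finset.mem_filter, Finset.mem_Ico, Finset.mem_Ico]
      omega
    refine Eq.trans ?_ h1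
    rw [hk, hb, ← Finset.card_union_of_disjoint
      (Finset.disjoint_filter_filter (Finset.Ico_disjoint_Ico_consecutive 0 n N)),
      ← Finset.filter_union, Finset.Ico_union_Ico_eq_Ico (Nat.zero_le n) (by omega)]
  have hkn : k ≤ n := by
    have := Finset.card_filter_le (Finset.Ico 0 n) fun i => w i < m
    rw [Nat.card_Ico] at this
    omega
  have hbt : b ≤ N - n := by
    have := Finset.card_filter_le (Finset.Ico n N) fun i => w i < m
    rw [Nat.card_Ico] at this
    omega
  refine ⟨k, n - k, b, t - b, by omega, by omega, by omega, by omega, ?_⟩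
  -- The block exchange then collects these points in `[0, m)`.
  set g := w * (σ' * σ) * (blockSwap k (n - k) b)⁻¹ with hg
  have hBs := blockSwap_mem k (n - k) b
  have hgN : g ∈ blk 0 N := mul_mem (mul_mem hw (mul_mem (blk_mono (by omega) le_rfl hσ')
    (blk_mono le_rfl (by omega) hσ))) (inv_mem (blk_mono (by omega) (by omega) hBs))
  have hgm : ∀ i, g i < m ↔ i < m := by
    intro i
    by_cases hiN : N ≤ i
    · rw [hgN i (.inr hiN)]
    have h1 : ∀ j, j < N → (w (σ' (σ j)) < m ↔ j < k ∨ (n ≤ j ∧ j < n + b)) := by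
      intro j hj
      have hj' := blk_lt_iff (.inr le_rfl) hσ j
      by_cases hjn : j < n
      · rw [hσ' _ (.inl (hj'.2 hjn)), hσP j (Nat.zero_le _) hjn]
        omega
      · rw [hσ j (.inr (by omega)), hσP' j (by omega) hj]
        omega
    rw [hg, Equiv.Perm.mul_apply, blockSwap_inv, Equiv.Perm.mul_apply, Equiv.Perm.mul_apply,
      h1 _ (by rw [blockSwap_apply]; split_ifs <;> omega), blockSwap_apply]
    split_ifs <;> omega
  obtain ⟨v, hv, u, hu, hvu⟩ := blk_split hgN hgm
  refine ⟨u, hu, v, hv, σ⁻¹, inv_mem hσ, σ'⁻¹, inv_mem hσ', ?_⟩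
  rw [← blk_commute le_rfl hv hu, ← hvu, hg]
  group

/-- Suppose that `u⁻¹ v w = w' α β` for block exchanges `w` and `w'`, where `u⁻¹ v ∈ S_ℓ × S_m` and
`α β ∈ S_n × S_t`.  Then `w = w'`, since the size `p` is determined by the double
coset.  Moreover `α β` preserves the last `p` strands, and `v` and `α` are equal up to
permutations of the strands `k, k + 1, …`. -/
theorem double_coset_stabilizer {k c b p k' c' b' p' m n N : ℕ} (hn : n = k + c) (hm : m = k + b)
    (hN : N = k + c + b + p) (hn' : n = k' + c') (hm' : m = k' + b') (hN' : N = k' + c' + b' + p')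
    {u v α β : Equiv.Perm ℕ} (hu : u ∈ blk m N) (hv : v ∈ blk 0 m) (hα : α ∈ blk 0 n)
    (hβ : β ∈ blk n N) (h : u⁻¹ * v * blockSwap k c b = blockSwap k' c' b' * (α * β)) :
    p = p' ∧ ∃ g ∈ blk 0 k, ∃ v' ∈ blk k m, ∃ α' ∈ blk k n, v = g * v' ∧ α = g * α' ∧
      ∀ i, (α * β) i < N - p ↔ i < N - p := by
  have hum : ∀ i, (u⁻¹ * v) i < m ↔ i < m := fun i =>
    (blk_lt_iff (.inl le_rfl) (inv_mem hu) _).trans (blk_lt_iff (.inr le_rfl) hv i)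
  have hn1 : ∀ i, (α * β) i < n ↔ i < n := fun i =>
    (blk_lt_iff (.inr le_rfl) hα _).trans (blk_lt_iff (.inl le_rfl) hβ i)
  have hN1 : ∀ i, (α * β) i < N ↔ i < N := fun i =>
    (blk_lt_iff (.inr (by omega)) hα _).trans (blk_lt_iff (.inr le_rfl) hβ i)
  have hpp : p = p' := by
    rw [← cross_blockSwap hn hm hN, ← cross_mul_left hum, h, cross_mul_right hn1 hN1,
      cross_blockSwap hn' hm' hN']
  obtain rfl : p = p' := hpp
  obtain rfl : k = k' := by omega
  obtain rfl : c = c' := by omega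
  obtain rfl : b = b' := by omega
  have key : ∀ i, (u⁻¹ * v) (blockSwap k c b i) = blockSwap k c b ((α * β) i) := fun i =>
    congrArg (fun f : Equiv.Perm ℕ => f i) h
  -- The points `< k` are those that lie in the first block on both sides.
  have hk1 : ∀ i, (α * β) i < k ↔ i < k := by
    intro i
    have h1 := hum (blockSwap k c b i)
    have h2 := hn1 i
    rw [key, blockSwap_apply, blockSwap_apply k c b i] at h1
    split_ifs at h1 <;> omega
  have hαk : ∀ i, α i < k ↔ i < k := by
    intro i
    by_cases hi : i < n
    · have := hk1 i
      rwa [Equiv.Perm.mul_apply, hβ i (.inl hi)] at this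
    · rw [hα i (.inr (by omega))]
  have hvα : ∀ i, i < k → v i = α i := by
    intro i hi
    have h1 := key i
    have h2 := hk1 i
    rw [Equiv.Perm.mul_apply α, hβ i (.inl (by omega))] at h1 h2
    rw [blockSwap_apply, if_pos hi, blockSwap_apply, if_pos (by omega), Equiv.Perm.mul_apply,
      Equiv.Perm.inv_eq_iff_eq, hu (α i) (.inl (by omega))] at h1
    exact h1
  have hvk : ∀ i, v i < k ↔ i < k := by
    intro i
    constructor
    · intro hi
      have h4 := hαk (α⁻¹ (v i))
      rw [perm_apply_inv] at h4
      have h3 := hvα (α⁻¹ (v i)) (h4.1 hi)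
      rw [perm_apply_inv] at h3
      rw [← v.injective h3]
      exact h4.1 hi
    · intro hi
      rw [hvα i hi]
      exact (hαk i).2 hi
  obtain ⟨g, hg, v', hv', rfl⟩ := blk_split hv hvk
  obtain ⟨g', hg', α', hα', rfl⟩ := blk_split hα hαk
  obtain rfl : g = g' := by
    ext i
    by_cases hi : i < k
    · have := hvα i hi
      rwa [Equiv.Perm.mul_apply, Equiv.Perm.mul_apply, hv' i (.inl hi), hα' i (.inl hi)] at this
    · rw [hg i (.inr (by omega)), hg' i (.inr (by omega))]
  refine ⟨rfl, g, hg, v', hv', α', hα', rfl, rfl, fun i => ?_⟩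
  have h1 := hum (blockSwap k c b i)
  have h2 := hn1 i
  have h3 := hN1 i
  rw [key, blockSwap_apply, blockSwap_apply k c b i] at h1
  split_ifs at h1 <;> omega

/-! ### The symmetric group inside `R(n)` -/

section Rho

variable {K : Type u} [Field K]

variable (K) in
/-- The crossing `τ_k` of `R(n)`, extended by `1` to all natural numbers `k`. -/
def tauN (n k : ℕ) : KLR K n := if h : k + 1 < n then gen K n (.tau k h) else 1

theorem tauN_of_lt {n k : ℕ} (h : k + 1 < n) : tauN K n k = gen K n (.tau k h) := dif_pos h

theorem braidRel_tauN (n : ℕ) : BraidRel (tauN K n) n where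
  sq k hk := by rw [tauN_of_lt hk, tau_sq]
  far j k hj hk := by
    rw [tauN_of_lt hk, tauN_of_lt (show j + 1 < n by omega), tau_far _ _ _ _ hj]
  braid k hk := by
    rw [tauN_of_lt (show k + 1 < n by omega), tauN_of_lt (show k + 1 + 1 < n by omega), braid]

variable (K) in
/-- The element `τ_w` of `R(n)` for a permutation `w` of `[0, n)`. -/
def rho (n : ℕ) (w : Equiv.Perm ℕ) : KLR K n := word (tauN K n) n w

theorem rho_one (n : ℕ) : rho K n 1 = 1 := word_one _ _

theorem rho_mul {n : ℕ} {v w : Equiv.Perm ℕ} (hv : v ∈ blk 0 n) (hw : w ∈ blk 0 n) :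
    rho K n (v * w) = rho K n v * rho K n w := word_mul (braidRel_tauN n) hv hw

theorem rho_sw {n k : ℕ} (hk : k + 1 < n) : rho K n (sw k) = gen K n (.tau k hk) :=
  (word_sw (braidRel_tauN n) hk).trans (tauN_of_lt hk)

theorem rho_sw_mul {n k : ℕ} (hk : k + 1 < n) {w : Equiv.Perm ℕ} (hw : w ∈ blk 0 n) :
    rho K n (sw k * w) = gen K n (.tau k hk) * rho K n w := by
  rw [rho_mul (sw_mem (Nat.zero_le k) hk) hw, rho_sw]

/-- The image of a strand under a permutation of the strands. -/
def permFin {n : ℕ} {w : Equiv.Perm ℕ} (hw : w ∈ blk 0 n) (i : Fin n) : Fin n :=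
  ⟨w i, (blk_lt_iff (.inr le_rfl) hw i).2 i.2⟩

theorem tau_mul_x {n k : ℕ} (hk : k + 1 < n) (i : Fin n) : gen K n (.tau k hk) * gen K n (.x i)
    = gen K n (.x (permFin (sw_mem (Nat.zero_le k) hk) i)) * gen K n (.tau k hk) := by
  obtain ⟨i, hi⟩ := i
  rcases eq_or_ne i k with rfl | h1
  · rw [tau_x]
    congr 3
    exact Fin.ext (by simp [permFin, sw_apply])
  rcases eq_or_ne i (k + 1) with rfl | h2
  · rw [← x_tau]
    congr 3
    exact Fin.ext (by simp [permFin, sw_apply])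
  · rw [tau_x_far k hk _ h1 h2]
    congr 3
    exact Fin.ext (by simp [permFin, sw_apply, h1, h2])

theorem rho_mul_x {n : ℕ} {w : Equiv.Perm ℕ} (hw : w ∈ blk 0 n) (i : Fin n) :
    rho K n w * gen K n (.x i) = gen K n (.x (permFin hw i)) * rho K n w := by
  suffices H : w ∈ blk 0 n ∧ ∀ hw : w ∈ blk 0 n, ∀ i,
      rho K n w * gen K n (.x i) = gen K n (.x (permFin hw i)) * rho K n w from H.2 hw i
  refine blk_induction (P := fun w => w ∈ blk 0 n ∧ ∀ hw : w ∈ blk 0 n, ∀ i,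
      rho K n w * gen K n (.x i) = gen K n (.x (permFin hw i)) * rho K n w) (Nat.zero_le n)
    ⟨one_mem _, fun _ i => ?_⟩ (fun k _ hk w hw ih => ⟨mul_mem (sw_mem (Nat.zero_le k) hk) hw,
      fun _ i => ?_⟩) hw
  · rw [rho_one, one_mul, mul_one]
    rfl
  · rw [rho_sw_mul hk hw, mul_assoc, ih.2 hw, ← mul_assoc, tau_mul_x, mul_assoc]
    rfl

theorem incl_x {m n : ℕ} (h : m ≤ n) (i : Fin m) :
    incl h (gen K m (.x i)) = gen K n (.x (i.castLE h)) := incl_gen _ _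

theorem incl_rho {m n : ℕ} (h : m ≤ n) {w : Equiv.Perm ℕ} (hw : w ∈ blk 0 m) :
    incl h (rho K m w) = rho K n w := by
  refine blk_induction (P := fun w => incl h (rho K m w) = rho K n w) (Nat.zero_le m)
    (by rw [rho_one, rho_one, map_one]) (fun k _ hk w hw ih => ?_) hw
  rw [rho_sw_mul hk hw, rho_sw_mul (hk.trans_le h) (blk_mono le_rfl h hw), map_mul, ih, incl_gen]
  rfl

/-- Induction on elements of `R(n)` through the generators. -/
theorem KLR.induction {n : ℕ} {P : KLR K n → Prop} (algebraMap : ∀ c : K, P (algebraMap K _ c))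
    (x : ∀ i, P (gen K n (.x i))) (tau : ∀ k hk, P (gen K n (.tau k hk)))
    (add : ∀ y z, P y → P z → P (y + z)) (mul : ∀ y z, P y → P z → P (y * z)) (y : KLR K n) :
    P y := by
  have hy : y ∈ Algebra.adjoin K (Set.range (gen K n)) := adjoin_gen (K := K) n ▸ Algebra.mem_top
  induction hy using Algebra.adjoin_induction with
  | mem y hy =>
    obtain ⟨g, rfl⟩ := hy
    cases g with
    | x i => exact x i
    | tau k hk => exact tau k hk
  | algebraMap c => exact algebraMap c
  | add u v _ _ hu hv => exact add _ _ hu hv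
  | mul u v _ _ hu hv => exact mul _ _ hu hv

theorem tauPerm_eq {m ℓ n : ℕ} (h : m + ℓ = n) (w : Equiv.Perm (Fin ℓ)) :
    tauPerm K h w = rho K n (emb m w) := by
  have key : ∀ l : List {k : ℕ // k + 1 < ℓ}, ((l.map (shiftTau h)).map (gen K n)).prod
      = rho K n (emb m (l.map adjSwap).prod) := by
    intro l
    induction l with
    | nil => simp [rho_one]
    | cons k l ih =>
      have := k.2
      have hl : emb m (l.map adjSwap).prod ∈ blk 0 n :=
        blk_mono (Nat.zero_le m) h.le (emb_mem m _)
      rw [List.map_cons, List.map_cons, List.prod_cons, ih, List.map_cons, List.prod_cons,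
        map_mul, emb_adjSwap, rho_sw_mul (show m + k + 1 < n by omega) hl]
      rfl
  rw [tauPerm, key]
  congr 2
  exact (exists_redWord w).choose_spec.1

theorem symIdem_eq {m ℓ n : ℕ} (h : m + ℓ = n) : symIdem K h
    = (ℓ.factorial : K)⁻¹ • ∑ u : Equiv.Perm (Fin ℓ), rho K n (emb m u) := by
  simp only [symIdem, tauPerm_eq]

theorem emb_mem_of_eq {m ℓ n : ℕ} (h : m + ℓ = n) (u : Equiv.Perm (Fin ℓ)) :
    emb m u ∈ blk m n := h ▸ emb_mem m u

theorem emb_mem_zero {m ℓ n : ℕ} (h : m + ℓ ≤ n) (u : Equiv.Perm (Fin ℓ)) : emb m u ∈ blk 0 n :=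
  blk_mono (Nat.zero_le m) h (emb_mem m u)

theorem rho_mul_symIdem {m ℓ n : ℕ} (h : m + ℓ = n) {w : Equiv.Perm ℕ} (hw : w ∈ blk m n) :
    rho K n w * symIdem K h = symIdem K h := by
  obtain ⟨g, rfl⟩ := exists_emb (h ▸ hw)
  rw [symIdem_eq, mul_smul_comm, Finset.mul_sum]
  congr 1
  refine Fintype.sum_equiv (Equiv.mulLeft g) _ _ fun u => ?_
  rw [Equiv.coe_mulLeft, map_mul, rho_mul (emb_mem_zero h.le g) (emb_mem_zero h.le u)]

theorem symIdem_mul_rho {m ℓ n : ℕ} (h : m + ℓ = n) {w : Equiv.Perm ℕ} (hw : w ∈ blk m n) :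
    symIdem K h * rho K n w = symIdem K h := by
  obtain ⟨g, rfl⟩ := exists_emb (h ▸ hw)
  rw [symIdem_eq, smul_mul_assoc, Finset.sum_mul]
  congr 1
  refine Fintype.sum_equiv (Equiv.mulRight g) _ _ fun u => ?_
  rw [Equiv.coe_mulRight, map_mul, rho_mul (emb_mem_zero h.le u) (emb_mem_zero h.le g)]

theorem inv_factorial_smul_sum [CharZero K] {V : Type*} [AddCommGroup V] [Module K V] (ℓ : ℕ)
    (v : V) : (ℓ.factorial : K)⁻¹ • ∑ _u : Equiv.Perm (Fin ℓ), v = v := by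
  rw [Finset.sum_const, Finset.card_univ, Fintype.card_perm, Fintype.card_fin,
    ← Nat.cast_smul_eq_nsmul K, smul_smul, inv_mul_cancel₀ (by exact_mod_cast ℓ.factorial_ne_zero),
    one_smul]

theorem symIdem_mul_self [CharZero K] {m ℓ n : ℕ} (h : m + ℓ = n) :
    symIdem K h * symIdem K h = symIdem K h := by
  conv_lhs => rw [symIdem_eq, smul_mul_assoc, Finset.sum_mul]
  rw [← symIdem_eq h]
  simp only [rho_mul_symIdem h (emb_mem_of_eq h _)]
  exact inv_factorial_smul_sum ℓ _

/-- Every element of `R(n)` is a combination of elements `τ_w x_{i_1} ⋯ x_{i_s}`. -/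
theorem mem_span_rho_mul_x {n : ℕ} (y : KLR K n) : y ∈ Submodule.span K
    {z | ∃ w ∈ blk 0 n, ∃ l : List (Fin n), rho K n w * (l.map fun i => gen K n (.x i)).prod = z} := by
  set S := Submodule.span K {z | ∃ w ∈ blk 0 n, ∃ l : List (Fin n),
    rho K n w * (l.map fun i => gen K n (.x i)).prod = z} with hS
  suffices H : ∀ z ∈ S, y * z ∈ S by
    simpa using H 1 (Submodule.subset_span ⟨1, one_mem _, [], by simp [rho_one]⟩)
  have hgen : ∀ g : KLR K n, (∀ w ∈ blk 0 n, ∀ l : List (Fin n),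
      g * (rho K n w * (l.map fun i => gen K n (.x i)).prod) ∈ S) → ∀ z ∈ S, g * z ∈ S := by
    intro g hg z hz
    have : S ≤ S.comap (LinearMap.mulLeft K g) := by
      refine Submodule.span_le.2 ?_
      rintro _ ⟨w, hw, l, rfl⟩
      exact hg w hw l
    exact this hz
  induction y using KLR.induction with
  | algebraMap c =>
    intro z hz
    rw [← Algebra.smul_def]
    exact S.smul_mem c hz
  | x i =>
    refine hgen _ fun w hw l => Submodule.subset_span
      ⟨w, hw, permFin (inv_mem hw) i :: l, ?_⟩
    rw [List.map_cons, List.prod_cons, ← mul_assoc, rho_mul_x hw, mul_assoc]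
    congr 3
    exact Fin.ext (perm_apply_inv w i)
  | tau k hk =>
    refine hgen _ fun w hw l => Submodule.subset_span
      ⟨sw k * w, mul_mem (sw_mem (Nat.zero_le k) hk) hw, l, ?_⟩
    rw [rho_sw_mul hk hw, mul_assoc]
  | add y y' h h' =>
    intro z hz
    rw [add_mul]
    exact S.add_mem (h z hz) (h' z hz)
  | mul y y' h h' =>
    intro z hz
    rw [mul_assoc]
    exact h _ (h' z hz)

/-! ### Representations of `R(n)` on functions on the symmetric group -/

section Model

variable {V : Type u} [AddCommGroup V] [Module K V]

/-- The action of the dot `x_i` on functions `S_n → V`: on the value at `w`, the dot acts through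
the operator that belongs to the strand `w⁻¹ i`. -/
def dotEnd (n : ℕ) (X : ℕ → Module.End K V) (i : ℕ) : Module.End K (blk 0 n → V) where
  toFun φ w := X ((w : Equiv.Perm ℕ)⁻¹ i) (φ w)
  map_add' _ _ := funext fun _ => map_add _ _ _
  map_smul' _ _ := funext fun _ => map_smul _ _ _

/-- Left translation of functions `S_n → V`. -/
def transEnd (V : Type u) [AddCommGroup V] [Module K V] {n : ℕ} (g : blk 0 n) :
    Module.End K (blk 0 n → V) where
  toFun φ w := φ (g⁻¹ * w)
  map_add' _ _ := rfl
  map_smul' _ _ := rfl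

theorem transEnd_mul {n : ℕ} (g h : blk 0 n) :
    transEnd (K := K) V g * transEnd V h = transEnd V (g * h) := by
  ext φ w
  show φ (h⁻¹ * (g⁻¹ * w)) = φ ((g * h)⁻¹ * w)
  rw [mul_inv_rev, mul_assoc]

theorem transEnd_one (n : ℕ) : transEnd (K := K) V (1 : blk 0 n) = 1 := by
  ext φ w
  show φ (1⁻¹ * w) = φ w
  rw [inv_one, one_mul]

theorem transEnd_mul_dotEnd {n : ℕ} (X : ℕ → Module.End K V) (g : blk 0 n) (i : ℕ) :
    transEnd V g * dotEnd n X i = dotEnd n X ((g : Equiv.Perm ℕ) i) * transEnd V g := by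
  ext φ w
  show X (((g⁻¹ * w : blk 0 n) : Equiv.Perm ℕ)⁻¹ i) _ = X ((w : Equiv.Perm ℕ)⁻¹ _) _
  congr 2

/-- Commuting operators `X_i` on `V` make the space of functions `S_n → V` a representation of
`R(n)`. -/
def funRep (n : ℕ) (X : ℕ → Module.End K V) (hX : ∀ i j, X i * X j = X j * X i) :
    KLR K n →ₐ[K] Module.End K (blk 0 n → V) :=
  klrLift (fun
      | .x i => dotEnd n X i
      | .tau k hk => transEnd V ⟨sw k, sw_mem (Nat.zero_le k) hk⟩) (by
    have hsw : ∀ k i, i ≠ k → i ≠ k + 1 → sw k i = i := fun k i h1 h2 => by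
      rw [sw_apply, if_neg h1, if_neg h2]
    intro u v h
    cases h with
    | x_comm j k =>
      simp only [map_mul, FreeAlgebra.lift_ι_apply]
      ext φ w
      exact congrArg (fun f : Module.End K V => f (φ w)) (hX _ _)
    | tau_sq k hk =>
      simp only [map_mul, map_one, FreeAlgebra.lift_ι_apply]
      rw [transEnd_mul, ← transEnd_one]
      congr 1
      exact Subtype.ext (sw_mul_self k)
    | tau_x k hk =>
      simp only [map_mul, FreeAlgebra.lift_ι_apply]
      rw [transEnd_mul_dotEnd]
      simp [sw]
    | x_tau k hk =>
      simp only [map_mul, FreeAlgebra.lift_ι_apply]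
      rw [transEnd_mul_dotEnd]
      simp [sw]
    | tau_x_far k hk j h1 h2 =>
      simp only [map_mul, FreeAlgebra.lift_ι_apply]
      rw [transEnd_mul_dotEnd]
      simp only [hsw k j h1 h2]
    | tau_far j k hj hk h_ =>
      simp only [map_mul, FreeAlgebra.lift_ι_apply]
      rw [transEnd_mul, transEnd_mul]
      congr 1
      exact Subtype.ext ((braidRel_sw n).far j k h_ hk)
    | braid k hk =>
      simp only [map_mul, FreeAlgebra.lift_ι_apply]
      rw [transEnd_mul, transEnd_mul, transEnd_mul, transEnd_mul]
      congr 1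
      exact Subtype.ext ((braidRel_sw n).braid k hk))

theorem funRep_x {n : ℕ} (X : ℕ → Module.End K V) (hX : ∀ i j, X i * X j = X j * X i)
    (i : Fin n) : funRep n X hX (gen K n (.x i)) = dotEnd n X i := klrLift_gen _ _ _

theorem funRep_tau {n : ℕ} (X : ℕ → Module.End K V) (hX : ∀ i j, X i * X j = X j * X i)
    (k : ℕ) (hk : k + 1 < n) : funRep n X hX (gen K n (.tau k hk))
      = transEnd V ⟨sw k, sw_mem (Nat.zero_le k) hk⟩ := klrLift_gen _ _ _

theorem funRep_rho {n : ℕ} (X : ℕ → Module.End K V) (hX : ∀ i j, X i * X j = X j * X i)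
    (g : blk 0 n) : funRep n X hX (rho K n g) = transEnd V g := by
  obtain ⟨g, hg⟩ := g
  suffices H : ∃ h : g ∈ blk 0 n, funRep n X hX (rho K n g) = transEnd V ⟨g, h⟩ from H.2
  refine blk_induction (P := fun g => ∃ h : g ∈ blk 0 n,
    funRep n X hX (rho K n g) = transEnd V ⟨g, h⟩) (Nat.zero_le n)
    ⟨one_mem _, by rw [rho_one, map_one]; exact (transEnd_one n).symm⟩
    (fun k _ hk w hw ih => ⟨mul_mem (sw_mem (Nat.zero_le k) hk) hw, ?_⟩) hg
  rw [rho_sw_mul hk hw, map_mul, ih.2, funRep_tau, transEnd_mul]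
  rfl

end Model

end Rho

/-! ### Induction along a corner -/

section CornerMaps

variable {K : Type u} [Field K] {A : Type u} [Ring A] [Algebra K A] {𝒜 : ℤ → Submodule K A}
  {B : Type u} [Ring B] [Algebra K B] {ℬ : ℤ → Submodule K B}

namespace Corner

variable (c : Corner 𝒜 ℬ)

/-- The canonical map `M → B e ⊗_A M`, `m ↦ e ⊗ m`. -/
def indUnit (M : GrMod 𝒜) : M.carrier →ₗ[K] c.IndCarrier M :=
  c.indMk M ∘ₗ TensorProduct.mk K c.ideal M.carrier ⟨c.e, Submodule.mem_span_singleton_self _⟩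

theorem smul_indUnit (M : GrMod 𝒜) (b : B) (m : M.carrier) :
    b • c.indUnit M m = c.indMk M ((b • (⟨c.e, Submodule.mem_span_singleton_self _⟩ : c.ideal))
      ⊗ₜ[K] m) := rfl

theorem e_smul_indUnit (he : c.e * c.e = c.e) (M : GrMod 𝒜) (m : M.carrier) :
    c.e • c.indUnit M m = c.indUnit M m := by
  rw [smul_indUnit]
  have : c.e • (⟨c.e, Submodule.mem_span_singleton_self _⟩ : c.ideal)
      = ⟨c.e, Submodule.mem_span_singleton_self _⟩ := Subtype.ext he
  rw [this]
  rfl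

theorem ι_smul_indUnit (M : GrMod 𝒜) (a : A) (m : M.carrier) :
    c.ι a • c.indUnit M m = c.indUnit M (a • m) := by
  rw [smul_indUnit]
  have : c.ι a • (⟨c.e, Submodule.mem_span_singleton_self _⟩ : c.ideal)
      = c.rmul ⟨c.e, Submodule.mem_span_singleton_self _⟩ a := Subtype.ext (c.comm a).eq.symm
  rw [this]
  exact (Submodule.Quotient.eq _).2 (Submodule.subset_span ⟨_, a, m, rfl⟩)

theorem indUnit_mem (M : GrMod 𝒜) {d : ℤ} {m : M.carrier} (hm : m ∈ M.grade d) :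
    c.indUnit M m ∈ c.indGrade M d :=
  ⟨_, tmul_mem (zero_add d) (show _ ∈ c.idealGrade 0 from c.e_mem) hm, rfl⟩

theorem ind_induction {M : GrMod 𝒜} {P : c.IndCarrier M → Prop}
    (smul : ∀ (b : B) (m : M.carrier), P (b • c.indUnit M m)) (add : ∀ x y, P x → P y → P (x + y))
    (x : c.IndCarrier M) : P x := by
  obtain ⟨x, rfl⟩ := Submodule.mkQ_surjective _ x
  induction x using TensorProduct.induction_on with
  | zero => simpa using smul 0 0
  | add x y hx hy => rw [map_add]; exact add _ _ hx hy
  | tmul b m =>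
    obtain ⟨b, hb⟩ := b
    obtain ⟨b, rfl⟩ := Submodule.mem_span_singleton.1 hb
    exact smul b m

/-- The universal property of `B e ⊗_A M`: maps out of it are the maps out of `M` that are
compatible with the action of `A`, with values fixed by `e`. -/
theorem exists_indLift {M : GrMod 𝒜} {X : Type*} [AddCommGroup X] [Module K X]
    (α : B →ₐ[K] Module.End K X) (f : M.carrier →ₗ[K] X)
    (hf : ∀ a m, f (a • m) = α (c.ι a) (f m)) (he : ∀ m, α c.e (f m) = f m) :
    ∃ F : c.IndCarrier M →ₗ[K] X, (∀ b y, F (b • y) = α b (F y)) ∧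
      ∀ m, F (c.indUnit M m) = f m := by
  let : Module B X := Module.compHom X (α : B →+* Module.End K X)
  have hsm : ∀ (b : B) (x : X), b • x = α b x := fun _ _ => rfl
  have : IsScalarTower K B X := ⟨fun k b x => by rw [hsm, hsm, map_smul]; rfl⟩
  have : SMulCommClass B K X := ⟨fun b k x => by rw [hsm, hsm, map_smul]⟩
  let g : c.ideal →ₗ[B] M.carrier →ₗ[K] X :=
    { toFun := fun b => α b.1 ∘ₗ f
      map_add' := fun b b' => by
        rw [Submodule.coe_add, map_add]
        rfl
      map_smul' := fun b b' => by
        ext m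
        show α (b * b'.1) (f m) = α b (α b'.1 (f m))
        rw [map_mul]
        rfl }
  let G : c.ideal ⊗[K] M.carrier →ₗ[B] X := TensorProduct.AlgebraTensorModule.lift g
  have hG : c.indRel M ≤ LinearMap.ker G := by
    refine Submodule.span_le.2 ?_
    rintro _ ⟨b, a, m, rfl⟩
    rw [SetLike.mem_coe, LinearMap.mem_ker, map_sub, sub_eq_zero]
    show α (b.1 * c.ι a) (f m) = α b.1 (f (a • m))
    rw [map_mul, hf]
    rfl
  refine ⟨((c.indRel M).liftQ G hG).restrictScalars K, fun b y => ?_, fun m => ?_⟩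
  · exact map_smul ((c.indRel M).liftQ G hG) b y
  · exact he m

end Corner

/-! ### Isomorphisms with direct sums of functors -/

theorem GrMod.isIso_of_bijective {M N : GrMod 𝒜} (f : M ⟶ N) (hf : Function.Bijective f.toLin) :
    IsIso f := by
  let e := LinearEquiv.ofBijective f.toLin hf
  have he : ∀ x, f.toLin (e.symm x) = x := e.apply_symm_apply
  refine ⟨⟨e.symm.toLinearMap, fun d n hn => ?_⟩, ?_, ?_⟩
  · have h1 := gproj_comm M.isInternal N.isInternal (f.toLin.restrictScalars K) f.map_grade d
      (e.symm n)
    have h2 : f.toLin (gproj M.isInternal d (e.symm n)) = f.toLin (e.symm n) := by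
      refine h1.trans ?_
      show gproj N.isInternal d (f.toLin (e.symm n)) = _
      rw [he, gproj_same N.isInternal hn]
    show e.symm n ∈ M.grade d
    rw [← hf.1 h2]
    exact gproj_mem _ _ _
  · exact GrMod.hom_ext fun x => e.symm_apply_apply x
  · exact GrMod.hom_ext fun x => e.apply_symm_apply x

theorem nonempty_iso_dsumFunctor {C : Type*} [Category C] {J : Type} [Fintype J]
    (G : C ⥤ GrMod 𝒜) (F : J → (C ⥤ GrMod 𝒜)) (η : ∀ j, F j ⟶ G)
    (h : ∀ X, Function.Bijective fun x : ∀ j, ((F j).obj X).carrier =>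
      ∑ j, ((η j).app X).toLin (x j)) : Nonempty (G ≅ dsumFunctor F) := by
  let app : ∀ X, (dsumFunctor F).obj X ⟶ G.obj X := fun X =>
    GrMod.Hom.mk (M := (dsumFunctor F).obj X) (N := G.obj X)
      (∑ j, ((η j).app X).toLin ∘ₗ LinearMap.proj j) (fun d m hm => by
        rw [LinearMap.sum_apply]
        exact Submodule.sum_mem _ fun j _ => ((η j).app X).map_grade d _ (hm j trivial))
  have happ : ∀ X (x : ∀ j, ((F j).obj X).carrier),
      (app X).toLin x = ∑ j, ((η j).app X).toLin (x j) := fun X x => LinearMap.sum_apply _ _ _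
  let θ : dsumFunctor F ⟶ G :=
    { app := app
      naturality := fun X Y f => by
        apply GrMod.hom_ext
        intro (x : ∀ j, ((F j).obj X).carrier)
        show (app Y).toLin (fun j => ((F j).map f).toLin (x j))
          = (G.map f).toLin ((app X).toLin x)
        rw [happ, happ, map_sum]
        refine Finset.sum_congr rfl fun j _ => ?_
        exact congrArg (fun g => GrMod.Hom.toLin g (x j)) ((η j).naturality f) }
  have : ∀ X, IsIso (θ.app X) := fun X => GrMod.isIso_of_bijective _ (by
    have : ((θ.app X).toLin : ((dsumFunctor F).obj X).carrier → (G.obj X).carrier)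
      = fun x : ∀ j, ((F j).obj X).carrier => ∑ j, ((η j).app X).toLin (x j) :=
        funext fun x => happ X x
    rw [this]
    exact h X)
  have := NatIso.isIso_of_isIso_app θ
  exact ⟨(asIso θ).symm⟩

end CornerMaps

/-! ### The transformation attached to a double coset -/

section Summand

variable {K : Type u} [Field K]
  {Rn : Type u} [Ring Rn] [Algebra K Rn] {𝒢n : ℤ → Submodule K Rn}
  {RN : Type u} [Ring RN] [Algebra K RN] {𝒢N : ℤ → Submodule K RN}
  {Rm : Type u} [Ring Rm] [Algebra K Rm] {𝒢m : ℤ → Submodule K Rm}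
  {Rk : Type u} [Ring Rk] [Algebra K Rk] {𝒢k : ℤ → Submodule K Rk}
  [GradedAlgebra 𝒢n] [GradedAlgebra 𝒢N]

/-- Two ways around a square of algebras `R(k) → R(m) → R(N)` and `R(k) → R(n) → R(N)`, and a
graded space `Z` of intertwiners between them in `R(N)`. -/
structure Square (cF : Corner 𝒢n 𝒢N) (cE : Corner 𝒢m 𝒢N) (dE : Corner 𝒢k 𝒢n)
    (dF : Corner 𝒢k 𝒢m) (Z : GrSpace K) where
  ζ : Z.carrier →ₗ[K] RN
  ζ_mem : ∀ d z, z ∈ Z.grade d → ζ z ∈ 𝒢N d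
  ζ_comm : ∀ y z, cE.ι (dF.ι y) * ζ z = ζ z * cF.ι (dE.ι y)
  e_ζ : ∀ z, cE.ι dF.e * ζ z * cF.e = ζ z * cF.e
  idem : cF.e * cF.e = cF.e

namespace Square

variable {cF : Corner 𝒢n 𝒢N} {cE : Corner 𝒢m 𝒢N} {dE : Corner 𝒢k 𝒢n} {dF : Corner 𝒢k 𝒢m}
  {Z : GrSpace K} (s : Square cF cE dE dF Z)

/-- The bilinear map `(l, z) ↦ e ζ(z) ⊗ l`. -/
def pre (M : GrMod 𝒢n) :
    dE.eSub M →ₗ[K] Z.carrier →ₗ[K] cE.eSub (cF.indObj M) :=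
  LinearMap.mk₂ K (fun l z => ⟨cE.e • s.ζ z • cF.indUnit M l, ⟨_, rfl⟩⟩)
    (fun l l' z => Subtype.ext (by
      show cE.e • s.ζ z • cF.indUnit M (l + l') = _ + _
      rw [map_add, smul_add, smul_add]))
    (fun k l z => Subtype.ext (by
      show cE.e • s.ζ z • cF.indUnit M (k • (l : M.carrier)) = k • (cE.e • s.ζ z • cF.indUnit M l)
      rw [map_smul, smul_comm _ k, smul_comm _ k]))
    (fun l z z' => Subtype.ext (by
      show cE.e • s.ζ (z + z') • cF.indUnit M l = _ + _
      rw [map_add, add_smul, smul_add]))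
    (fun k l z => Subtype.ext (by
      show cE.e • s.ζ (k • z) • cF.indUnit M l = k • (cE.e • s.ζ z • cF.indUnit M l)
      rw [map_smul, smul_assoc, smul_comm _ k]))

theorem coe_pre (M : GrMod 𝒢n) (l : dE.eSub M) (z : Z.carrier) :
    (s.pre M l z).1 = cE.e • s.ζ z • cF.indUnit M l := rfl

theorem pre_smul (M : GrMod 𝒢n) (y : Rk) (l : dE.eSub M) (z : Z.carrier) :
    s.pre M (y • l) z = dF.ι y • s.pre M l z := by
  refine Subtype.ext ?_
  show cE.e • s.ζ z • cF.indUnit M (dE.ι y • (l : M.carrier))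
    = cE.ι (dF.ι y) • cE.e • s.ζ z • cF.indUnit M l
  rw [← cF.ι_smul_indUnit]
  simp only [smul_smul]
  congr 1
  rw [← s.ζ_comm, ← mul_assoc, ← mul_assoc, (cE.comm _).eq]

theorem e_smul_pre (M : GrMod 𝒢n) (l : dE.eSub M) (z : Z.carrier) :
    dF.e • s.pre M l z = s.pre M l z := by
  refine Subtype.ext ?_
  show cE.ι dF.e • cE.e • s.ζ z • cF.indUnit M l = cE.e • s.ζ z • cF.indUnit M l
  rw [← cF.e_smul_indUnit s.idem M]
  simp only [smul_smul]
  congr 1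
  have h := s.e_ζ z
  rw [mul_assoc] at h
  rw [← mul_assoc, ← (cE.comm _).eq, mul_assoc, h]

theorem exists_toLin (M : GrMod 𝒢n) :
    ∃ F : dF.IndCarrier (dE.res.obj M) ⊗[K] Z.carrier →ₗ[Rm] cE.eSub (cF.indObj M),
      ∀ (l : dE.eSub M) z, F (dF.indUnit (dE.res.obj M) l ⊗ₜ z) = s.pre M l z := by
  obtain ⟨F, hF, hF'⟩ := dF.exists_indLift (M := dE.res.obj M)
    (Algebra.lsmul K K (Z.carrier →ₗ[K] cE.eSub (cF.indObj M))) (s.pre M)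
    (fun a m => LinearMap.ext fun z => s.pre_smul M a m z)
    (fun m => LinearMap.ext fun z => s.e_smul_pre M m z)
  let F' : dF.IndCarrier (dE.res.obj M) →ₗ[Rm] Z.carrier →ₗ[K] cE.eSub (cF.indObj M) :=
    { toFun := F
      map_add' := map_add F
      map_smul' := hF }
  exact ⟨TensorProduct.AlgebraTensorModule.lift F', fun l z =>
    congrArg (fun g : Z.carrier →ₗ[K] cE.eSub (cF.indObj M) => g z) (hF' l)⟩

/-- The homomorphism `R(m) e ⊗_{R(k)} e M ⊗ Z → e R(N) e ⊗_{R(n)} M` with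
`e ⊗ l ⊗ z ↦ e ζ(z) e ⊗ l`. -/
def toLin (M : GrMod 𝒢n) :
    dF.IndCarrier (dE.res.obj M) ⊗[K] Z.carrier →ₗ[Rm] cE.eSub (cF.indObj M) :=
  (s.exists_toLin M).choose

theorem toLin_indUnit (M : GrMod 𝒢n) (l : dE.eSub M) (z : Z.carrier) :
    s.toLin M (dF.indUnit (dE.res.obj M) l ⊗ₜ z) = s.pre M l z :=
  (s.exists_toLin M).choose_spec l z

theorem toLin_smul_indUnit (M : GrMod 𝒢n) (y : Rm) (l : dE.eSub M) (z : Z.carrier) :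
    s.toLin M ((y • dF.indUnit (dE.res.obj M) l) ⊗ₜ z) = y • s.pre M l z := by
  rw [← toLin_indUnit, ← map_smul, TensorProduct.smul_tmul']

theorem toLin_mem (M : GrMod 𝒢n) (d : ℤ)
    (x : dF.IndCarrier (dE.res.obj M) ⊗[K] Z.carrier)
    (hx : x ∈ tensorGrade (dF.indGrade (dE.res.obj M)) Z.grade d) :
    (s.toLin M x).1 ∈ cF.indGrade M d := by
  let G : dF.IndCarrier (dE.res.obj M) ⊗[K] Z.carrier →ₗ[K] cF.IndCarrier M :=
    (cE.eSub (cF.indObj M)).subtype ∘ₗ (s.toLin M).restrictScalars K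
  suffices H : tensorGrade (dF.indGrade (dE.res.obj M)) Z.grade d ≤ (cF.indGrade M d).comap G from
    H hx
  refine Submodule.span_le.2 ?_
  rintro _ ⟨i, j, y, z, rfl, ⟨y, hy, rfl⟩, hz, rfl⟩
  suffices H : tensorGrade dF.idealGrade (dE.res.obj M).grade i ≤
      (cF.indGrade M (i + j)).comap
        (G ∘ₗ (TensorProduct.mk K _ _).flip z ∘ₗ dF.indMk (dE.res.obj M)) from H hy
  refine Submodule.span_le.2 ?_
  rintro _ ⟨i₁, i₂, b, l, rfl, hb, hl, rfl⟩
  obtain ⟨b, hbe⟩ := b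
  obtain ⟨b', rfl⟩ := Submodule.mem_span_singleton.1 hbe
  have hb : b' * dF.e ∈ 𝒢m i₁ := hb
  have h1 : dF.indMk (dE.res.obj M) (⟨b' • dF.e, hbe⟩ ⊗ₜ[K] l)
      = b' • dF.indUnit (dE.res.obj M) l := rfl
  rw [SetLike.mem_coe, Submodule.mem_comap, LinearMap.comp_apply, LinearMap.comp_apply, h1]
  show (s.toLin M ((b' • dF.indUnit (dE.res.obj M) l) ⊗ₜ z)).1 ∈ _
  have h2 : s.toLin M ((b' • dF.indUnit (dE.res.obj M) l) ⊗ₜ z)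
      = (b' * dF.e) • s.pre M (show dE.eSub M from l) z :=
    (s.toLin_smul_indUnit M _ _ _).trans (by rw [mul_smul, e_smul_pre])
  have h3 : cE.ι (b' * dF.e) • cE.e • s.ζ z •
      cF.indUnit M (show dE.eSub M from l) ∈ cF.indGrade M (i₁ + i₂ + j) := by
    rw [add_assoc]
    refine cF.smul_mem_indGrade M (cE.ι_mem _ _ hb) ?_
    rw [← zero_add (i₂ + j)]
    refine cF.smul_mem_indGrade M cE.e_mem ?_
    rw [add_comm i₂ j]
    exact cF.smul_mem_indGrade M (s.ζ_mem _ _ hz) (cF.indUnit_mem M hl)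
  exact Eq.subst (motive := fun v => v ∈ cF.indGrade M (i₁ + i₂ + j))
    (congrArg Subtype.val h2).symm h3

variable [GradedAlgebra 𝒢m] [GradedAlgebra 𝒢k]

/-- The natural transformation attached to a square. -/
def natTrans : dE.res ⋙ dF.ind ⋙ tensorFunctor 𝒢m Z ⟶ cF.ind ⋙ cE.res where
  app M := GrMod.Hom.mk (M := tensorObj Z (dF.indObj (dE.res.obj M)))
    (N := cE.res.obj (cF.indObj M)) (s.toLin M) (s.toLin_mem M)
  naturality M M' f := by
    apply GrMod.hom_ext
    intro (x : dF.IndCarrier (dE.res.obj M) ⊗[K] Z.carrier)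
    show s.toLin M' ((tensorMap Z (dF.indMap (dE.res.map f))).toLin x)
      = (cE.res.map (cF.indMap f)).toLin (s.toLin M x)
    induction x using TensorProduct.induction_on with
    | zero =>
      refine (congrArg (s.toLin M') (map_zero _)).trans ((map_zero _).trans ?_)
      exact ((congrArg _ (map_zero (s.toLin M))).trans (map_zero _)).symm
    | add x y hx hy =>
      refine (congrArg (s.toLin M') (map_add _ x y)).trans ((map_add _ _ _).trans ?_)
      refine Eq.trans ?_ ((congrArg _ (map_add (s.toLin M) x y)).trans (map_add _ _ _)).symm
      exact congrArg₂ _ hx hy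
    | tmul y z =>
      induction y using dF.ind_induction with
      | add x y hx hy =>
        rw [TensorProduct.add_tmul]
        refine (congrArg (s.toLin M') (map_add _ _ _)).trans ((map_add _ _ _).trans ?_)
        refine Eq.trans ?_ ((congrArg _ (map_add (s.toLin M) _ _)).trans (map_add _ _ _)).symm
        exact congrArg₂ _ hx hy
      | smul b l =>
        have h1 : (tensorMap Z (dF.indMap (dE.res.map f))).toLin
            ((b • dF.indUnit (dE.res.obj M) l) ⊗ₜ[K] z)
            = (b • dF.indUnit (dE.res.obj M') ((dE.res.map f).toLin l)) ⊗ₜ[K] z := rfl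
        refine (congrArg (s.toLin M') h1).trans ((s.toLin_smul_indUnit M' _ _ _).trans ?_)
        refine Eq.trans ?_ (congrArg _ (s.toLin_smul_indUnit M b l z)).symm
        refine Eq.trans ?_ (map_smul _ _ _).symm
        refine congrArg (b • ·) (Subtype.ext ?_)
        refine Eq.trans ?_ (map_smul (cF.indMap f).toLin cE.e
          (s.ζ z • cF.indUnit M (show dE.eSub M from l))).symm
        refine congrArg (cE.e • ·) ?_
        exact (map_smul (cF.indMap f).toLin (s.ζ z)
          (cF.indUnit M (show dE.eSub M from l))).symm

end Square

end Summand

/-! ### Algebras of dots -/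

section Dots

/-- The ideal generated by the powers `X_i ^ a` for all exponents `a` in the set `s`. -/
def dotIdeal (K : Type u) [Field K] (s : Set ℕ) (p : ℕ) : Ideal (MvPolynomial (Fin p) K) :=
  Ideal.span {f | ∃ i, ∃ a ∈ s, MvPolynomial.X i ^ a = f}

/-- The algebra of dots on `p` strands.  The set `s` is empty for the polynomial algebra and
consists of the exponent `a` for the truncated polynomial algebra. -/
abbrev DotAlg (K : Type u) [Field K] (s : Set ℕ) (p : ℕ) : Type u :=
  MvPolynomial (Fin p) K ⧸ dotIdeal K s p

variable {K : Type u} [Field K] {s : Set ℕ} {p : ℕ}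

variable (K s) in
/-- The dot on the strand `i`. -/
def dot (i : Fin p) : DotAlg K s p := Ideal.Quotient.mk _ (MvPolynomial.X i)

theorem dot_pow (i : Fin p) {a : ℕ} (ha : a ∈ s) : dot K s i ^ a = 0 := by
  rw [dot, ← map_pow]
  exact Ideal.Quotient.eq_zero_iff_mem.2 (Ideal.subset_span ⟨i, a, ha, rfl⟩)

theorem dot_induction {P : DotAlg K s p → Prop} (algebraMap : ∀ c : K, P (algebraMap K _ c))
    (add : ∀ f g, P f → P g → P (f + g)) (mul_dot : ∀ f i, P f → P (f * dot K s i))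
    (f : DotAlg K s p) : P f := by
  obtain ⟨f, rfl⟩ := Ideal.Quotient.mk_surjective f
  induction f using MvPolynomial.induction_on with
  | C c => exact algebraMap c
  | add f g hf hg => rw [map_add]; exact add _ _ hf hg
  | mul_X f i hf => rw [map_mul]; exact mul_dot _ i hf

theorem exists_dotLift {B : Type*} [Ring B] [Algebra K B] (y : Fin p → B)
    (hc : ∀ i j, y i * y j = y j * y i) (hn : ∀ i, ∀ a ∈ s, y i ^ a = 0) :
    ∃ F : DotAlg K s p →ₐ[K] B, ∀ i, F (dot K s i) = y i := by
  obtain ⟨S, hS⟩ : ∃ S, S = Algebra.adjoin K (Set.range y) := ⟨_, rfl⟩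
  have : IsMulCommutative S := hS ▸ Algebra.isMulCommutative_adjoin K (by
    rintro _ ⟨i, rfl⟩ _ ⟨j, rfl⟩
    exact hc i j)
  let _ : CommRing S := { S.toRing with mul_comm := this.is_comm.comm }
  let y' : Fin p → S := fun i => ⟨y i, hS ▸ Algebra.subset_adjoin ⟨i, rfl⟩⟩
  let F : MvPolynomial (Fin p) K →ₐ[K] S := MvPolynomial.aeval y'
  have hF : ∀ f ∈ dotIdeal K s p, F f = 0 := by
    intro f hf
    have : dotIdeal K s p ≤ RingHom.ker F := by
      refine Ideal.span_le.2 ?_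
      rintro _ ⟨i, a, ha, rfl⟩
      rw [SetLike.mem_coe, RingHom.mem_ker, map_pow, MvPolynomial.aeval_X]
      exact Subtype.ext (hn i a ha)
    exact this hf
  refine ⟨S.val.comp (Ideal.Quotient.liftₐ _ F hF), fun i => ?_⟩
  show ((F (MvPolynomial.X i) : S) : B) = y i
  rw [MvPolynomial.aeval_X]

/-- The algebra homomorphism that sends the dots to given commuting elements. -/
def dotLift {B : Type*} [Ring B] [Algebra K B] (y : Fin p → B)
    (hc : ∀ i j, y i * y j = y j * y i) (hn : ∀ i, ∀ a ∈ s, y i ^ a = 0) :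
    DotAlg K s p →ₐ[K] B := (exists_dotLift y hc hn).choose

theorem dotLift_dot {B : Type*} [Ring B] [Algebra K B] (y : Fin p → B)
    (hc : ∀ i j, y i * y j = y j * y i) (hn : ∀ i, ∀ a ∈ s, y i ^ a = 0) (i : Fin p) :
    dotLift y hc hn (dot K s i) = y i := (exists_dotLift y hc hn).choose_spec i

/-- The action of a permutation on the algebra of dots. -/
def permDot (σ : Equiv.Perm (Fin p)) : DotAlg K s p →ₐ[K] DotAlg K s p :=
  dotLift (fun i => dot K s (σ i)) (fun _ _ => mul_comm _ _) (fun i _ ha => dot_pow (σ i) ha)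

theorem permDot_dot (σ : Equiv.Perm (Fin p)) (i : Fin p) :
    permDot σ (dot K s i) = dot K s (σ i) := dotLift_dot _ _ _ i

theorem permDot_one (f : DotAlg K s p) : permDot 1 f = f := by
  induction f using dot_induction with
  | algebraMap c => exact AlgHom.commutes _ c
  | add f g hf hg => rw [map_add, hf, hg]
  | mul_dot f i hf => rw [map_mul, hf, permDot_dot]; rfl

theorem permDot_mul (σ τ : Equiv.Perm (Fin p)) (f : DotAlg K s p) :
    permDot σ (permDot τ f) = permDot (σ * τ) f := by
  induction f using dot_induction with
  | algebraMap c => simp only [AlgHom.commutes]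
  | add f g hf hg => simp only [map_add, hf, hg]
  | mul_dot f i hf => simp only [map_mul, hf, permDot_dot, Equiv.Perm.mul_apply]

end Dots

/-! ### Quotients of the algebras `R(n)` -/

section System

/-- A family of graded quotients of the algebras `R(n)` with the universal property of the
quotient by the relations `x_1 ^ a = 0` for `a` in `s`, together with the inclusions on the first
strands and the idempotents on the last strands.  For `s = ∅` these are the algebras `R(n)`
themselves, and for `s = {a}` the cyclotomic quotients. -/
structure KLRSystem {K : Type u} [Field K] (r : ℕ) (s : Set ℕ) {R : ℕ → Type u}
    [∀ n, Ring (R n)] [∀ n, Algebra K (R n)] (𝒢 : ∀ n, ℤ → Submodule K (R n)) where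
  pr : ∀ n, KLR K n →ₐ[K] R n
  surj : ∀ n, Function.Surjective (pr n)
  nil : ∀ n (h : 0 < n), ∀ a ∈ s, pr n (gen K n (.x ⟨0, h⟩)) ^ a = 0
  lift : ∀ n {B : Type u} [Ring B] [Algebra K B] (f : KLR K n →ₐ[K] B),
    (∀ a ∈ s, ∀ h : 0 < n, f (gen K n (.x ⟨0, h⟩)) ^ a = 0) →
      ∃ f' : R n →ₐ[K] B, ∀ y, f' (pr n y) = f y
  pr_mem : ∀ n d y, y ∈ klrGrade K r n d → pr n y ∈ 𝒢 n d
  corner : ∀ {m ℓ n : ℕ} (_ : m + ℓ = n), Corner (𝒢 m) (𝒢 n)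
  corner_ι : ∀ {m ℓ n : ℕ} (h : m + ℓ = n) y,
    (corner h).ι (pr m y) = pr n (incl (Nat.le.intro h) y)
  corner_e : ∀ {m ℓ n : ℕ} (h : m + ℓ = n), (corner h).e = pr n (symIdem K h)

variable {K : Type u} [Field K] {r : ℕ} {s : Set ℕ} {R : ℕ → Type u}
  [∀ n, Ring (R n)] [∀ n, Algebra K (R n)] {𝒢 : ∀ n, ℤ → Submodule K (R n)}

theorem gen_mem (r : ℕ) {n : ℕ} (g : Gen n) : gen K n g ∈ klrGrade K r n (Gen.deg r g) :=
  Submodule.subset_span ⟨[g], by simp, by simp⟩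

namespace KLRSystem

variable (S : KLRSystem r s 𝒢)

/-- The image of `τ_w`. -/
def ρ (n : ℕ) (w : Equiv.Perm ℕ) : R n := S.pr n (rho K n w)

/-- The image of the dot `x_i`. -/
def x {n : ℕ} (i : Fin n) : R n := S.pr n (gen K n (.x i))

theorem ρ_one (n : ℕ) : S.ρ n 1 = 1 := by rw [ρ, rho_one, map_one]

theorem ρ_mul {n : ℕ} {v w : Equiv.Perm ℕ} (hv : v ∈ blk 0 n) (hw : w ∈ blk 0 n) :
    S.ρ n (v * w) = S.ρ n v * S.ρ n w := by rw [ρ, rho_mul hv hw, map_mul]; rfl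

theorem ρ_mul_x {n : ℕ} {w : Equiv.Perm ℕ} (hw : w ∈ blk 0 n) (i : Fin n) :
    S.ρ n w * S.x i = S.x (permFin hw i) * S.ρ n w := by
  rw [ρ, x, ← map_mul, rho_mul_x hw, map_mul, x]

theorem ρ_mul_prod {n : ℕ} {w : Equiv.Perm ℕ} (hw : w ∈ blk 0 n) (q : List (Fin n)) :
    S.ρ n w * (q.map S.x).prod = ((q.map (permFin hw)).map S.x).prod * S.ρ n w := by
  induction q with
  | nil => simp
  | cons i q ih =>
    rw [List.map_cons, List.prod_cons, ← mul_assoc, S.ρ_mul_x hw, mul_assoc, ih, List.map_cons,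
      List.map_cons, List.prod_cons, mul_assoc]

theorem x_comm {n : ℕ} (i j : Fin n) : S.x i * S.x j = S.x j * S.x i := by
  rw [x, x, ← map_mul, JordanKLR.x_comm, map_mul]

theorem ρ_inv_mul {n : ℕ} {w : Equiv.Perm ℕ} (hw : w ∈ blk 0 n) : S.ρ n w⁻¹ * S.ρ n w = 1 := by
  rw [← S.ρ_mul (inv_mem hw) hw, inv_mul_cancel, ρ_one]

theorem x_pow {n : ℕ} (i : Fin n) {a : ℕ} (ha : a ∈ s) : S.x i ^ a = 0 := by
  have hn : 0 < n := i.pos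
  have hw : Equiv.swap (i : ℕ) 0 ∈ blk 0 n := fun j hj =>
    Equiv.swap_apply_of_ne_of_ne (by omega) (by omega)
  have h0 : permFin hw i = ⟨0, hn⟩ := Fin.ext (Equiv.swap_apply_left _ _)
  have h1 : S.ρ n (Equiv.swap (i : ℕ) 0) * S.x i ^ a = 0 := by
    have : SemiconjBy (S.ρ n (Equiv.swap (i : ℕ) 0)) (S.x i) (S.x ⟨0, hn⟩) := h0 ▸ S.ρ_mul_x hw i
    rw [(this.pow_right a).eq, x, S.nil n hn a ha, zero_mul]
  rw [← one_mul (S.x i ^ a), ← S.ρ_inv_mul hw, mul_assoc, h1, mul_zero]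

theorem induction {n : ℕ} {P : R n → Prop} (algebraMap : ∀ c : K, P (algebraMap K _ c))
    (x : ∀ i, P (S.x i)) (ρ : ∀ w ∈ blk 0 n, P (S.ρ n w))
    (add : ∀ y z, P y → P z → P (y + z)) (mul : ∀ y z, P y → P z → P (y * z)) (y : R n) :
    P y := by
  obtain ⟨y, rfl⟩ := S.surj n y
  induction y using KLR.induction with
  | algebraMap c => rw [AlgHom.commutes]; exact algebraMap c
  | x i => exact x i
  | tau k hk => rw [← rho_sw hk]; exact ρ _ (sw_mem (Nat.zero_le k) hk)
  | add y z hy hz => rw [map_add]; exact add _ _ hy hz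
  | mul y z hy hz => rw [map_mul]; exact mul _ _ hy hz

section Corner

variable {m ℓ n : ℕ} (h : m + ℓ = n)

theorem ι_x (i : Fin m) : (S.corner h).ι (S.x i) = S.x (i.castLE (Nat.le.intro h)) := by
  rw [x, corner_ι, incl_x, x]

theorem ι_ρ {w : Equiv.Perm ℕ} (hw : w ∈ blk 0 m) : (S.corner h).ι (S.ρ m w) = S.ρ n w := by
  rw [ρ, corner_ι, incl_rho _ hw, ρ]

theorem e_eq : (S.corner h).e
    = (ℓ.factorial : K)⁻¹ • ∑ u : Equiv.Perm (Fin ℓ), S.ρ n (emb m u) := by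
  rw [corner_e, symIdem_eq, map_smul, map_sum]
  rfl

theorem ρ_mul_e {w : Equiv.Perm ℕ} (hw : w ∈ blk m n) :
    S.ρ n w * (S.corner h).e = (S.corner h).e := by
  rw [corner_e, ρ, ← map_mul, rho_mul_symIdem h hw]

theorem e_mul_ρ {w : Equiv.Perm ℕ} (hw : w ∈ blk m n) :
    (S.corner h).e * S.ρ n w = (S.corner h).e := by
  rw [corner_e, ρ, ← map_mul, symIdem_mul_rho h hw]

theorem e_mul_e [CharZero K] : (S.corner h).e * (S.corner h).e = (S.corner h).e := by
  rw [corner_e, ← map_mul, symIdem_mul_self]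

end Corner

/-- The dots on the strands `b, …, b + p - 1`. -/
def pol {n : ℕ} (b p : ℕ) (h : b + p ≤ n) : DotAlg K s p →ₐ[K] R n :=
  dotLift (fun i => S.x ⟨b + i, by omega⟩) (fun _ _ => S.x_comm _ _) (fun _ _ ha => S.x_pow _ ha)

theorem pol_dot {n b p : ℕ} (h : b + p ≤ n) (i : Fin p) :
    S.pol b p h (dot K s i) = S.x ⟨b + i, by omega⟩ := dotLift_dot _ _ _ i

theorem ρ_mul_pol {n b b' p : ℕ} (h : b + p ≤ n) (h' : b' + p ≤ n) {w : Equiv.Perm ℕ}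
    (hw : w ∈ blk 0 n) (σ : Equiv.Perm (Fin p)) (hσ : ∀ i : Fin p, w (b + i) = b' + σ i)
    (f : DotAlg K s p) : S.ρ n w * S.pol b p h f = S.pol b' p h' (permDot σ f) * S.ρ n w := by
  induction f using dot_induction with
  | algebraMap c => simp only [AlgHom.commutes, Algebra.commutes]
  | add f g hf hg => simp only [map_add, mul_add, add_mul, hf, hg]
  | mul_dot f i hf =>
    have : permFin hw ⟨b + i, by omega⟩ = ⟨b' + σ i, by omega⟩ := Fin.ext (hσ i)
    rw [map_mul, ← mul_assoc, hf, mul_assoc, pol_dot, ρ_mul_x S hw, map_mul, map_mul, permDot_dot,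
      pol_dot, mul_assoc, this]

theorem ρ_mul_pol_of_fix {n b p : ℕ} (h : b + p ≤ n) {w : Equiv.Perm ℕ} (hw : w ∈ blk 0 n)
    (hσ : ∀ i : Fin p, w (b + i) = b + i) (f : DotAlg K s p) :
    S.ρ n w * S.pol b p h f = S.pol b p h f * S.ρ n w := by
  rw [S.ρ_mul_pol h h hw 1 hσ, permDot_one]

theorem x_mul_pol {n b p : ℕ} (h : b + p ≤ n) (i : Fin n) (f : DotAlg K s p) :
    S.x i * S.pol b p h f = S.pol b p h f * S.x i := by
  induction f using dot_induction with
  | algebraMap c => simp only [AlgHom.commutes, Algebra.commutes]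
  | add f g hf hg => simp only [map_add, mul_add, add_mul, hf, hg]
  | mul_dot f j hf => rw [map_mul, ← mul_assoc, hf, mul_assoc, pol_dot, x_comm, mul_assoc]

theorem ρ_mem (n : ℕ) {w : Equiv.Perm ℕ} (hw : w ∈ blk 0 n) : S.ρ n w ∈ 𝒢 n 0 := by
  refine S.pr_mem n 0 _ ?_
  refine blk_induction (P := fun w => rho K n w ∈ klrGrade K r n 0) (Nat.zero_le n) ?_
    (fun k _ hk w hw ih => ?_) hw
  · rw [rho_one]
    exact word_mem _ _ [] rfl
  · rw [rho_sw_mul hk hw, ← add_zero (0 : ℤ)]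
    refine SetLike.GradedMul.mul_mem ?_ ih
    exact gen_mem r (.tau k hk)

theorem x_mem {n : ℕ} (i : Fin n) : S.x i ∈ 𝒢 n (2 * r) := by
  exact S.pr_mem n _ _ (gen_mem r (.x i))

theorem pol_mem [∀ n, SetLike.GradedMonoid (𝒢 n)] {n b p : ℕ} (h : b + p ≤ n) {d : ℤ}
    {f : MvPolynomial (Fin p) K} (hf : f ∈ polyGrade K r p d) :
    S.pol b p h (Ideal.Quotient.mk _ f) ∈ 𝒢 n d := by
  have hmon : ∀ c : Fin p →₀ ℕ, S.pol b p h (Ideal.Quotient.mk _ (MvPolynomial.monomial c 1))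
      ∈ 𝒢 n (Finsupp.weight (fun _ : Fin p => (2 * r : ℤ)) c) := by
    intro c
    induction c using Finsupp.induction_linear with
    | zero =>
      rw [map_zero, show MvPolynomial.monomial (0 : Fin p →₀ ℕ) (1 : K) = 1 from rfl, map_one,
        map_one]
      exact SetLike.GradedOne.one_mem
    | add c c' hc hc' =>
      rw [map_add, show MvPolynomial.monomial (c + c') (1 : K)
        = MvPolynomial.monomial c 1 * MvPolynomial.monomial c' 1 by
          rw [MvPolynomial.monomial_mul, one_mul], map_mul, map_mul]
      exact SetLike.GradedMul.mul_mem hc hc'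
    | single i k =>
      rw [← MvPolynomial.X_pow_eq_monomial, map_pow, map_pow, Finsupp.weight_apply,
        Finsupp.sum_single_index (by simp)]
      refine SetLike.pow_mem_graded k ?_
      show S.pol b p h (dot K s i) ∈ _
      rw [pol_dot]
      exact S.x_mem _
  rw [f.as_sum, map_sum, map_sum]
  refine Submodule.sum_mem _ fun c hc => ?_
  rw [← hf (MvPolynomial.mem_support_iff.1 hc)]
  have : MvPolynomial.monomial c (f.coeff c) = f.coeff c • MvPolynomial.monomial c (1 : K) := by
    rw [MvPolynomial.smul_monomial, smul_eq_mul, mul_one]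
  rw [this, show Ideal.Quotient.mk (dotIdeal K s p) (f.coeff c • MvPolynomial.monomial c 1)
    = f.coeff c • Ideal.Quotient.mk (dotIdeal K s p) (MvPolynomial.monomial c 1) from rfl, map_smul]
  exact Submodule.smul_mem _ (f.coeff c) (hmon c)

end KLRSystem

end System

/-! ### The summands of the Mackey decomposition -/

/-- The sizes of the blocks of strands in a double coset: `n = k + c`, `m = k + b`, `t = b + p`
and `ℓ = c + p`, where `n + t = N = m + ℓ`. -/
structure Blocks (k c b p n t m ℓ N : ℕ) : Prop where
  n_eq : k + c = n
  m_eq : k + b = m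
  t_eq : b + p = t
  ℓ_eq : c + p = ℓ
  hn : n + t = N
  hm : m + ℓ = N

theorem blockSwap_conj_left {k c b : ℕ} {g : Equiv.Perm ℕ} (hg : g ∈ blk k (k + b)) :
    (blockSwap k c b)⁻¹ * g * blockSwap k c b ∈ blk (k + c) (k + c + b) := by
  intro i hi
  have : g (blockSwap k c b i) = blockSwap k c b i :=
    hg _ (by rw [blockSwap_apply]; split_ifs <;> omega)
  rw [Equiv.Perm.mul_apply, Equiv.Perm.mul_apply, this, perm_inv_apply]

theorem blockSwap_conj_right {k c b : ℕ} {g : Equiv.Perm ℕ} (hg : g ∈ blk (k + b) (k + b + c)) :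
    (blockSwap k c b)⁻¹ * g * blockSwap k c b ∈ blk k (k + c) := by
  intro i hi
  have : g (blockSwap k c b i) = blockSwap k c b i :=
    hg _ (by rw [blockSwap_apply]; split_ifs <;> omega)
  rw [Equiv.Perm.mul_apply, Equiv.Perm.mul_apply, this, perm_inv_apply]

/-- An identification of a graded space `Z` with the invariants in the algebra of dots on `p`
strands. -/
structure SymDots {K : Type u} [Field K] (r : ℕ) (s : Set ℕ) (p : ℕ) (Z : GrSpace K) where
  toDot : Z.carrier →ₗ[K] DotAlg K s p
  injective : Function.Injective toDot
  perm : ∀ σ z, permDot σ (toDot z) = toDot z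
  exists_eq : ∀ f, (∀ σ, permDot σ f = f) → ∃ z, toDot z = f
  exists_lift : ∀ d z, z ∈ Z.grade d →
    ∃ f ∈ polyGrade K r p d, Ideal.Quotient.mk (dotIdeal K s p) f = toDot z

namespace KLRSystem

variable {K : Type u} [Field K] {r : ℕ} {s : Set ℕ} {R : ℕ → Type u}
  [∀ n, Ring (R n)] [∀ n, Algebra K (R n)] {𝒢 : ∀ n, ℤ → Submodule K (R n)}
  (S : KLRSystem r s 𝒢) {k c b p n t m ℓ N : ℕ}

/-- The intertwiner `τ_w z`, where `w` exchanges two blocks of strands and `z` consists of dots on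
the last `p` strands. -/
def twine (hB : Blocks k c b p n t m ℓ N) : DotAlg K s p →ₗ[K] R N :=
  LinearMap.mulLeft K (S.ρ N (blockSwap k c b)) ∘ₗ
    (S.pol (k + c + b) p (by have := hB.n_eq; have := hB.t_eq; have := hB.hn; omega)).toLinearMap

theorem twine_apply (hB : Blocks k c b p n t m ℓ N) (f : DotAlg K s p) :
    S.twine hB f = S.ρ N (blockSwap k c b) *
      S.pol (k + c + b) p (by have := hB.n_eq; have := hB.t_eq; have := hB.hn; omega) f := rfl

theorem blockSwap_mem_zero (hB : Blocks k c b p n t m ℓ N) : blockSwap k c b ∈ blk 0 N :=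
  blk_mono (Nat.zero_le k) (by have := hB.n_eq; have := hB.t_eq; have := hB.hn; omega)
    (blockSwap_mem k c b)

theorem ρ_mul_twine (hB : Blocks k c b p n t m ℓ N) {g : Equiv.Perm ℕ} (hg : g ∈ blk 0 m)
    (f : DotAlg K s p) : S.ρ N g * S.twine hB f
      = S.twine hB f * S.ρ N ((blockSwap k c b)⁻¹ * g * blockSwap k c b) := by
  obtain ⟨rfl, rfl, rfl, rfl, rfl, h⟩ := hB
  have hw : blockSwap k c b ∈ blk 0 (k + c + (b + p)) :=
    blk_mono (Nat.zero_le k) (by omega) (blockSwap_mem k c b)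
  have hg' : g ∈ blk 0 (k + c + (b + p)) := blk_mono le_rfl (by omega) hg
  have hc : (blockSwap k c b)⁻¹ * g * blockSwap k c b ∈ blk 0 (k + c + (b + p)) :=
    mul_mem (mul_mem (inv_mem hw) hg') hw
  rw [twine_apply, mul_assoc, ← S.ρ_mul_pol_of_fix _ hc, ← mul_assoc, ← mul_assoc,
    ← S.ρ_mul hg' hw, ← S.ρ_mul hw hc]
  · congr 2
    group
  · intro i
    have h1 : blockSwap k c b (k + c + b + i) = k + c + b + i := by
      rw [blockSwap_apply]; split_ifs <;> omega
    rw [Equiv.Perm.mul_apply, Equiv.Perm.mul_apply, h1, hg _ (.inr (by omega)),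
      Equiv.Perm.inv_eq_iff_eq, h1]

theorem x_mul_twine (hB : Blocks k c b p n t m ℓ N) (i j : Fin N)
    (hij : blockSwap k c b j = i) (f : DotAlg K s p) :
    S.x i * S.twine hB f = S.twine hB f * S.x j := by
  have : permFin (blockSwap_mem_zero hB) j = i := Fin.ext hij
  rw [twine_apply, mul_assoc, ← x_mul_pol, ← mul_assoc, ← mul_assoc,
    S.ρ_mul_x (blockSwap_mem_zero hB), this]

theorem ρ_smul_indUnit' {n ℓ N : ℕ} (h : n + ℓ = N) (M : GrMod (𝒢 n)) {w : Equiv.Perm ℕ}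
    (hw : w ∈ blk 0 n) (l : M.carrier) :
    S.ρ N w • (S.corner h).indUnit M l = (S.corner h).indUnit M (S.ρ n w • l) := by
  rw [← (S.corner h).ι_smul_indUnit, ι_ρ S h hw]

variable [CharZero K]

theorem ρ_smul_indUnit {n ℓ N : ℕ} (h : n + ℓ = N) (M : GrMod (𝒢 n)) {w : Equiv.Perm ℕ}
    (hw : w ∈ blk n N) (l : M.carrier) :
    S.ρ N w • (S.corner h).indUnit M l = (S.corner h).indUnit M l := by
  rw [← (S.corner h).e_smul_indUnit (S.e_mul_e h) M l, smul_smul, S.ρ_mul_e h hw]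

section Absorb

variable (hB : Blocks k c b p n t m ℓ N) (M : GrMod (𝒢 n))

/-- Absorbing the symmetrizer of the `c` strands into the module. -/
theorem e_smul_twine_symm_left (f : DotAlg K s p) (l : M.carrier) :
    ((S.corner hB.hm).e * S.twine hB f) • (S.corner hB.hn).indUnit M l
      = ((S.corner hB.hm).e * S.twine hB f) •
        (S.corner hB.hn).indUnit M ((S.corner hB.n_eq).e • l) := by
  have h1 := hB.n_eq
  have h2 := hB.m_eq
  have h3 := hB.hn
  have h4 := hB.t_eq
  have h5 := hB.ℓ_eq
  have h6 := hB.hm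
  have key : ∀ u : Equiv.Perm (Fin c), ((S.corner hB.hm).e * S.twine hB f) •
      (S.corner hB.hn).indUnit M (S.ρ n (emb k u) • l)
        = ((S.corner hB.hm).e * S.twine hB f) • (S.corner hB.hn).indUnit M l := by
    intro u
    -- On the other side of the block exchange, `u` permutes `c` of the last `ℓ` strands.
    have hw := blockSwap_mem_zero hB
    have hg : emb (k + b) u ∈ blk m N := blk_mono h2.ge (by omega) (emb_mem (k + b) u)
    have hg0 : emb (k + b) u ∈ blk 0 N := blk_mono (Nat.zero_le _) le_rfl hg
    have hc : (blockSwap k c b)⁻¹ * emb (k + b) u * blockSwap k c b = emb k u := by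
      have h7 := blockSwap_conj_right (c := c) (emb_mem (k + b) u)
      obtain ⟨v, hv⟩ := exists_emb h7
      rw [← hv]
      congr 1
      refine Equiv.ext fun i => Fin.ext ?_
      have e1 := emb_apply k v i
      have h8 : blockSwap k c b (k + i) = k + b + i := by
        rw [blockSwap_apply]; have := i.2; split_ifs <;> omega
      have h9 := (u i).2
      rw [hv, Equiv.Perm.mul_apply, Equiv.Perm.mul_apply, h8, emb_apply, blockSwap_inv,
        blockSwap_apply] at e1
      split_ifs at e1 <;> omega
    rw [← ρ_smul_indUnit' S hB.hn M (emb_mem_zero (by omega) u), smul_smul]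
    congr 1
    have hu : emb k u ∈ blk 0 N := emb_mem_zero (by omega) u
    conv_rhs => rw [← S.e_mul_ρ hB.hm hg]
    rw [mul_assoc, mul_assoc]
    congr 1
    rw [twine_apply, mul_assoc, ← S.ρ_mul_pol_of_fix _ hu fun i => emb_mem k u _ (.inr (by omega)),
      ← mul_assoc, ← mul_assoc, ← S.ρ_mul hw hu, ← S.ρ_mul hg0 hw, ← hc]
    congr 2
    group
  rw [S.e_eq hB.n_eq, smul_assoc, map_smul, Finset.sum_smul, map_sum, smul_comm, Finset.smul_sum]
  simp only [key]
  exact (inv_factorial_smul_sum c _).symm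

/-- Absorbing permutations of the last `p` strands into the dots. -/
theorem e_smul_twine_permDot (f : DotAlg K s p) (σ : Equiv.Perm (Fin p)) (l : M.carrier) :
    ((S.corner hB.hm).e * S.twine hB (permDot σ f)) • (S.corner hB.hn).indUnit M l
      = ((S.corner hB.hm).e * S.twine hB f) • (S.corner hB.hn).indUnit M l := by
  have h1 := hB.n_eq
  have h2 := hB.m_eq
  have h3 := hB.hn
  have h4 := hB.t_eq
  have h5 := hB.ℓ_eq
  have h6 := hB.hm
  have hw := blockSwap_mem_zero hB
  have hg : emb (k + c + b) σ ∈ blk (k + c + b) N := emb_mem_of_eq (by omega) σ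
  have hg0 : emb (k + c + b) σ ∈ blk 0 N := blk_mono (Nat.zero_le _) le_rfl hg
  have key : S.ρ N (emb (k + c + b) σ) * S.twine hB f
      = S.twine hB (permDot σ f) * S.ρ N (emb (k + c + b) σ) := by
    rw [twine_apply, twine_apply, mul_assoc, ← S.ρ_mul_pol _ _ hg0 σ fun i => emb_apply _ σ i,
      ← mul_assoc, ← mul_assoc, ← S.ρ_mul hw hg0, ← S.ρ_mul hg0 hw,
      ← blk_commute le_rfl (blockSwap_mem k c b) hg]
  rw [← ρ_smul_indUnit S hB.hn M (blk_mono (by omega) le_rfl hg) l, smul_smul, mul_assoc, ← key,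
    ← mul_assoc, S.e_mul_ρ hB.hm (blk_mono (by omega) le_rfl hg),
    ρ_smul_indUnit S hB.hn M (blk_mono (by omega) le_rfl hg) l]

end Absorb

variable [∀ n, GradedAlgebra (𝒢 n)]

/-- The square of algebras attached to a double coset. -/
def square (hB : Blocks k c b p n t m ℓ N) {Z : GrSpace K} (D : SymDots r s p Z) :
    Square (S.corner hB.hn) (S.corner hB.hm) (S.corner hB.n_eq) (S.corner hB.m_eq) Z where
  ζ := S.twine hB ∘ₗ D.toDot
  ζ_mem d z hz := by
    obtain ⟨f, hf, hfz⟩ := D.exists_lift d z hz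
    rw [LinearMap.comp_apply, ← hfz, twine_apply, ← zero_add d]
    exact SetLike.GradedMul.mul_mem (S.ρ_mem N (blockSwap_mem_zero hB)) (S.pol_mem _ hf)
  ζ_comm y z := by
    rw [LinearMap.comp_apply]
    generalize D.toDot z = f
    have h1 := hB.n_eq
    have h2 := hB.m_eq
    have h3 := hB.hn
    induction y using S.induction with
    | algebraMap a => simp only [AlgHom.commutes, Algebra.commutes]
    | x i =>
      rw [ι_x, ι_x, ι_x, ι_x]
      refine S.x_mul_twine hB _ _ ?_ f
      show blockSwap k c b (i : ℕ) = i
      rw [blockSwap_apply, if_pos i.2]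
    | ρ w hw =>
      rw [ι_ρ S _ hw, ι_ρ S _ hw, ι_ρ S _ (blk_mono le_rfl (by omega) hw),
        ι_ρ S _ (blk_mono le_rfl (by omega) hw), S.ρ_mul_twine hB (blk_mono le_rfl (by omega) hw),
        mul_assoc, blk_commute le_rfl hw (blockSwap_mem k c b), inv_mul_cancel_left]
    | add y y' h h' => simp only [map_add, add_mul, mul_add, h, h']
    | mul y y' h h' => simp only [map_mul, mul_assoc, h']; simp only [← mul_assoc, h]
  e_ζ z := by
    rw [LinearMap.comp_apply]
    generalize D.toDot z = f
    have h1 := hB.n_eq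
    have h2 := hB.m_eq
    have h3 := hB.hn
    have h4 := hB.t_eq
    rw [e_eq, map_smul, map_sum, smul_mul_assoc, smul_mul_assoc, Finset.sum_mul, Finset.sum_mul]
    have : ∀ u : Equiv.Perm (Fin b), (S.corner hB.hm).ι (S.ρ m (emb k u)) * S.twine hB f *
        (S.corner hB.hn).e = S.twine hB f * (S.corner hB.hn).e := by
      intro u
      have hu : emb k u ∈ blk 0 m := emb_mem_zero h2.le u
      rw [S.ι_ρ _ hu, S.ρ_mul_twine hB hu, mul_assoc, S.ρ_mul_e hB.hn]
      exact blk_mono h1.ge (by omega) (blockSwap_conj_left (emb_mem k u))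
    simp only [this]
    exact inv_factorial_smul_sum b _
  idem := S.e_mul_e _

/-! ### Surjectivity -/

section Surj

variable (hB : Blocks k c b p n t m ℓ N) {Z : GrSpace K} (D : SymDots r s p Z) (M : GrMod (𝒢 n))

theorem exists_pre_eq (f : DotAlg K s p) (l : M.carrier) : ∃ l' z,
    (((S.square hB D).pre M l' z).1 : (S.corner hB.hn).IndCarrier M)
      = ((S.corner hB.hm).e * S.twine hB f) • (S.corner hB.hn).indUnit M l := by
  let f' : DotAlg K s p := (p.factorial : K)⁻¹ • ∑ σ : Equiv.Perm (Fin p), permDot σ f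
  obtain ⟨z, hz⟩ := D.exists_eq f' (fun σ => by
    rw [map_smul, map_sum]
    congr 1
    refine Fintype.sum_equiv (Equiv.mulLeft σ) _ _ fun τ => ?_
    rw [permDot_mul]
    rfl)
  refine ⟨⟨(S.corner hB.n_eq).e • l, l, rfl⟩, z, ?_⟩
  show (S.corner hB.hm).e • S.twine hB (D.toDot z) •
    (S.corner hB.hn).indUnit M ((S.corner hB.n_eq).e • l) = _
  rw [smul_smul, ← e_smul_twine_symm_left, hz, map_smul, map_sum, mul_smul_comm, Finset.mul_sum,
    smul_assoc, Finset.sum_smul]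
  simp only [e_smul_twine_permDot]
  exact inv_factorial_smul_sum p _

/-- The image of a summand contains everything of the form `e τ_w x_{i_1} ⋯ x_{i_q} e ⊗ l`, where
`w` is the corresponding block exchange. -/
theorem e_smul_twine_mem_range (q : List (Fin N)) (y : R m) (f : DotAlg K s p) (l : M.carrier) :
    ∃ x, ((S.square hB D).toLin M x).1 = ((S.corner hB.hm).ι y * ((S.corner hB.hm).e *
      S.twine hB f) * (q.map S.x).prod) • (S.corner hB.hn).indUnit M l := by
  have h1 := hB.n_eq
  have h2 := hB.m_eq
  have h3 := hB.hn
  have h4 := hB.t_eq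
  induction q generalizing y f l with
  | nil =>
    obtain ⟨l', z, h⟩ := S.exists_pre_eq hB D M f l
    refine ⟨(y • (S.corner hB.m_eq).indUnit _ l') ⊗ₜ z, ?_⟩
    rw [List.map_nil, List.prod_nil, mul_one, mul_smul, ← h]
    exact congrArg Subtype.val ((S.square hB D).toLin_smul_indUnit M y l' z)
  | cons i q ih =>
    rw [List.map_cons, List.prod_cons]
    rcases lt_or_ge (i : ℕ) n with hi | hi
    · -- a dot on the first `n` strands is absorbed into the module
      obtain ⟨x, hx⟩ := ih y f (S.x ⟨i, hi⟩ • l)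
      refine ⟨x, hx.trans ?_⟩
      have hc : S.x i * (q.map S.x).prod = (q.map S.x).prod * S.x i :=
        Commute.list_prod_right _ _ fun z hz => by
          obtain ⟨j, _, rfl⟩ := List.mem_map.1 hz
          exact S.x_comm i j
      rw [hc, ← (S.corner hB.hn).ι_smul_indUnit, S.ι_x, smul_smul, mul_assoc _ (q.map S.x).prod]
      rfl
    rcases lt_or_ge (i : ℕ) (k + c + b) with hi' | hi'
    · -- a dot on the next `b` strands moves through the block exchange
      obtain ⟨x, hx⟩ := ih (y * S.x ⟨i - c, by omega⟩) f l
      refine ⟨x, hx.trans ?_⟩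
      congr 1
      rw [map_mul, S.ι_x, mul_assoc _ (S.x _), ← mul_assoc (S.x _), ← S.ι_x hB.hm,
        ← ((S.corner hB.hm).comm _).eq, S.ι_x, mul_assoc _ (S.x _),
        S.x_mul_twine hB _ i (by
          rw [blockSwap_apply]
          simp only [Fin.val_castLE]
          split_ifs <;> omega)]
      simp only [mul_assoc]
    · -- a dot on the last `p` strands is absorbed into `f`
      obtain ⟨x, hx⟩ := ih y (f * dot K s ⟨i - (k + c + b), by omega⟩) l
      refine ⟨x, hx.trans ?_⟩
      congr 1
      rw [twine_apply, map_mul, pol_dot, twine_apply]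
      have : (⟨k + c + b + (i - (k + c + b)), by omega⟩ : Fin N) = i := Fin.ext (by simp; omega)
      simp only [this, mul_assoc]

end Surj

end KLRSystem

/-! ### Functions on the symmetric group -/

section Delta

variable {K : Type u} [Field K] {V : Type u} [AddCommGroup V] [Module K V] {n : ℕ}

open Classical in
variable (K) in
/-- The function on the symmetric group that is concentrated at `w`. -/
def delta (w : blk 0 n) : V →ₗ[K] (blk 0 n → V) := LinearMap.single K (fun _ => V) w

theorem delta_self (w : blk 0 n) (y : V) : delta K w y w = y := by
  classical
  exact Pi.single_eq_same (M := fun _ : blk 0 n => V) w y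

theorem delta_ne {w w' : blk 0 n} (h : w' ≠ w) (y : V) : delta K w y w' = 0 := by
  classical
  exact Pi.single_eq_of_ne (M := fun _ : blk 0 n => V) h y

theorem transEnd_delta (g w : blk 0 n) (y : V) :
    transEnd (K := K) V g (delta K w y) = delta K (g * w) y := by
  funext w'
  show delta K w y (g⁻¹ * w') = _
  by_cases h : w' = g * w
  · subst h
    rw [inv_mul_cancel_left, delta_self, delta_self]
  · rw [delta_ne h, delta_ne]
    rintro rfl
    exact h (by group)

theorem dotEnd_delta (X : ℕ → Module.End K V) (i : ℕ) (w : blk 0 n) (y : V) :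
    dotEnd n X i (delta K w y) = delta K w (X ((w : Equiv.Perm ℕ)⁻¹ i) y) := by
  funext w'
  show X ((w' : Equiv.Perm ℕ)⁻¹ i) (delta K w y w') = _
  by_cases h : w' = w
  · subst h
    rw [delta_self, delta_self]
  · rw [delta_ne h, delta_ne h, map_zero]

end Delta

namespace KLRSystem

variable {K : Type u} [Field K] {r : ℕ} {s : Set ℕ} {R : ℕ → Type u}
  [∀ n, Ring (R n)] [∀ n, Algebra K (R n)] {𝒢 : ∀ n, ℤ → Submodule K (R n)}
  (S : KLRSystem r s 𝒢)

section Rep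

variable {V : Type u} [AddCommGroup V] [Module K V] {N : ℕ} (X : ℕ → Module.End K V)
  (hX : ∀ i j, X i * X j = X j * X i) (hn : ∀ i < N, ∀ a ∈ s, X i ^ a = 0)

include hn in
theorem exists_rep : ∃ α : R N →ₐ[K] Module.End K (blk 0 N → V),
    ∀ y, α (S.pr N y) = funRep N X hX y := by
  refine S.lift N (funRep N X hX) fun a ha h => ?_
  rw [funRep_x]
  have key : ∀ q φ w, (dotEnd N X 0 ^ q) φ w = (X ((w : Equiv.Perm ℕ)⁻¹ 0) ^ q) (φ w) := by
    intro q φ w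
    induction q with
    | zero => rfl
    | succ q ih =>
      rw [pow_succ', pow_succ']
      exact congrArg _ ih
  refine LinearMap.ext fun φ => funext fun w => (key a φ w).trans ?_
  rw [hn _ ((blk_lt_iff (.inr le_rfl) (inv_mem w.2) 0).2 h) a ha]
  rfl

/-- The representation on functions on the symmetric group that belongs to commuting operators
`X_i` on `V`. -/
def rep : R N →ₐ[K] Module.End K (blk 0 N → V) := (S.exists_rep X hX hn).choose

theorem rep_x (i : Fin N) : S.rep X hX hn (S.x i) = dotEnd N X i :=
  ((S.exists_rep X hX hn).choose_spec _).trans (funRep_x X hX i)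

theorem rep_ρ (g : blk 0 N) : S.rep X hX hn (S.ρ N g) = transEnd V g :=
  ((S.exists_rep X hX hn).choose_spec _).trans (funRep_rho X hX g)

theorem rep_ρ_delta {g : Equiv.Perm ℕ} (hg : g ∈ blk 0 N) (w : blk 0 N) (y : V) :
    S.rep X hX hn (S.ρ N g) (delta K w y) = delta K (⟨g, hg⟩ * w) y := by
  rw [S.rep_ρ X hX hn ⟨g, hg⟩, transEnd_delta]

theorem rep_x_delta (i : Fin N) (w : blk 0 N) (y : V) :
    S.rep X hX hn (S.x i) (delta K w y) = delta K w (X ((w : Equiv.Perm ℕ)⁻¹ i) y) := by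
  rw [rep_x, dotEnd_delta]

/-- Dots preserve the support of a function. -/
theorem rep_pol_delta {b p : ℕ} (h : b + p ≤ N) (w : blk 0 N) (f : DotAlg K s p) (y : V) :
    ∃ y', S.rep X hX hn (S.pol b p h f) (delta K w y) = delta K w y' := by
  induction f using dot_induction generalizing y with
  | algebraMap c =>
    refine ⟨c • y, ?_⟩
    rw [AlgHom.commutes, AlgHom.commutes, map_smul]
    rfl
  | add f g hf hg =>
    obtain ⟨y₁, h₁⟩ := hf y
    obtain ⟨y₂, h₂⟩ := hg y
    exact ⟨y₁ + y₂, by rw [map_add, map_add, LinearMap.add_apply, h₁, h₂, map_add]⟩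
  | mul_dot f i hf =>
    obtain ⟨y₁, h₁⟩ := hf (X ((w : Equiv.Perm ℕ)⁻¹ (b + i : ℕ)) y)
    refine ⟨y₁, ?_⟩
    rw [map_mul, map_mul, pol_dot, Module.End.mul_apply, rep_x_delta, h₁]

/-- If the dots of `p` consecutive strands act on `V` through an action of the algebra of dots and
`w` permutes these strands, then they act in the same way at `w`, up to this permutation. -/
theorem rep_pol_delta_eq {b p : ℕ} (h : b + p ≤ N) (w : blk 0 N) (σ : Equiv.Perm (Fin p))
    (hσ : ∀ i : Fin p, (w : Equiv.Perm ℕ)⁻¹ (b + i) = b + σ i)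
    (A : DotAlg K s p →ₐ[K] Module.End K V) (hA : ∀ i : Fin p, A (dot K s i) = X (b + i))
    (f : DotAlg K s p) (y : V) :
    S.rep X hX hn (S.pol b p h f) (delta K w y) = delta K w (A (permDot σ f) y) := by
  induction f using dot_induction generalizing y with
  | algebraMap c =>
    rw [AlgHom.commutes, AlgHom.commutes, AlgHom.commutes, AlgHom.commutes]
    exact (map_smul (delta K w) c y).symm
  | add f g hf hg => simp only [map_add, LinearMap.add_apply, hf, hg]
  | mul_dot f i hf =>
    rw [map_mul, map_mul, pol_dot, Module.End.mul_apply, rep_x_delta, hf, map_mul, map_mul,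
      permDot_dot, hA, Module.End.mul_apply]
    congr 3
    exact congrArg X (hσ i)

end Rep

variable {k c b p n t m ℓ N : ℕ}
  (hB : Blocks k c b p n t m ℓ N) (M : GrMod (𝒢 n))

variable (K s b p) in
/-- The space `M ⊗ Q_b ⊗ Q_p`, where `Q_b` is the algebra of dots on `b` strands.  It contains the
values of the functions on `S_N` that represent the elements of `F_t M`. -/
abbrev Vals (M : GrMod (𝒢 n)) : Type u := (M.carrier ⊗[K] DotAlg K s b) ⊗[K] DotAlg K s p

/-- The operator of the dot on strand `i` on `M ⊗ Q_b ⊗ Q_p`: the first `n` strands belong to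
`M`, the next `b` strands to `Q_b`, the last `p` strands to `Q_p`. -/
def strandEnd (i : ℕ) : Module.End K (Vals K s b p M) :=
  if h : i < n then (Algebra.lsmul K K M.carrier (S.x ⟨i, h⟩)).rTensor _ |>.rTensor _
  else if h : i < n + b then
    ((LinearMap.mulLeft K (dot K s ⟨i - n, by omega⟩)).lTensor M.carrier).rTensor _
  else if h : i < N then (LinearMap.mulLeft K (dot K s ⟨i - (n + b), by
    have := hB.hn; have := hB.t_eq; omega⟩)).lTensor _
  else 0

theorem strandEnd_left {i : ℕ} (h : i < n) (l : M.carrier) (f : DotAlg K s b) (g : DotAlg K s p) :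
    S.strandEnd hB M i ((l ⊗ₜ f) ⊗ₜ g) = ((S.x ⟨i, h⟩ • l) ⊗ₜ f) ⊗ₜ g := by
  rw [strandEnd, dif_pos h]
  rfl

theorem strandEnd_mid {i : ℕ} (h : n ≤ i) (h' : i < n + b) (l : M.carrier) (f : DotAlg K s b)
    (g : DotAlg K s p) : S.strandEnd hB M i ((l ⊗ₜ f) ⊗ₜ g)
      = (l ⊗ₜ (dot K s ⟨i - n, by omega⟩ * f)) ⊗ₜ g := by
  rw [strandEnd, dif_neg (by omega), dif_pos h']
  rfl

theorem strandEnd_right_eq {i : ℕ} (h : n + b ≤ i) (h' : i < N) : S.strandEnd hB M i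
      = (LinearMap.mulLeft K (dot K s ⟨i - (n + b), by
          have := hB.hn; have := hB.t_eq; omega⟩)).lTensor _ := by
  rw [strandEnd, dif_neg (by omega), dif_neg (by omega), dif_pos h']

theorem strandEnd_right {i : ℕ} (h : n + b ≤ i) (h' : i < N) (l : M.carrier) (f : DotAlg K s b)
    (g : DotAlg K s p) : S.strandEnd hB M i ((l ⊗ₜ f) ⊗ₜ g)
      = (l ⊗ₜ f) ⊗ₜ (dot K s ⟨i - (n + b), by
          have := hB.hn; have := hB.t_eq; omega⟩ * g) := by
  rw [strandEnd_right_eq S hB M h h']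
  rfl

theorem strandEnd_zero {i : ℕ} (h : n + b ≤ i) (h' : N ≤ i) : S.strandEnd hB M i = 0 := by
  rw [strandEnd, dif_neg (by omega), dif_neg (by omega), dif_neg (by omega)]

theorem strandEnd_comm (i j : ℕ) : S.strandEnd hB M i * S.strandEnd hB M j
    = S.strandEnd hB M j * S.strandEnd hB M i := by
  have h1 := hB.t_eq
  have h2 := hB.hn
  refine TensorProduct.ext_threefold fun l f g => ?_
  rw [Module.End.mul_apply, Module.End.mul_apply]
  rcases lt_or_ge i n with hi | hi
  · rcases lt_or_ge j n with hj | hj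
    · rw [S.strandEnd_left hB M hi, S.strandEnd_left hB M hj, S.strandEnd_left hB M hi,
        S.strandEnd_left hB M hj, smul_smul, smul_smul, S.x_comm]
    · rcases lt_or_ge j (n + b) with hj' | hj'
      · rw [S.strandEnd_left hB M hi, S.strandEnd_mid hB M hj hj', S.strandEnd_left hB M hi,
          S.strandEnd_mid hB M hj hj']
      · rcases lt_or_ge j N with hj'' | hj''
        · rw [S.strandEnd_left hB M hi, S.strandEnd_right hB M hj' hj'', S.strandEnd_left hB M hi,
            S.strandEnd_right hB M hj' hj'']
        · rw [S.strandEnd_zero hB M hj' hj'']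
          exact map_zero _
  · rcases lt_or_ge i (n + b) with hi' | hi'
    · rcases lt_or_ge j n with hj | hj
      · rw [S.strandEnd_left hB M hj, S.strandEnd_mid hB M hi hi', S.strandEnd_mid hB M hi hi',
          S.strandEnd_left hB M hj]
      · rcases lt_or_ge j (n + b) with hj' | hj'
        · rw [S.strandEnd_mid hB M hi hi', S.strandEnd_mid hB M hj hj', S.strandEnd_mid hB M hi hi',
            S.strandEnd_mid hB M hj hj', mul_left_comm]
        · rcases lt_or_ge j N with hj'' | hj''
          · rw [S.strandEnd_mid hB M hi hi', S.strandEnd_right hB M hj' hj'',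
              S.strandEnd_mid hB M hi hi', S.strandEnd_right hB M hj' hj'']
          · rw [S.strandEnd_zero hB M hj' hj'']
            exact map_zero _
    · rcases lt_or_ge i N with hi'' | hi''
      · rcases lt_or_ge j n with hj | hj
        · rw [S.strandEnd_left hB M hj, S.strandEnd_right hB M hi' hi'',
            S.strandEnd_right hB M hi' hi'', S.strandEnd_left hB M hj]
        · rcases lt_or_ge j (n + b) with hj' | hj'
          · rw [S.strandEnd_mid hB M hj hj', S.strandEnd_right hB M hi' hi'',
              S.strandEnd_right hB M hi' hi'', S.strandEnd_mid hB M hj hj']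
          · rcases lt_or_ge j N with hj'' | hj''
            · rw [S.strandEnd_right hB M hi' hi'', S.strandEnd_right hB M hj' hj'',
                S.strandEnd_right hB M hi' hi'', S.strandEnd_right hB M hj' hj'', mul_left_comm]
            · rw [S.strandEnd_zero hB M hj' hj'']
              exact map_zero _
      · rw [S.strandEnd_zero hB M hi' hi'']
        exact (map_zero _).symm

theorem strandEnd_pow (i : ℕ) (hi : i < N) (a : ℕ) (ha : a ∈ s) : S.strandEnd hB M i ^ a = 0 := by
  rw [strandEnd]
  split_ifs
  · rw [LinearMap.rTensor_pow, LinearMap.rTensor_pow, ← map_pow, S.x_pow _ ha, map_zero,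
      LinearMap.rTensor_zero, LinearMap.rTensor_zero]
  · rw [LinearMap.rTensor_pow, LinearMap.lTensor_pow, LinearMap.pow_mulLeft, dot_pow _ ha,
      LinearMap.mulLeft_zero_eq_zero, LinearMap.lTensor_zero, LinearMap.rTensor_zero]
  · rw [LinearMap.lTensor_pow, LinearMap.pow_mulLeft, dot_pow _ ha,
      LinearMap.mulLeft_zero_eq_zero, LinearMap.lTensor_zero]

/-- The representation of `R(N)` on functions `S_N → M ⊗ Q_b ⊗ Q_p`. -/
def valRep : R N →ₐ[K] Module.End K (blk 0 N → Vals K s b p M) :=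
  S.rep (S.strandEnd hB M) (S.strandEnd_comm hB M) (S.strandEnd_pow hB M)

/-- The product of a permutation of the first `n` and a permutation of the last `t` strands. -/
def embPair (hB : Blocks k c b p n t m ℓ N) (u : Equiv.Perm (Fin n)) (v : Equiv.Perm (Fin t)) :
    blk 0 N := ⟨emb 0 u * emb n v, mul_mem (emb_mem_zero (by have := hB.hn; omega) u)
      (emb_mem_zero hB.hn.le v)⟩

/-- The map `l ↦ l ⊗ 1 ⊗ 1`. -/
def valOne : M.carrier →ₗ[K] Vals K s b p M :=
  (TensorProduct.mk K _ (DotAlg K s p)).flip 1 ∘ₗ (TensorProduct.mk K M.carrier (DotAlg K s b)).flip 1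

/-- The function on `S_N` attached to `l ∈ M`: it is supported on `S_n × S_t`, with value
`τ_u⁻¹ l ⊗ 1 ⊗ 1` at `(u, v)`. -/
def unitFun : M.carrier →ₗ[K] (blk 0 N → Vals K s b p M) :=
  ∑ u : Equiv.Perm (Fin n), ∑ v : Equiv.Perm (Fin t),
    delta K (embPair hB u v) ∘ₗ valOne M ∘ₗ Algebra.lsmul K K M.carrier (S.ρ n (emb 0 u⁻¹))

theorem unitFun_apply (l : M.carrier) : S.unitFun hB M l
    = ∑ u : Equiv.Perm (Fin n), ∑ v : Equiv.Perm (Fin t),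
      delta K (embPair hB u v) (valOne M (S.ρ n (emb 0 u⁻¹) • l)) := by
  simp only [unitFun, LinearMap.sum_apply]
  rfl

theorem emb_zero_mem {n : ℕ} (u : Equiv.Perm (Fin n)) : emb 0 u ∈ blk 0 n :=
  emb_mem_zero (Nat.zero_add n).le u

theorem unitFun_smul (y : R n) (l : M.carrier) :
    S.unitFun hB M (y • l) = S.valRep hB M ((S.corner hB.hn).ι y) (S.unitFun hB M l) := by
  induction y using S.induction generalizing l with
  | algebraMap a =>
    rw [AlgHom.commutes, AlgHom.commutes, algebraMap_smul, map_smul]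
    rfl
  | add y z hy hz => rw [add_smul, map_add, map_add, map_add, hy, hz, LinearMap.add_apply]
  | mul y z hy hz => rw [mul_smul, hy, hz, map_mul, map_mul, Module.End.mul_apply]
  | x i =>
    have h1 := hB.hn
    rw [ι_x, unitFun_apply, unitFun_apply, map_sum]
    refine Finset.sum_congr rfl fun u _ => ?_
    rw [map_sum]
    refine Finset.sum_congr rfl fun v _ => ?_
    rw [valRep, rep_x_delta]
    congr 1
    have h2 : ((embPair hB u v : blk 0 N) : Equiv.Perm ℕ)⁻¹ (i : ℕ)
        = permFin (emb_zero_mem u⁻¹) i := by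
      show (emb 0 u * emb n v)⁻¹ (i : ℕ) = emb 0 u⁻¹ (i : ℕ)
      rw [mul_inv_rev, Equiv.Perm.mul_apply, ← map_inv, ← map_inv]
      exact emb_mem n v⁻¹ _ (.inl ((blk_lt_iff (.inr le_rfl) (emb_zero_mem u⁻¹) _).2 i.2))
    rw [Fin.val_castLE, h2]
    refine Eq.trans ?_ (S.strandEnd_left hB M (permFin (emb_zero_mem u⁻¹) i).2 _ _ _).symm
    have h3 : S.ρ n (emb 0 u⁻¹) • S.x i • l
        = S.x (permFin (emb_zero_mem u⁻¹) i) • S.ρ n (emb 0 u⁻¹) • l := by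
      rw [smul_smul, smul_smul, S.ρ_mul_x]
    exact congrArg (valOne M) h3
  | ρ w hw =>
    have h1 := hB.hn
    obtain ⟨g, rfl⟩ := exists_emb (m := 0) (ℓ := n) (by rwa [Nat.zero_add])
    rw [S.ι_ρ hB.hn hw, unitFun_apply, unitFun_apply, map_sum]
    refine (Fintype.sum_equiv (Equiv.mulLeft g) _ _ fun u => ?_).symm
    rw [map_sum]
    refine Finset.sum_congr rfl fun v _ => ?_
    rw [valRep, rep_ρ_delta _ _ _ _ (blk_mono le_rfl (by omega) hw), smul_smul,
      ← S.ρ_mul (emb_zero_mem _) hw, ← map_mul, Equiv.coe_mulLeft, mul_inv_rev,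
      inv_mul_cancel_right]
    refine congrArg (fun w => delta K w _) (Subtype.ext ?_)
    show emb 0 g * (emb 0 u * emb n v) = emb 0 (g * u) * emb n v
    rw [map_mul, mul_assoc]

variable [CharZero K]

theorem e_unitFun (l : M.carrier) :
    S.valRep hB M (S.corner hB.hn).e (S.unitFun hB M l) = S.unitFun hB M l := by
  have h1 := hB.hn
  have key : ∀ g : Equiv.Perm (Fin t), S.valRep hB M (S.ρ N (emb n g)) (S.unitFun hB M l)
      = S.unitFun hB M l := by
    intro g
    rw [unitFun_apply, map_sum]
    refine Finset.sum_congr rfl fun u _ => ?_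
    rw [map_sum]
    refine Fintype.sum_equiv (Equiv.mulLeft g) _ _ fun v => ?_
    rw [valRep, rep_ρ_delta _ _ _ _ (emb_mem_zero h1.le g)]
    refine congrArg (fun w => delta K w _) (Subtype.ext ?_)
    show emb n g * (emb 0 u * emb n v) = emb 0 u * emb n (g * v)
    rw [map_mul, ← mul_assoc, ← mul_assoc, blk_commute le_rfl (emb_zero_mem u) (emb_mem n g)]
  rw [e_eq, map_smul, map_sum, LinearMap.smul_apply, LinearMap.sum_apply]
  simp only [key]
  exact inv_factorial_smul_sum t _

theorem exists_indFun : ∃ θ : (S.corner hB.hn).IndCarrier M →ₗ[K] (blk 0 N → Vals K s b p M),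
    (∀ y x, θ (y • x) = S.valRep hB M y (θ x)) ∧
      ∀ l, θ ((S.corner hB.hn).indUnit M l) = S.unitFun hB M l :=
  (S.corner hB.hn).exists_indLift (S.valRep hB M) (S.unitFun hB M) (S.unitFun_smul hB M)
    (S.e_unitFun hB M)

/-- The homomorphism from `F_t M = R(N) e ⊗_{R(n)} M` to functions on `S_N` that sends `e ⊗ l` to
the function attached to `l`. -/
def indFun : (S.corner hB.hn).IndCarrier M →ₗ[K] (blk 0 N → Vals K s b p M) :=
  (S.exists_indFun hB M).choose

theorem indFun_smul (y : R N) (x) : S.indFun hB M (y • x) = S.valRep hB M y (S.indFun hB M x) :=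
  (S.exists_indFun hB M).choose_spec.1 y x

theorem indFun_indUnit (l : M.carrier) :
    S.indFun hB M ((S.corner hB.hn).indUnit M l) = S.unitFun hB M l :=
  (S.exists_indFun hB M).choose_spec.2 l

end KLRSystem

/-! ### Projections onto the summands -/

namespace KLRSystem

variable {K : Type u} [Field K] {r : ℕ} {s : Set ℕ} {R : ℕ → Type u}
  [∀ n, Ring (R n)] [∀ n, Algebra K (R n)] {𝒢 : ∀ n, ℤ → Submodule K (R n)}
  (S : KLRSystem r s 𝒢) {k c b p n t m ℓ N : ℕ}
  (hB : Blocks k c b p n t m ℓ N) (M : GrMod (𝒢 n))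

theorem valRep_ρ (g h : blk 0 N) (φ : blk 0 N → Vals K s b p M) :
    S.valRep hB M (S.ρ N g) φ h = φ (g⁻¹ * h) := by
  rw [valRep, rep_ρ]
  rfl

theorem valRep_x (i : Fin N) (h : blk 0 N) (φ : blk 0 N → Vals K s b p M) :
    S.valRep hB M (S.x i) φ h = S.strandEnd hB M ((h : Equiv.Perm ℕ)⁻¹ i) (φ h) := by
  rw [valRep, rep_x]
  rfl

theorem pol_le (hB : Blocks k c b p n t m ℓ N) : k + c + b + p ≤ N := by
  have := hB.n_eq
  have := hB.t_eq
  have := hB.hn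
  omega

theorem valRep_pol_delta_of_ne {h w : blk 0 N} {b' p' : ℕ} (hb : b' + p' ≤ N) (hw : h ≠ w) (f : DotAlg K s p')
    (y : Vals K s b p M) :
    S.valRep hB M (S.pol b' p' hb f) (delta K w y) h = 0 := by
  obtain ⟨y', hy'⟩ := S.rep_pol_delta (S.strandEnd hB M) (S.strandEnd_comm hB M)
    (S.strandEnd_pow hB M) hb w f y
  rw [valRep, hy', delta_ne hw]

/-- The carrier of `F_b E_c M`. -/
abbrev IndRes : Type u :=
  (S.corner hB.m_eq).IndCarrier ((S.corner hB.n_eq).res.obj M)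

/-- The map `M → F_b E_c M`, `l ↦ e ⊗ e l`. -/
def unitE : M.carrier →ₗ[K] S.IndRes hB M :=
  (S.corner hB.m_eq).indUnit ((S.corner hB.n_eq).res.obj M) ∘ₗ
    (Module.toModuleEnd K M.carrier (S.corner hB.n_eq).e).rangeRestrict

theorem unitE_ι_smul (y : R k) (l : M.carrier) : S.unitE hB M ((S.corner hB.n_eq).ι y • l)
    = (S.corner hB.m_eq).ι y • S.unitE hB M l := by
  refine Eq.trans ?_ ((S.corner hB.m_eq).ι_smul_indUnit _ _ _).symm
  refine congrArg ((S.corner hB.m_eq).indUnit ((S.corner hB.n_eq).res.obj M)) (Subtype.ext ?_)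
  show (S.corner hB.n_eq).e • (S.corner hB.n_eq).ι y • l
    = (S.corner hB.n_eq).ι y • (S.corner hB.n_eq).e • l
  rw [smul_smul, smul_smul, ((S.corner hB.n_eq).comm y).eq]

theorem unitE_ρ_smul {w : Equiv.Perm ℕ} (hw : w ∈ blk k n) (l : M.carrier) :
    S.unitE hB M (S.ρ n w • l) = S.unitE hB M l := by
  refine congrArg ((S.corner hB.m_eq).indUnit ((S.corner hB.n_eq).res.obj M)) (Subtype.ext ?_)
  show (S.corner hB.n_eq).e • S.ρ n w • l = (S.corner hB.n_eq).e • l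
  rw [smul_smul, S.e_mul_ρ hB.n_eq hw]

/-- The map `M ⊗ Q_b → F_b E_c M` in which the dots act on the last `b` strands. -/
def valBase : M.carrier ⊗[K] DotAlg K s b →ₗ[K] S.IndRes hB M :=
  TensorProduct.lift (LinearMap.mk₂ K (fun l f => S.pol k b hB.m_eq.le f • S.unitE hB M l)
    (fun l l' f => by rw [map_add, smul_add])
    (fun a l f => by rw [map_smul, smul_comm])
    (fun l f f' => by rw [map_add, add_smul])
    (fun a l f => by rw [map_smul, smul_assoc]))

/-- The map `M ⊗ Q_b ⊗ Q_p → F_b E_c M ⊗ Q_p`. -/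
def valMap : Vals K s b p M →ₗ[K] S.IndRes hB M ⊗[K] DotAlg K s p :=
  (S.valBase hB M).rTensor _

theorem valMap_tmul (l : M.carrier) (f : DotAlg K s b) (g : DotAlg K s p) :
    S.valMap hB M ((l ⊗ₜ f) ⊗ₜ g) = (S.pol k b hB.m_eq.le f • S.unitE hB M l) ⊗ₜ g := rfl

theorem valMap_strandEnd (i : Fin m) (y : Vals K s b p M) :
    S.valMap hB M (S.strandEnd hB M ((blockSwap k c b)⁻¹ i) y) = S.x i • S.valMap hB M y := by
  have h1 := hB.n_eq
  have h2 := hB.m_eq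
  have hi := i.2
  suffices H : S.valMap hB M ∘ₗ S.strandEnd hB M ((blockSwap k c b)⁻¹ i)
      = Module.toModuleEnd K _ (S.x i) ∘ₗ S.valMap hB M from LinearMap.congr_fun H y
  refine TensorProduct.ext_threefold fun l f g => ?_
  show S.valMap hB M (S.strandEnd hB M ((blockSwap k c b)⁻¹ i) ((l ⊗ₜ f) ⊗ₜ g))
    = S.x i • S.valMap hB M ((l ⊗ₜ f) ⊗ₜ g)
  rw [valMap_tmul, TensorProduct.smul_tmul', smul_smul, blockSwap_inv]
  rcases lt_or_ge (i : ℕ) k with hk | hk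
  · have h3 : blockSwap k b c i = i := by rw [blockSwap_apply, if_pos hk]
    have h4 : (⟨i, by omega⟩ : Fin n) = (⟨i, hk⟩ : Fin k).castLE (by omega) := rfl
    have h5 : (⟨i, hk⟩ : Fin k).castLE (Nat.le.intro h2) = i := rfl
    rw [h3, S.strandEnd_left hB M (by omega : (i : ℕ) < n), valMap_tmul, h4, ← S.ι_x hB.n_eq,
      unitE_ι_smul, smul_smul, S.ι_x, h5, x_mul_pol]
  · have h3 : blockSwap k b c i = i + c := by
      rw [blockSwap_apply, if_neg (by omega), if_pos (by omega)]
    rw [h3, S.strandEnd_mid hB M (by omega) (by omega), valMap_tmul, map_mul, pol_dot]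
    have h4 : (⟨k + ((i : ℕ) + c - n), by omega⟩ : Fin m) = i := Fin.ext (by simp; omega)
    simp only [h4]

theorem emb_mul_blockSwap_mem (hB : Blocks k c b p n t m ℓ N) (v : Equiv.Perm (Fin m)) :
    emb 0 v * blockSwap k c b ∈ blk 0 N :=
  mul_mem (emb_mem_zero (by have := hB.hm; omega) v) (blockSwap_mem_zero hB)

/-- The projection from functions on `S_N` to `F_b E_c M ⊗ Q_p`: the values of a function at the
elements `v w` with `v ∈ S_m`, where `w` is the block exchange, are transported by `τ_v` and
added up. -/
def funProj : (blk 0 N → Vals K s b p M) →ₗ[K] S.IndRes hB M ⊗[K] DotAlg K s p :=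
  ∑ v : Equiv.Perm (Fin m), Module.toModuleEnd K _ (S.ρ m (emb 0 v)) ∘ₗ S.valMap hB M ∘ₗ
    LinearMap.proj ⟨_, emb_mul_blockSwap_mem hB v⟩

theorem funProj_apply (φ : blk 0 N → Vals K s b p M) : S.funProj hB M φ
    = ∑ v : Equiv.Perm (Fin m),
      S.ρ m (emb 0 v) • S.valMap hB M (φ ⟨_, emb_mul_blockSwap_mem hB v⟩) := by
  simp only [funProj, LinearMap.sum_apply]
  rfl

/-- The sum over `S_m` makes the projection `R(m)`-linear. -/
theorem funProj_smul (y : R m) (φ : blk 0 N → Vals K s b p M) :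
    S.funProj hB M (S.valRep hB M ((S.corner hB.hm).ι y) φ) = y • S.funProj hB M φ := by
  have h0 := hB.hm
  induction y using S.induction generalizing φ with
  | algebraMap a =>
    rw [AlgHom.commutes, AlgHom.commutes, algebraMap_smul, ← map_smul]
    rfl
  | add y z hy hz => rw [map_add, map_add, LinearMap.add_apply, map_add, hy, hz, add_smul]
  | mul y z hy hz => rw [map_mul, map_mul, Module.End.mul_apply, hy, hz, mul_smul]
  | x i =>
    rw [S.ι_x, funProj_apply, funProj_apply, Finset.smul_sum]
    refine Finset.sum_congr rfl fun v _ => ?_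
    have h1 : (emb 0 v * blockSwap k c b)⁻¹ ((i.castLE (Nat.le.intro h0) : Fin N) : ℕ)
        = (blockSwap k c b)⁻¹ (permFin (emb_zero_mem v⁻¹) i : Fin m) := by
      rw [mul_inv_rev, Equiv.Perm.mul_apply, ← map_inv]
      rfl
    have h2 : permFin (emb_zero_mem v) (permFin (emb_zero_mem v⁻¹) i) = i := by
      refine Fin.ext ?_
      show emb 0 v (emb 0 v⁻¹ i) = i
      rw [map_inv, perm_apply_inv]
    rw [valRep_x, h1, valMap_strandEnd, smul_smul, S.ρ_mul_x (emb_zero_mem v), h2, smul_smul]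
  | ρ w hw =>
    obtain ⟨g, rfl⟩ := exists_emb (m := 0) (ℓ := m) (by rwa [Nat.zero_add])
    have hg : emb 0 g ∈ blk 0 N := blk_mono le_rfl (by omega) hw
    rw [S.ι_ρ _ hw, funProj_apply, funProj_apply, Finset.smul_sum]
    refine (Fintype.sum_equiv (Equiv.mulLeft g) _ _ fun v => ?_).symm
    rw [S.valRep_ρ hB M ⟨_, hg⟩, smul_smul, ← S.ρ_mul hw (emb_zero_mem v), ← map_mul]
    congr 3
    refine Subtype.ext ?_
    show _ = (emb 0 g)⁻¹ * (emb 0 (g * v) * blockSwap k c b)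
    rw [map_mul]
    group

variable [CharZero K]

theorem unitE_coe (l : (S.corner hB.n_eq).eSub M) : S.unitE hB M l
    = (S.corner hB.m_eq).indUnit ((S.corner hB.n_eq).res.obj M) l := by
  obtain ⟨_, l, rfl⟩ := l
  refine congrArg ((S.corner hB.m_eq).indUnit ((S.corner hB.n_eq).res.obj M)) (Subtype.ext ?_)
  show (S.corner hB.n_eq).e • (S.corner hB.n_eq).e • l = (S.corner hB.n_eq).e • l
  rw [smul_smul, S.e_mul_e]

theorem ρ_smul_unitE {w : Equiv.Perm ℕ} (hw : w ∈ blk k m) (l : M.carrier) :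
    S.ρ m w • S.unitE hB M l = S.unitE hB M l :=
  S.ρ_smul_indUnit hB.m_eq _ hw _

/-- The projection of `F_t M` onto `F_b E_c M ⊗ Q_p`.  Up to a nonzero scalar, its restriction to
the summand `F_b E_c M ⊗ Z_p` is the inclusion, and it vanishes on the other summands. -/
def summandProj :
    (S.corner hB.hn).IndCarrier M →ₗ[K] S.IndRes hB M ⊗[K] DotAlg K s p :=
  S.funProj hB M ∘ₗ S.indFun hB M

theorem summandProj_ι_smul (y : R m) (x : (S.corner hB.hn).IndCarrier M) :
    S.summandProj hB M ((S.corner hB.hm).ι y • x) = y • S.summandProj hB M x := by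
  rw [summandProj, LinearMap.comp_apply, indFun_smul, funProj_smul]
  rfl

section Evaluation

variable {k' c' b' p' : ℕ} (hB' : Blocks k' c' b' p' n t m ℓ N)

/-- The point of `S_N` at which the summand of `e τ_{w'}` indexed by `u` evaluates a function, in
order to compute the value at `v w`. -/
def evalPt (u : Equiv.Perm (Fin ℓ)) (v : Equiv.Perm (Fin m)) : blk 0 N :=
  ⟨(blockSwap k' c' b')⁻¹ * (emb m u)⁻¹ * (emb 0 v * blockSwap k c b),
    mul_mem (mul_mem (inv_mem (blockSwap_mem_zero hB'))
      (inv_mem (emb_mem_zero hB.hm.le u))) (emb_mul_blockSwap_mem hB v)⟩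

/-- The value of the projection on the image of a generator of a possibly different summand. -/
theorem summandProj_e_smul_twine (f : DotAlg K s p') (l : M.carrier) :
    S.summandProj hB M ((S.corner hB.hm).e • S.twine hB' f • (S.corner hB.hn).indUnit M l)
      = (ℓ.factorial : K)⁻¹ • ∑ v : Equiv.Perm (Fin m), ∑ u : Equiv.Perm (Fin ℓ),
        ∑ α : Equiv.Perm (Fin n), ∑ β : Equiv.Perm (Fin t),
          S.ρ m (emb 0 v) • S.valMap hB M (S.valRep hB M (S.pol _ p' (pol_le hB') f)
            (delta K (embPair hB α β) (valOne M (S.ρ n (emb 0 α⁻¹) • l))) (evalPt hB hB' u v)) := by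
  rw [summandProj, LinearMap.comp_apply, indFun_smul, indFun_smul, indFun_indUnit, twine_apply,
    map_mul, Module.End.mul_apply]
  have h1 : S.valRep hB M (S.pol _ p' (pol_le hB') f) (S.unitFun hB M l)
      = ∑ α : Equiv.Perm (Fin n), ∑ β : Equiv.Perm (Fin t),
        S.valRep hB M (S.pol _ p' (pol_le hB') f)
          (delta K (embPair hB α β) (valOne M (S.ρ n (emb 0 α⁻¹) • l))) := by
    rw [unitFun_apply, map_sum]
    exact Finset.sum_congr rfl fun α _ => map_sum _ _ _
  rw [h1, e_eq, map_smul, map_sum, LinearMap.smul_apply, LinearMap.sum_apply, map_smul, map_sum]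
  congr 1
  simp only [funProj_apply]
  rw [Finset.sum_comm]
  refine Finset.sum_congr rfl fun v _ => Finset.sum_congr rfl fun u _ => ?_
  rw [S.valRep_ρ hB M ⟨_, emb_mem_zero hB.hm.le u⟩, S.valRep_ρ hB M ⟨_, blockSwap_mem_zero hB'⟩]
  have h2 : (⟨_, blockSwap_mem_zero hB'⟩ : blk 0 N)⁻¹ * ((⟨_, emb_mem_zero hB.hm.le u⟩ : blk 0 N)⁻¹
      * ⟨_, emb_mul_blockSwap_mem hB v⟩) = evalPt hB hB' u v :=
    Subtype.ext (mul_assoc _ _ _).symm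
  rw [h2, Finset.sum_apply, map_sum, Finset.smul_sum]
  refine Finset.sum_congr rfl fun α _ => ?_
  rw [Finset.sum_apply, map_sum, Finset.smul_sum]

theorem evalPt_eq {u : Equiv.Perm (Fin ℓ)} {v : Equiv.Perm (Fin m)} {α : Equiv.Perm (Fin n)}
    {β : Equiv.Perm (Fin t)} (h : evalPt hB hB' u v = embPair hB α β) :
    (emb m u)⁻¹ * emb 0 v * blockSwap k c b = blockSwap k' c' b' * (emb 0 α * emb n β) := by
  have h' : (blockSwap k' c' b')⁻¹ * (emb m u)⁻¹ * (emb 0 v * blockSwap k c b)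
    = emb 0 α * emb n β := congrArg Subtype.val h
  rw [← h']
  group

/-- All terms vanish for two different summands, since the double cosets are disjoint. -/
theorem summandProj_of_ne (hp : p ≠ p') (f : DotAlg K s p') (l : M.carrier) :
    S.summandProj hB M ((S.corner hB.hm).e • S.twine hB' f • (S.corner hB.hn).indUnit M l) = 0 := by
  rw [summandProj_e_smul_twine]
  refine (congrArg _ ?_).trans (smul_zero _)
  refine Finset.sum_eq_zero fun v _ => Finset.sum_eq_zero fun u _ => Finset.sum_eq_zero fun α _ =>
    Finset.sum_eq_zero fun β _ => ?_
  rw [S.valRep_pol_delta_of_ne hB M (pol_le hB'), map_zero, smul_zero]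
  intro h
  have h1 := hB.n_eq
  have h2 := hB.m_eq
  have h3 := hB.t_eq
  have h4 := hB.hn
  have h5 := hB'.n_eq
  have h6 := hB'.m_eq
  have h7 := hB'.t_eq
  exact hp (double_coset_stabilizer h1.symm h2.symm (by omega) h5.symm h6.symm (by omega)
    (emb_mem_of_eq hB.hm u) (emb_zero_mem v) (emb_zero_mem α) (emb_mem_of_eq hB.hn β)
    (evalPt_eq hB hB' h)).1

/-- The action of the dots on the last factor of `M ⊗ Q_b ⊗ Q_p`. -/
def dotRight : DotAlg K s p →ₐ[K] Module.End K (Vals K s b p M) :=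
  (Module.End.lTensorAlgHom K (DotAlg K s p) (M.carrier ⊗[K] DotAlg K s b)).comp
    (Algebra.lmul K (DotAlg K s p))

/-- For equal summands, all nonzero terms have the same value: the permutations that occur are
absorbed by the symmetrizers on both sides and by the symmetry of `z`. -/
theorem summandProj_term {Z : GrSpace K} (D : SymDots r s p Z) (z : Z.carrier)
    (l : M.carrier) {u : Equiv.Perm (Fin ℓ)} {v : Equiv.Perm (Fin m)}
    {α : Equiv.Perm (Fin n)} {β : Equiv.Perm (Fin t)} (h : evalPt hB hB u v = embPair hB α β) :
    S.ρ m (emb 0 v) • S.valMap hB M (S.valRep hB M (S.pol _ p (pol_le hB) (D.toDot z))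
      (delta K (embPair hB α β) (valOne M (S.ρ n (emb 0 α⁻¹) • l))) (evalPt hB hB u v))
        = S.unitE hB M l ⊗ₜ D.toDot z := by
  have h1 := hB.n_eq
  have h2 := hB.m_eq
  have h3 := hB.t_eq
  have h4 := hB.hn
  have h5 := hB.hm
  obtain ⟨-, g, hg, v', hv', α', hα', hv, hα, hαβ⟩ :=
    double_coset_stabilizer (p := p) (p' := p) h1.symm h2.symm (by omega) h1.symm h2.symm
      (by omega) (emb_mem_of_eq hB.hm u) (emb_zero_mem v) (emb_zero_mem α) (emb_mem_of_eq hB.hn β)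
      (evalPt_eq hB hB h)
  -- the permutation of the last `p` strands, which disappears since `z` is symmetric
  obtain ⟨w₁, hw₁, w₂, hw₂, hw⟩ := blk_split (embPair hB α β).2 hαβ
  obtain ⟨σ, hσ⟩ := exists_emb (m := k + c + b) (ℓ := p) (w := w₂⁻¹)
    (inv_mem (blk_mono (by omega) (by omega) hw₂))
  have hσ' : ∀ i : Fin p, ((embPair hB α β : blk 0 N) : Equiv.Perm ℕ)⁻¹ (k + c + b + i)
      = k + c + b + σ i := by
    intro i
    have e1 : (embPair hB α β : Equiv.Perm ℕ) = w₁ * w₂ := hw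
    have e2 : w₁⁻¹ (k + c + b + i) = k + c + b + i := inv_mem hw₁ _ (.inr (by omega))
    rw [e1, mul_inv_rev, Equiv.Perm.mul_apply, e2, ← hσ, emb_apply]
  have hA : ∀ i : Fin p, dotRight M (dot K s i) = S.strandEnd hB M (k + c + b + i) := by
    intro i
    rw [S.strandEnd_right_eq hB M (by omega) (by have := i.2; omega)]
    have : (⟨k + c + b + i - (n + b), by omega⟩ : Fin p) = i := Fin.ext (by simp; omega)
    rw [this]
    rfl
  rw [h, valRep, S.rep_pol_delta_eq _ _ _ (pol_le hB) _ σ hσ' (dotRight M) hA, delta_self, D.perm]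
  have e3 : dotRight M (D.toDot z) (valOne M (S.ρ n (emb 0 α⁻¹) • l))
      = ((S.ρ n (emb 0 α⁻¹) • l) ⊗ₜ (1 : DotAlg K s b)) ⊗ₜ (D.toDot z * 1) := rfl
  rw [e3, valMap_tmul, map_one, one_smul, mul_one, TensorProduct.smul_tmul']
  congr 1
  have hg' : g⁻¹ ∈ blk 0 k := inv_mem hg
  have hgn : g⁻¹ ∈ blk 0 n := blk_mono le_rfl (by omega) hg'
  have hgm : g ∈ blk 0 m := blk_mono le_rfl (by omega) hg
  have hα0 : α'⁻¹ ∈ blk 0 n := blk_mono (Nat.zero_le _) le_rfl (inv_mem hα')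
  rw [map_inv, hα, mul_inv_rev, S.ρ_mul hα0 hgn, mul_smul, unitE_ρ_smul S hB M (inv_mem hα'),
    ← S.ι_ρ hB.n_eq hg', unitE_ι_smul, S.ι_ρ _ hg', hv, smul_smul,
    blk_commute le_rfl hg hv', ← S.ρ_mul (mul_mem (blk_mono (Nat.zero_le _) le_rfl hv') hgm)
      (inv_mem hgm), mul_inv_cancel_right, ρ_smul_unitE S hB M hv']

variable [∀ n, GradedAlgebra (𝒢 n)] {Z : GrSpace K} (D : SymDots r s p Z)

/-- The scalar is the number of nonzero terms divided by `ℓ!`, so it does not vanish in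
characteristic zero. -/
theorem exists_summandProj_pre : ∃ κ : K, κ ≠ 0 ∧ ∀ (l : (S.corner hB.n_eq).eSub M) z,
    S.summandProj hB M ((S.square hB D).pre M l z).1
      = κ • ((S.corner hB.m_eq).indUnit ((S.corner hB.n_eq).res.obj M) l ⊗ₜ D.toDot z) := by
  classical
  let count : Equiv.Perm (Fin m) → Equiv.Perm (Fin ℓ) → Equiv.Perm (Fin n) → Equiv.Perm (Fin t) → ℕ :=
    fun v u α β => if evalPt hB hB u v = embPair hB α β then 1 else 0
  refine ⟨(ℓ.factorial : K)⁻¹ * ((∑ v, ∑ u, ∑ α, ∑ β, count v u α β : ℕ) : K),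
    mul_ne_zero (inv_ne_zero (by exact_mod_cast ℓ.factorial_ne_zero)) ?_, fun l z => ?_⟩
  · -- the identity permutations contribute to the count
    have h1 : count 1 1 1 1 = 1 := if_pos (Subtype.ext (by
      show (blockSwap k c b)⁻¹ * (emb m 1)⁻¹ * (emb 0 1 * blockSwap k c b) = emb 0 1 * emb n 1
      simp only [map_one]
      group))
    have h2 : 1 ≤ ∑ v, ∑ u, ∑ α, ∑ β, count v u α β :=
      calc 1 = count 1 1 1 1 := h1.symm
        _ ≤ ∑ β, count 1 1 1 β := Finset.single_le_sum (fun _ _ => Nat.zero_le _) (Finset.mem_univ 1)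
        _ ≤ ∑ α, ∑ β, count 1 1 α β := Finset.single_le_sum
          (f := fun α => ∑ β, count 1 1 α β) (fun _ _ => Nat.zero_le _) (Finset.mem_univ 1)
        _ ≤ ∑ u, ∑ α, ∑ β, count 1 u α β := Finset.single_le_sum
          (f := fun u => ∑ α, ∑ β, count 1 u α β) (fun _ _ => Nat.zero_le _) (Finset.mem_univ 1)
        _ ≤ _ := Finset.single_le_sum
          (f := fun v => ∑ u, ∑ α, ∑ β, count v u α β) (fun _ _ => Nat.zero_le _) (Finset.mem_univ 1)
    exact Nat.cast_ne_zero.2 (Nat.one_le_iff_ne_zero.1 h2)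
  · rw [← unitE_coe, Square.coe_pre]
    refine (S.summandProj_e_smul_twine hB M hB (D.toDot z) l).trans ?_
    rw [mul_smul, Nat.cast_smul_eq_nsmul]
    simp only [Finset.sum_smul]
    refine congrArg (fun y => (ℓ.factorial : K)⁻¹ • y) ?_
    refine Finset.sum_congr rfl fun v _ => Finset.sum_congr rfl fun u _ => Finset.sum_congr rfl
      fun α _ => Finset.sum_congr rfl fun β _ => ?_
    by_cases h : evalPt hB hB u v = embPair hB α β
    · rw [S.summandProj_term hB M D z l h]
      exact ((congrArg (· • _) (if_pos h)).trans (one_smul ℕ _)).symm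
    · rw [S.valRep_pol_delta_of_ne hB M (pol_le hB) h, map_zero, smul_zero]
      exact ((congrArg (· • _) (if_neg h)).trans (zero_smul ℕ _)).symm

theorem exists_summandProj_toLin : ∃ κ : K, κ ≠ 0 ∧ ∀ x,
    S.summandProj hB M ((S.square hB D).toLin M x).1 = κ • D.toDot.lTensor (S.IndRes hB M) x := by
  obtain ⟨κ, hκ, h⟩ := S.exists_summandProj_pre hB M D
  refine ⟨κ, hκ, fun x => ?_⟩
  induction x using TensorProduct.induction_on with
  | zero =>
    rw [map_zero, map_zero, smul_zero]
    exact map_zero _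
  | add x y hx hy =>
    rw [map_add, map_add, smul_add, ← hx, ← hy]
    exact map_add _ _ _
  | tmul y z =>
    induction y using Corner.ind_induction with
    | add x y hx hy =>
      rw [TensorProduct.add_tmul, map_add, map_add, smul_add, ← hx, ← hy]
      exact map_add _ _ _
    | smul y l =>
      refine (congrArg (fun q => S.summandProj hB M q.1)
        ((S.square hB D).toLin_smul_indUnit M y l z)).trans ?_
      refine (S.summandProj_ι_smul hB M y _).trans ?_
      refine (congrArg (y • ·) (h l z)).trans ?_
      rw [smul_comm, TensorProduct.smul_tmul']
      rfl

theorem summandProj_toLin_of_ne {Z' : GrSpace K} (D' : SymDots r s p' Z') (hp : p ≠ p') (x) :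
    S.summandProj hB M ((S.square hB' D').toLin M x).1 = 0 := by
  induction x using TensorProduct.induction_on with
  | zero =>
    rw [map_zero]
    exact map_zero _
  | add x y hx hy =>
    rw [map_add]
    exact (map_add _ _ _).trans ((congrArg₂ _ hx hy).trans (add_zero _))
  | tmul y z =>
    induction y using Corner.ind_induction with
    | add x y hx hy =>
      rw [TensorProduct.add_tmul, map_add]
      exact (map_add _ _ _).trans ((congrArg₂ _ hx hy).trans (add_zero _))
    | smul y l =>
      refine (congrArg (fun q => S.summandProj hB M q.1)
        ((S.square hB' D').toLin_smul_indUnit M y l z)).trans ?_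
      refine (S.summandProj_ι_smul hB M y _).trans ?_
      exact (congrArg (y • ·) (S.summandProj_of_ne hB M hB' hp _ _)).trans (smul_zero y)

end Evaluation

end KLRSystem

/-! ### The Mackey decomposition -/

namespace KLRSystem

variable {K : Type u} [Field K] [CharZero K] {r : ℕ} {s : Set ℕ} {R : ℕ → Type u}
  [∀ n, Ring (R n)] [∀ n, Algebra K (R n)] {𝒢 : ∀ n, ℤ → Submodule K (R n)}
  [∀ n, GradedAlgebra (𝒢 n)] (S : KLRSystem r s 𝒢)

/-- The double cosets exhaust `e R(N) e ⊗_{R(n)} M`. -/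
theorem eSub_le_of_forall_blocks {n t m ℓ N : ℕ} (hn : n + t = N) (hm : m + ℓ = N)
    (M : GrMod (𝒢 n)) (W : Submodule K ((S.corner hn).IndCarrier M))
    (hW : ∀ k c b p (hB : Blocks k c b p n t m ℓ N) (y : R m) (q : List (Fin N)) (l : M.carrier),
      ((S.corner hm).ι y * ((S.corner hm).e * S.twine hB 1) * (q.map S.x).prod) •
        (S.corner hn).indUnit M l ∈ W) :
    (S.corner hm).eSub ((S.corner hn).indObj M) ≤ W := by
  rintro _ ⟨x, rfl⟩
  show (S.corner hm).e • x ∈ W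
  induction x using Corner.ind_induction with
  | add x y hx hy =>
    exact Eq.subst (motive := (· ∈ W)) (smul_add (S.corner hm).e x y).symm (W.add_mem hx hy)
  | smul g l =>
    obtain ⟨g, rfl⟩ := S.surj N g
    let F : KLR K N →ₗ[K] (S.corner hn).IndCarrier M :=
      Module.toModuleEnd K _ (S.corner hm).e ∘ₗ
        (LinearMap.toSpanSingleton (R N) _ ((S.corner hn).indUnit M l)).restrictScalars K ∘ₗ
          (S.pr N).toLinearMap
    suffices H : Submodule.span K {z | ∃ w ∈ blk 0 N, ∃ q : List (Fin N),
        rho K N w * (q.map fun i => gen K N (.x i)).prod = z} ≤ W.comap F from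
      H (mem_span_rho_mul_x g)
    refine Submodule.span_le.2 ?_
    rintro _ ⟨w, hw, q, rfl⟩
    show (S.corner hm).e • S.pr N (rho K N w * (q.map fun i => gen K N (.x i)).prod) •
      (S.corner hn).indUnit M l ∈ W
    have hq : S.pr N (rho K N w * (q.map fun i => gen K N (.x i)).prod)
        = S.ρ N w * (q.map S.x).prod := by
      rw [map_mul, map_list_prod, List.map_map]
      rfl
    rw [hq]
    obtain ⟨k, c, b, p, h1, h2, h3, h4, u, hu, v, hv, α, hα, β, hβ, rfl⟩ :=
      exists_double_coset hm hn hw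
    have hB : Blocks k c b p n t m ℓ N := ⟨h1.symm, h2.symm, h3.symm, h4.symm, hn, hm⟩
    have hu' : u ∈ blk 0 N := blk_mono (Nat.zero_le _) le_rfl hu
    have hv' : v ∈ blk 0 N := blk_mono le_rfl (by omega) hv
    have hα' : α ∈ blk 0 N := blk_mono le_rfl (by omega) hα
    have hβ' : β ∈ blk 0 N := blk_mono (Nat.zero_le _) le_rfl hβ
    have hαβ := mul_mem hα' hβ'
    have hw := blockSwap_mem_zero hB
    have hl : (S.corner hn).indUnit M (S.ρ n α • l)
        = S.ρ N (α * β) • (S.corner hn).indUnit M l := by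
      rw [S.ρ_mul hα' hβ', mul_smul, ρ_smul_indUnit S hn M hβ, ρ_smul_indUnit' S hn M hα]
    have hW' := hW k c b p hB (S.ρ m v) (q.map (permFin hαβ)) (S.ρ n α • l)
    rw [hl, smul_smul, twine_apply, map_one, mul_one, S.ι_ρ hm hv, mul_assoc, ← ρ_mul_prod] at hW'
    rw [smul_smul]
    convert hW' using 2
    have hev : (S.corner hm).e * S.ρ N v = S.ρ N v * (S.corner hm).e := by
      rw [← S.ι_ρ hm hv, ((S.corner hm).comm _).eq]
    rw [S.ρ_mul (mul_mem (mul_mem hu' hv') hw) hαβ, S.ρ_mul (mul_mem hu' hv') hw, S.ρ_mul hu' hv']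
    simp only [← mul_assoc]
    rw [S.e_mul_ρ hm hu, hev]

theorem blocks_of_index {n t m ℓ : ℕ} (h : m + ℓ = n + t) (p : SummandIndex ℓ t n) :
    Blocks (n - (ℓ - p.1)) (ℓ - p.1) (t - p.1) p.1 n t m ℓ (n + t) := by
  have h1 := p.2
  have h2 := p.1.2
  exact ⟨p.left, p.right h, by omega, by omega, rfl, h⟩

section Sum

variable {n t m ℓ : ℕ} (h : m + ℓ = n + t) {Z : ℕ → GrSpace K} (D : ∀ p, SymDots r s p (Z p))
  (M : GrMod (𝒢 n))

/-- The map from the direct sum of the spaces `F_{t-p} E_{ℓ-p} M ⊗ Z_p` to `E_ℓ F_t M`. -/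
def sumToLin : (∀ p : SummandIndex ℓ t n, S.IndRes (blocks_of_index h p) M ⊗[K] (Z p.1).carrier)
    →ₗ[K] (S.corner h).eSub ((S.corner (rfl : n + t = n + t)).indObj M) :=
  ∑ p, ((S.square (blocks_of_index h p) (D p.1)).toLin M).restrictScalars K ∘ₗ LinearMap.proj p

theorem sumToLin_apply (x) : S.sumToLin h D M x
    = ∑ p, (S.square (blocks_of_index h p) (D p.1)).toLin M (x p) := LinearMap.sum_apply _ _ _

theorem summandProj_sumToLin (p : SummandIndex ℓ t n) : ∃ κ : K, κ ≠ 0 ∧ ∀ x,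
    S.summandProj (blocks_of_index h p) M (S.sumToLin h D M x).1
      = κ • (D p.1).toDot.lTensor (S.IndRes (blocks_of_index h p) M) (x p) := by
  obtain ⟨κ, hκ, hp⟩ := S.exists_summandProj_toLin (blocks_of_index h p) M (D p.1)
  refine ⟨κ, hκ, fun x => ?_⟩
  let G : (S.corner h).eSub ((S.corner (rfl : n + t = n + t)).indObj M) →ₗ[K]
      S.IndRes (blocks_of_index h p) M ⊗[K] DotAlg K s p.1 :=
    S.summandProj (blocks_of_index h p) M ∘ₗ Submodule.subtype _
  show G (S.sumToLin h D M x) = _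
  rw [sumToLin_apply, map_sum, Finset.sum_eq_single p, ← hp]
  · rfl
  · intro q _ hq
    refine S.summandProj_toLin_of_ne _ M _ (D q.1) (fun hpq => hq ?_) (x q)
    exact Subtype.ext (Fin.ext hpq.symm)
  · exact fun hp => absurd (Finset.mem_univ _) hp

theorem sumToLin_injective : Function.Injective (S.sumToLin h D M) := by
  intro x x' hx
  funext p
  obtain ⟨κ, hκ, hp⟩ := S.summandProj_sumToLin h D M p
  have h1 := (hp x).symm.trans ((congrArg (fun y => S.summandProj (blocks_of_index h p) M y.1)
    hx).trans (hp x'))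
  exact Module.Flat.lTensor_preserves_injective_linearMap _ (D p.1).injective
    (smul_right_injective _ hκ h1)

theorem toLin_mem_range_sumToLin (p : SummandIndex ℓ t n) (x) :
    ((S.square (blocks_of_index h p) (D p.1)).toLin M x).1 ∈ LinearMap.range
      (((S.corner h).eSub ((S.corner (rfl : n + t = n + t)).indObj M)).subtype ∘ₗ
        S.sumToLin h D M) := by
  refine ⟨Pi.single p x, congrArg Subtype.val ?_⟩
  rw [sumToLin_apply, Finset.sum_eq_single p, Pi.single_eq_same]
  · intro q _ hq
    rw [Pi.single_eq_of_ne hq, map_zero]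
  · exact fun hp => absurd (Finset.mem_univ _) hp

theorem sumToLin_surjective : Function.Surjective (S.sumToLin h D M) := by
  have key := S.eSub_le_of_forall_blocks rfl h M (LinearMap.range
      (((S.corner h).eSub ((S.corner (rfl : n + t = n + t)).indObj M)).subtype ∘ₗ
        S.sumToLin h D M)) (by
    intro k c b p hB z q l
    have e1 := hB.n_eq
    have e2 := hB.m_eq
    have e3 := hB.t_eq
    have e4 := hB.ℓ_eq
    obtain rfl : k = n - (ℓ - p) := by omega
    obtain rfl : c = ℓ - p := by omega
    obtain rfl : b = t - p := by omega
    let p' : SummandIndex ℓ t n := ⟨⟨p, by omega⟩, by show ℓ - p ≤ n; omega⟩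
    obtain ⟨x, hx⟩ := S.e_smul_twine_mem_range (blocks_of_index h p') (D p) M q z 1 l
    exact Eq.subst (motive := fun y => y ∈ LinearMap.range
      (((S.corner h).eSub ((S.corner (rfl : n + t = n + t)).indObj M)).subtype ∘ₗ
        S.sumToLin h D M)) hx (S.toLin_mem_range_sumToLin h D M p' x))
  intro y
  obtain ⟨x, hx⟩ := key y.2
  exact ⟨x, Subtype.ext hx⟩

end Sum

theorem nonempty_mackey_iso {n t m ℓ : ℕ} (h : m + ℓ = n + t) {Z : ℕ → GrSpace K}
    (D : ∀ p, SymDots r s p (Z p)) :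
    Nonempty ((S.corner (rfl : n + t = n + t)).ind ⋙ (S.corner h).res ≅
      dsumFunctor fun p : SummandIndex ℓ t n =>
        (S.corner p.left).res ⋙ (S.corner (p.right h)).ind ⋙ tensorFunctor (𝒢 m) (Z p.1)) :=
  nonempty_iso_dsumFunctor _ _
    (fun p => (S.square (blocks_of_index h p) (D p.1)).natTrans) fun M =>
      (funext (S.sumToLin_apply h D M) : (S.sumToLin h D M : _ → _) = _) ▸
        ⟨S.sumToLin_injective h D M, S.sumToLin_surjective h D M⟩

end KLRSystem

/-! ### The algebras `R(n)` and their cyclotomic quotients -/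

section Instances

variable {K : Type u} [Field K]

variable (K) in
/-- The algebras `R(n)` themselves. -/
def klrSystem (r : ℕ) : KLRSystem r ∅ (klrGrade K r) where
  pr n := AlgHom.id K (KLR K n)
  surj _ := Function.surjective_id
  nil _ _ _ ha := absurd ha (Set.notMem_empty _)
  lift _ _ _ _ f _ := ⟨f, fun _ => rfl⟩
  pr_mem _ _ _ h := h
  corner h := corner K r h
  corner_ι _ _ := rfl
  corner_e _ := rfl

variable (K) in
/-- The cyclotomic quotients. -/
def cycSystem (r a : ℕ) : KLRSystem r {a} (fun n => cycGrade K r n a) where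
  pr n := cycMk K n a
  surj n := cycMk_surjective n a
  nil n h b hb := by
    obtain rfl : b = a := hb
    exact x_pow_eq_zero b h
  lift n B _ _ f hf := ⟨cycLift f fun h => hf a rfl h, cycLift_mk f _⟩
  pr_mem n d y hy := wordGrade_map (cycMk K n a) id (fun _ => rfl) (fun _ => rfl) d y hy
  corner h := cycCorner K r a h
  corner_ι h y := by
    show cycIncl a _ (cycMk K _ a y) = _
    rw [cycIncl, cycLift_mk]
    rfl
  corner_e _ := rfl

theorem permDot_mk {s : Set ℕ} {p : ℕ} (σ : Equiv.Perm (Fin p)) (f : MvPolynomial (Fin p) K) :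
    permDot σ (Ideal.Quotient.mk (dotIdeal K s p) f)
      = Ideal.Quotient.mk (dotIdeal K s p) (MvPolynomial.rename σ f) := by
  suffices H : (permDot σ).comp (Ideal.Quotient.mkₐ K (dotIdeal K s p))
      = (Ideal.Quotient.mkₐ K (dotIdeal K s p)).comp (MvPolynomial.rename σ) from
    DFunLike.congr_fun H f
  refine MvPolynomial.algHom_ext fun i => ?_
  rw [AlgHom.comp_apply, AlgHom.comp_apply, MvPolynomial.rename_X]
  exact permDot_dot σ i

theorem mk_dotIdeal_empty_injective (p : ℕ) :
    Function.Injective (Ideal.Quotient.mk (dotIdeal K ∅ p)) := by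
  rw [RingHom.injective_iff_ker_eq_bot, Ideal.mk_ker, dotIdeal, Ideal.span_eq_bot]
  rintro _ ⟨_, _, ha, _⟩
  exact absurd ha (Set.notMem_empty _)

variable (K) in
/-- Symmetric polynomials are the invariants in the polynomial algebra. -/
def symDots (r p : ℕ) : SymDots r ∅ p (symSpace K r p) where
  toDot := (Ideal.Quotient.mkₐ K (dotIdeal K ∅ p)).toLinearMap ∘ₗ
    (MvPolynomial.symmetricSubalgebra (Fin p) K).val.toLinearMap
  injective := (mk_dotIdeal_empty_injective p).comp Subtype.val_injective
  perm σ z := (permDot_mk σ _).trans (congrArg _ (z.2 σ))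
  exists_eq f hf := by
    obtain ⟨f, rfl⟩ := Ideal.Quotient.mk_surjective f
    exact ⟨⟨f, fun σ => mk_dotIdeal_empty_injective p ((permDot_mk σ f).symm.trans (hf σ))⟩, rfl⟩
  exists_lift d z hz := ⟨_, hz, rfl⟩

theorem powIdeal_eq_dotIdeal (p a : ℕ) : powIdeal K p a = dotIdeal K {a} p := by
  refine congrArg Ideal.span (Set.ext fun f => ⟨?_, ?_⟩)
  · rintro ⟨i, rfl⟩
    exact ⟨i, a, rfl, rfl⟩
  · rintro ⟨i, _, rfl, rfl⟩
    exact ⟨i, rfl⟩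

/-- The two descriptions of the truncated polynomial algebra. -/
def truncEquiv (p a : ℕ) : TruncPoly K p a ≃ₐ[K] DotAlg K {a} p :=
  Ideal.quotientEquivAlgOfEq K (powIdeal_eq_dotIdeal p a)

theorem permDot_truncEquiv {p a : ℕ} (σ : Equiv.Perm (Fin p)) (y : TruncPoly K p a) :
    permDot σ (truncEquiv p a y) = truncEquiv p a (permTrunc K p a σ y) := by
  obtain ⟨f, rfl⟩ := Ideal.Quotient.mk_surjective y
  exact permDot_mk σ f

variable (K) in
/-- The space `Z_p^Λ` consists of the invariants in the truncated polynomial algebra. -/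
def truncDots (r p a : ℕ) : SymDots r {a} p (truncSpace K r p a) where
  toDot := (truncEquiv p a).toLinearMap ∘ₗ (truncInv K p a).val.toLinearMap
  injective := (truncEquiv p a).injective.comp Subtype.val_injective
  perm σ z := (permDot_truncEquiv σ _).trans (congrArg _ ((mem_truncInv K).1 z.2 σ))
  exists_eq f hf := by
    obtain ⟨y, rfl⟩ := (truncEquiv p a).surjective f
    exact ⟨⟨y, (mem_truncInv K).2 fun σ =>
      (truncEquiv p a).injective ((permDot_truncEquiv σ y).symm.trans (hf σ))⟩, rfl⟩
  exists_lift d z hz := by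
    obtain ⟨f, hf, hfz⟩ := hz
    exact ⟨f, hf, congrArg (truncEquiv p a) hfz⟩

end Instances

end

end JordanKLR

theorem mainTheorem8 (K : Type u) [Field K] [IsAlgClosed K] [CharZero K] (r : ℕ) (hr : 0 < r)
    (ℓ t : ℕ) (hℓ : 1 ≤ ℓ) (ht : 1 ≤ t) (n m : ℕ) (h : m + ℓ = n + t) :
    Nonempty
      (functorF K r (rfl : n + t = n + t) ⋙ functorE K r h ≅
        dsumFunctor fun p : SummandIndex ℓ t n =>
          functorE K r p.left ⋙ functorF K r (p.right h) ⋙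
            tensorFunctor (klrGrade K r m) (symSpace K r p.1)) ∧
    ∀ a : ℕ, Nonempty
      (cycFunctorF K r a (rfl : n + t = n + t) ⋙ cycFunctorE K r a h ≅
        dsumFunctor fun p : SummandIndex ℓ t n =>
          cycFunctorE K r a p.left ⋙ cycFunctorF K r a (p.right h) ⋙
            tensorFunctor (cycGrade K r m a) (truncSpace K r p.1 a)) := by
  exact ⟨(klrSystem K r).nonempty_mackey_iso h (symDots K r), fun a =>
    (cycSystem K r a).nonempty_mackey_iso h fun p => truncDots K r p a⟩
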